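/- Let $\mathcal E$ be the space of functions $u\in L^2(\mathbb C)$ of the form $u(z)=e^{-|z|^2/2}f(z)$ with $f$ entire, let $$[\Pi g](z)=\frac1\pi e^{-\frac{|z|^2}{2}}\int_{\mathbb C}e^{\overline w z-\frac{|w|^2}{2}}g(w)\,dL(w),$$ and consider the solutions $u:\mathbb R\to\mathcal E$, differentiable in time with respect to the $L^2$ norm, of $$i\partial_t u=\Pi(|u|^2u),\qquad u(0)=u_0\in\mathcal E. \tag{LLL}$$ Let $\|u\|_{L^{2,1}}=\|(1+|z|^2)^{1/2}u\|_{L^2(\mathbb C)}$, and write $L_su(z)=u(e^{is}z)$ and $R_\alpha u(z)=u(z+\alpha)e^{\frac12(\overline z\alpha-z\overline\alpha)}$. For $n\in\mathbb N$, $\alpha\in\mathbb C$ and $b\ge 0$ put $$\phi_n^\alpha(z)=\frac{1}{\sqrt{\pi n!}}(z-\overline\alpha)^ne^{-\frac{|z|^2}{2}-\frac{|\alpha|^2}{2}+\alpha z},\qquad \psi_b(z)=\frac{e^{-\frac12\left(\frac{b}{1+b^2}\right)^2}}{\sqrt{\pi(1+b^2)}}\Big(z-\frac{b(2+b^2)}{1+b^2}\Big)e^{-\frac12|z|^2+\frac{b}{1+b^2}z}.$$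 (i) There are $C,\delta_0>0$ such that for every $\alpha\in\mathbb C$, if $\|u_0-\phi_0^\alpha\|_{L^2}=\delta\le\delta_0$, then every solution $u$ of (LLL) with datum $u_0$ satisfies $$\sup_{t\in\mathbb R}\inf_{\theta\in\mathbb R,\,\beta\in\mathbb C}\|u(t)-e^{i\theta}\phi_0^\beta\|_{L^2}\le C\sqrt\delta.$$ (ii) For every $\alpha\in\mathbb C$ there are $C,\delta_0>0$ such that for $j=0$ and $j=1$, if $\|u_0-\phi_j^\alpha\|_{L^{2,1}}=\delta\le\delta_0$, then every solution $u$ of (LLL) with datum $u_0$ satisfies $$\sup_{t\in\mathbb R}\inf_{\theta\in\mathbb R}\|u(t)-e^{i\theta}\phi_j^\alpha\|_{L^{2,1}}\le C\sqrt\delta.$$ (iii) For every $b\ge0$ there are $C,\delta_0>0$ such that, if $\|u_0-\psi_b\|_{L^{2,1}}=\delta\le\delta_0$, then every solution $u$ of (LLL) with datum $u_0$ satisfies $$\sup_{t\in\mathbb R}\inf_{\theta,s\in\mathbb R}\|u(t)-e^{i\theta}L_s\psi_b\|_{L^{2,1}}\le C\sqrt\delta.$$ (iv) Let $v_0(z)=(\lambda_0z+\mu_0)e^{\alpha_0z-\frac12|z|^2}$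 with $\lambda_0,\mu_0,\alpha_0\in\mathbb C$, $\lambda_0\ne0$. Then there are $b\ge0$ and $c>0$ such that $v_0=c\,e^{i\theta}L_sR_\beta\psi_b$ for some $\theta,s\in\mathbb R$, $\beta\in\mathbb C$, and there are $C,\delta_0>0$ such that, if $\|u_0-v_0\|_{L^{2,1}}=\delta\le\delta_0$, then every solution $u$ of (LLL) with datum $u_0$ satisfies $$\sup_{t\in\mathbb R}\inf_{\theta,s\in\mathbb R,\,\beta\in\mathbb C}\|u(t)-c\,e^{i\theta}L_sR_\beta\psi_b\|_{L^{2,1}}\le C\sqrt\delta.$$ (v) For every $n\ge2$ and $\alpha\in\mathbb C$, the function $\phi_n^\alpha$ is not orbitally stable, even modulo all the symmetries above, neither in $L^2$ nor in $L^{2,1}$: for $X=L^2$ and for $X=L^{2,1}$, it is not true that for every $\varepsilon>0$ there is $\delta>0$ such that every solution $u$ of (LLL) with $\|u_0-\phi_n^\alpha\|_X\le\delta$ satisfies $\inf_{\theta,s\in\mathbb R,\,\beta\in\mathbb C}\|u(t)-e^{i\theta}L_sR_\beta\phi_n^\alpha\|_X\le\varepsilon$ for all $t\in\mathbb R$. 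-/

import Mathlib

open MeasureTheory Filter Topology
open scoped ENNReal ComplexConjugate

namespace LLL

noncomputable section

/-- The Bargmann-Fock space (lowest Landau level): the square-integrable functions on `ℂ` of the
form `z ↦ exp (-|z|² / 2) * f z` with `f` entire. -/
def fockSpace : Set (ℂ → ℂ) :=
  {u | (∃ f : ℂ → ℂ, Differentiable ℂ f ∧
      ∀ z, u z = (Real.exp (-‖z‖ ^ 2 / 2) : ℂ) * f z) ∧ MemLp u 2 volume}

/-- The `L²(ℂ)` norm with respect to Lebesgue measure. -/
def normL2 (u : ℂ → ℂ) : ℝ≥0∞ := eLpNorm u 2 volume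

/-- The weighted norm of `L^{2,1}`, that is `‖⟨z⟩ u‖_{L²}` with `⟨z⟩ = (1 + |z|²)^{1/2}`. -/
def normL21 (u : ℂ → ℂ) : ℝ≥0∞ :=
  eLpNorm (fun z : ℂ => (√(1 + ‖z‖ ^ 2) : ℂ) * u z) 2 volume

/-- The projector onto the lowest Landau level, given by its integral kernel
`π⁻¹ exp (-|z|² / 2 - |w|² / 2 + conj w * z)`. -/
def proj (g : ℂ → ℂ) (z : ℂ) : ℂ :=
  (1 / Real.pi : ℂ) * (Real.exp (-‖z‖ ^ 2 / 2) : ℂ) *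
    ∫ w : ℂ, Complex.exp (conj w * z - (‖w‖ ^ 2 : ℝ) / 2) * g w

/-- `u` is the global solution of `i ∂ₜ u = Π (|u|² u)`, `u 0 = u₀`, in the Bargmann-Fock space:
at each time the difference quotient in time converges in `L²(ℂ)`. -/
structure IsSolution (u₀ : ℂ → ℂ) (u : ℝ → ℂ → ℂ) : Prop where
  initial : u 0 = u₀
  mem : ∀ t, u t ∈ fockSpace
  eqn : ∀ t, Tendsto
    (fun h : ℝ => normL2 fun z =>
      Complex.I * ((u (t + h) z - u t z) / (h : ℂ))
        - proj (fun w => (‖u t w‖ ^ 2 : ℝ) * u t w) z)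
    (𝓝[≠] 0) (𝓝 0)

/-- Phase rotation `T_θ`. -/
def phaseRot (θ : ℝ) (u : ℂ → ℂ) : ℂ → ℂ := fun z => Complex.exp (Complex.I * θ) * u z

/-- Space rotation `L_s`. -/
def spaceRot (s : ℝ) (u : ℂ → ℂ) : ℂ → ℂ := fun z => u (Complex.exp (Complex.I * s) * z)

/-- Magnetic translation `R_α`. -/
def magTrans (α : ℂ) (u : ℂ → ℂ) : ℂ → ℂ :=
  fun z => u (z + α) * Complex.exp ((conj z * α - z * conj α) / 2)

/-- The stationary waves `φ_n^α`. -/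
def phi (n : ℕ) (α : ℂ) : ℂ → ℂ := fun z =>
  (1 / √(Real.pi * (n.factorial : ℝ)) : ℂ) * (z - conj α) ^ n *
    Complex.exp (-(‖z‖ ^ 2 : ℝ) / 2 - (‖α‖ ^ 2 : ℝ) / 2 + α * z)

/-- The stationary waves `ψ_b`. -/
def psi (b : ℝ) : ℂ → ℂ := fun z =>
  ((Real.exp (-(b / (1 + b ^ 2)) ^ 2 / 2) / √(Real.pi * (1 + b ^ 2)) : ℝ) : ℂ) *
    (z - (b * (2 + b ^ 2) / (1 + b ^ 2) : ℝ)) *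
    Complex.exp (-(‖z‖ ^ 2 : ℝ) / 2 + (b / (1 + b ^ 2) : ℝ) * z)

/-- Orbital stability of `φ`, for a norm `N`, relative to the set `O` of its images under a group
of symmetries: solutions starting close to `φ` stay close to `O` for all times. -/
def OrbitallyStable (N : (ℂ → ℂ) → ℝ≥0∞) (O : Set (ℂ → ℂ)) (φ : ℂ → ℂ) : Prop :=
  ∀ ε : ℝ, 0 < ε → ∃ δ : ℝ, 0 < δ ∧ ∀ u₀ u, IsSolution u₀ u →
    N (u₀ - φ) ≤ ENNReal.ofReal δ → ∀ t : ℝ, ⨅ w ∈ O, N (u t - w) ≤ ENNReal.ofReal ε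

/-- The images of `φ` under the group generated by the phase rotations, the space rotations and
the magnetic translations. -/
def fullOrbit (φ : ℂ → ℂ) : Set (ℂ → ℂ) :=
  {w | ∃ (θ s : ℝ) (β : ℂ), w = phaseRot θ (spaceRot s (magTrans β φ))}

end

end LLL

namespace LLL

noncomputable section

/-! In the basis of Hermite functions `φ_n` the Bargmann-Fock space is `ℓ²`. A pointwise product of
two of its elements is a dilate of a third one, which defines a bilinear contraction `prodMap`; up
to the factor `1 / (2π)`, `‖prodMap c c‖²` is the `L⁴` energy, and the equation becomes an ordinary
differential equation in `ℓ²` with a bounded cubic field (`proj_cubic`, `tendsto_diffQuot_iff`).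
Mass and energy are conserved. So are the angular momentum `P = ∑ n ‖c n‖²` and the magnetic
momentum `Q = ⟪c, z c⟫` when the datum is in `L^{2,1}` (`Sol.exists_raise`, `Sol.inner_raise_eq`).
The flow commutes with the magnetic translations `trans`.

Gaussians: `‖prodMap c c‖ ≤ ‖c‖²`, with equality at the Gaussians. In the translated frame that
maximizes the mass of mode zero, mode one vanishes, and the deficit in this inequality then controls
the distance to the Gaussians (`peak_deficit_le`); a continuity argument keeps the solution in the
region where this is valid. In the weighted norm, mass and angular momentum suffice, because `P`
vanishes only on multiples of the centred Gaussian.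

Profiles of degree one: `φ_1^α`, `ψ_b` and `v₀` are translates of `lin a b` with `b ≠ 0`. With `M`
the mass, the combination `P M - ‖Q‖² - 2 M² + 2 ‖prodMap c c‖²` (`lyap`) is conserved, invariant
under translations, and zero on this family. In the frame that maximizes the mass of modes zero and
one, mode two vanishes, and the quadratic part of `lyap` splits over the levels into nonnegative
forms. Three of these are degenerate; the shift relation between a function and its product with `z`
restores coercivity (`norm_sq_le_sum_density`). The remainder is then `O(√δ)` in the weighted norm,
while `P M - ‖Q‖²`, `M` and `Q` determine `‖b‖`, `‖a‖` and the translation in terms of the phases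
(`Sol.exists_decomposition`). Only the phases of `a` and `b` stay free, and they correspond to phase
and space rotations (`Sol.stability_lin`).

Instability: the linearization at `φ_n` couples mode `n + j` only with mode `n - j`. For `j = 2` and
`n ≥ 2` the coupling beats the detuning (`detuning_sq_lt`) and the pair grows exponentially. A
quadratic form that increases along solutions near `φ_n` shows that the solution issued from `√(1 -
η²) φ_n + η φ_{n+2}` leaves a fixed neighbourhood of the multiples of `φ_n` (`exists_escape`). This
datum has a parity, preserved by the flow, so being close to the translate by `β` means being close
to the translate by `-β`; hence `β` is small, and translations cannot account for the escape
(`exists_unstable`). -/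

/-! ### Parseval identities on the circle and for the Gaussian measure. -/

theorem setIntegral_exp_int_mul_I (k : ℤ) :
    ∫ θ in Set.Ioo (-Real.pi) Real.pi, Complex.exp (k * θ * Complex.I) =
      if k = 0 then (2 * Real.pi : ℂ) else 0 := by
  rw [← integral_Ioc_eq_integral_Ioo,
    ← intervalIntegral.integral_of_le (by linarith [Real.pi_pos])]
  split_ifs with hk
  · subst hk
    simp
    ring
  · have h : ((k : ℂ) * Complex.I) ≠ 0 := by simp [hk]
    have e : ∀ θ : ℝ, Complex.exp (k * θ * Complex.I) = Complex.exp ((k * Complex.I) * θ) := by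
      intro θ; ring_nf
    simp_rw [e]
    rw [integral_exp_mul_complex h]
    have : Complex.exp (k * Complex.I * (Real.pi : ℝ)) =
        Complex.exp (k * Complex.I * ((-Real.pi : ℝ) : ℂ)) := by
      rw [Complex.exp_eq_exp_iff_exists_int]
      exact ⟨k, by push_cast; ring⟩
    rw [this, sub_self, zero_div]

/-- The factor `y` is arbitrary because Parseval's identity needs two cases: a character, which
extracts a coefficient, and the conjugate of the sum itself. -/
theorem setIntegral_tsum_exp_mul {x : ℕ → ℂ} (hx : Summable fun n => ‖x n‖) (y : ℝ → ℂ)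
    (hy : Continuous y) :
    HasSum (fun n : ℕ => x n *
        ∫ θ in Set.Ioo (-Real.pi) Real.pi, Complex.exp (n * θ * Complex.I) * y θ)
      (∫ θ in Set.Ioo (-Real.pi) Real.pi, (∑' n : ℕ, x n * Complex.exp (n * θ * Complex.I)) * y θ)
      := by
  have hint : ∀ n : ℕ, IntegrableOn (fun θ : ℝ => x n * (Complex.exp (n * θ * Complex.I) * y θ))
      (Set.Ioo (-Real.pi) Real.pi) := fun n =>
    (Continuous.integrableOn_Icc (by fun_prop)).mono_set Set.Ioo_subset_Icc_self
  have h := hasSum_integral_of_summable_integral_norm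
    (μ := volume.restrict (Set.Ioo (-Real.pi) Real.pi)) hint ?_
  · convert! h using 1
    · ext n
      rw [integral_const_mul]
    · refine integral_congr_ae (Eventually.of_forall fun θ => ?_)
      simp only [← tsum_mul_right, mul_assoc]
  · have : ∀ n : ℕ, ∫ θ in Set.Ioo (-Real.pi) Real.pi,
        ‖x n * (Complex.exp (n * θ * Complex.I) * y θ)‖ =
        ‖x n‖ * ∫ θ in Set.Ioo (-Real.pi) Real.pi, ‖y θ‖ := by
      intro n
      rw [← integral_const_mul]
      refine integral_congr_ae (Eventually.of_forall fun θ => ?_)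
      have : ‖Complex.exp (n * θ * Complex.I)‖ = 1 := by
        have := Complex.norm_exp_ofReal_mul_I (n * θ)
        push_cast at this
        exact this
      simp [this]
    simp_rw [this]
    exact hx.mul_right _

theorem continuous_tsum_exp {x : ℕ → ℂ} (hx : Summable fun n => ‖x n‖) :
    Continuous fun θ : ℝ => ∑' n : ℕ, x n * Complex.exp (n * θ * Complex.I) := by
  refine continuous_tsum (fun n => by fun_prop) hx fun n θ => ?_
  have := Complex.norm_exp_ofReal_mul_I (n * θ)
  push_cast at this
  simp [this]

/-- Parseval's identity on the unit circle for absolutely convergent power series. -/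
theorem hasSum_sq_circle {x : ℕ → ℂ} (hx : Summable fun n => ‖x n‖) :
    HasSum (fun n => 2 * Real.pi * ‖x n‖ ^ 2) (∫ θ in Set.Ioo (-Real.pi) Real.pi,
      ‖∑' n : ℕ, x n * Complex.exp (n * θ * Complex.I)‖ ^ 2) := by
  set g : ℝ → ℂ := fun θ => ∑' n : ℕ, x n * Complex.exp (n * θ * Complex.I) with hg
  have hgc : Continuous g := continuous_tsum_exp hx
  have hcoef : ∀ m : ℕ, ∫ θ in Set.Ioo (-Real.pi) Real.pi,
      g θ * Complex.exp (-(m * θ * Complex.I)) = 2 * Real.pi * x m := by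
    intro m
    have h := setIntegral_tsum_exp_mul hx (fun θ => Complex.exp (-(m * θ * Complex.I)))
      (by fun_prop)
    rw [← h.tsum_eq]
    have : ∀ n : ℕ, x n * ∫ θ in Set.Ioo (-Real.pi) Real.pi,
        Complex.exp (n * θ * Complex.I) * Complex.exp (-(m * θ * Complex.I)) =
        if n = m then 2 * Real.pi * x m else 0 := by
      intro n
      have e : ∀ θ : ℝ, Complex.exp (n * θ * Complex.I) * Complex.exp (-(m * θ * Complex.I)) =
          Complex.exp (((n - m : ℤ) : ℂ) * θ * Complex.I) := by
        intro θ
        rw [← Complex.exp_add]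
        push_cast
        ring_nf
      simp_rw [e, setIntegral_exp_int_mul_I]
      by_cases hnm : n = m
      · subst hnm; simp; ring
      · rw [if_neg (by omega), if_neg hnm, mul_zero]
    simp_rw [this]
    simp
  have h := setIntegral_tsum_exp_mul hx (fun θ => conj (g θ)) (by fun_prop)
  have h2 : ∀ n : ℕ, ∫ θ in Set.Ioo (-Real.pi) Real.pi,
      Complex.exp (n * θ * Complex.I) * conj (g θ) = conj (2 * Real.pi * x n) := by
    intro n
    rw [← hcoef n, ← integral_conj]
    refine integral_congr_ae (Eventually.of_forall fun θ => ?_)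
    simp [← Complex.exp_conj, mul_comm]
  simp_rw [h2] at h
  have h3 : ∫ θ in Set.Ioo (-Real.pi) Real.pi, g θ * conj (g θ) =
      ((∫ θ in Set.Ioo (-Real.pi) Real.pi, ‖g θ‖ ^ 2 : ℝ) : ℂ) := by
    rw [← integral_complex_ofReal]
    refine integral_congr_ae (Eventually.of_forall fun θ => ?_)
    simp [Complex.mul_conj']
  have h4 : ∀ n, x n * conj (2 * Real.pi * x n) = ((2 * Real.pi * ‖x n‖ ^ 2 : ℝ) : ℂ) := by
    intro n
    simp only [map_mul, Complex.conj_ofReal, map_ofNat]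
    push_cast
    rw [← Complex.mul_conj']
    ring
  rw [h3] at h
  simp_rw [h4] at h
  exact Complex.hasSum_ofReal.mp h

theorem integral_pow_mul_exp_neg_sq (n : ℕ) :
    ∫ r in Set.Ioi (0 : ℝ), r ^ (2 * n + 1) * Real.exp (-r ^ 2) = n.factorial / 2 := by
  have h := integral_rpow_mul_exp_neg_mul_rpow (p := 2) (q := (2 * n + 1 : ℕ)) (b := 1)
    (by norm_num) (by push_cast; linarith [(Nat.cast_nonneg n : (0 : ℝ) ≤ n)]) one_pos
  have e : (((2 * n + 1 : ℕ) : ℝ) + 1) / 2 = n + 1 := by push_cast; ring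
  rw [e, Real.Gamma_nat_eq_factorial, Real.one_rpow] at h
  rw [show (n.factorial : ℝ) / 2 = 1 * (1 / 2) * n.factorial by ring, ← h]
  refine setIntegral_congr_fun measurableSet_Ioi fun r _ => ?_
  rw [Real.rpow_natCast, show (2 : ℝ) = ((2 : ℕ) : ℝ) by norm_num, Real.rpow_natCast]
  ring_nf

/-- A function that is not integrable has Bochner integral zero, whereas `n! / 2` is not zero. -/
theorem integrableOn_pow_mul_exp_neg_sq (n : ℕ) :
    IntegrableOn (fun r : ℝ => r ^ (2 * n + 1) * Real.exp (-r ^ 2)) (Set.Ioi 0) := by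
  by_contra h
  have := integral_undef h
  rw [integral_pow_mul_exp_neg_sq] at this
  have := n.factorial_pos
  simp_all [Nat.factorial_ne_zero]

/-- Parseval's identity for the Gaussian measure on the plane. -/
theorem lintegral_sq_powerSeries {a : ℕ → ℂ} (ha : ∀ r : ℝ, Summable fun n => ‖a n‖ * |r| ^ n)
    {f : ℂ → ℂ} (hf : ∀ z, f z = ∑' n, a n * z ^ n) (hfc : Continuous f) :
    ∫⁻ z, ENNReal.ofReal (‖f z‖ ^ 2 * Real.exp (-‖z‖ ^ 2)) =
      ∑' n : ℕ, ENNReal.ofReal (Real.pi * n.factorial * ‖a n‖ ^ 2) := by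
  -- Polar coordinates reduce to Parseval on each circle. Working in `ℝ≥0∞` requires no
  -- integrability of `f`.
  rw [← Complex.lintegral_comp_polarCoord_symm]
  have htar : polarCoord.target = Set.Ioi (0 : ℝ) ×ˢ Set.Ioo (-Real.pi) Real.pi := rfl
  rw [htar, Measure.volume_eq_prod, ← Measure.prod_restrict, lintegral_prod]
  swap
  · refine Measurable.aemeasurable ?_
    have : Continuous fun p : ℝ × ℝ => Complex.polarCoord.symm p := by
      simp only [Complex.polarCoord_symm_apply]; fun_prop
    simp only [smul_eq_mul]
    fun_prop
  have hin : ∀ r ∈ Set.Ioi (0 : ℝ), ∫⁻ θ in Set.Ioo (-Real.pi) Real.pi,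
      ENNReal.ofReal r • ENNReal.ofReal (‖f (Complex.polarCoord.symm (r, θ))‖ ^ 2 *
        Real.exp (-‖Complex.polarCoord.symm (r, θ)‖ ^ 2)) =
      ∑' n : ℕ, ENNReal.ofReal (2 * Real.pi * ‖a n‖ ^ 2 * (r ^ (2 * n + 1) * Real.exp (-r ^ 2))) := by
    intro r hr
    have hr0 : (0 : ℝ) < r := hr
    set x : ℕ → ℂ := fun n => a n * r ^ n with hx
    have hxs : Summable fun n => ‖x n‖ := by
      simpa [hx] using ha r
    have hfx : ∀ θ : ℝ, f (Complex.polarCoord.symm (r, θ)) =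
        ∑' n : ℕ, x n * Complex.exp (n * θ * Complex.I) := by
      intro θ
      rw [hf]
      refine tsum_congr fun n => ?_
      rw [Complex.polarCoord_symm_apply]
      simp only [Complex.ofReal_cos, Complex.ofReal_sin, ← Complex.exp_mul_I, mul_pow,
        ← Complex.exp_nat_mul, hx]
      ring_nf
    have hnorm : ∀ θ : ℝ, ‖Complex.polarCoord.symm (r, θ)‖ = r := by
      intro θ
      rw [Complex.norm_polarCoord_symm, abs_of_pos hr0]
    have hs := hasSum_sq_circle hxs
    have hcont := continuous_tsum_exp hxs
    calc _ = ∫⁻ θ in Set.Ioo (-Real.pi) Real.pi, ENNReal.ofReal (r * Real.exp (-r ^ 2)) *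
        ENNReal.ofReal (‖∑' n : ℕ, x n * Complex.exp (n * θ * Complex.I)‖ ^ 2) := by
          refine lintegral_congr fun θ => ?_
          rw [hfx, hnorm, smul_eq_mul, ← ENNReal.ofReal_mul hr0.le,
            ← ENNReal.ofReal_mul (by positivity)]
          congr 1
          ring
      _ = ENNReal.ofReal (r * Real.exp (-r ^ 2)) *
          ENNReal.ofReal (∑' n, 2 * Real.pi * ‖x n‖ ^ 2) := by
          rw [lintegral_const_mul _ (by fun_prop), hs.tsum_eq, ofReal_integral_eq_lintegral_ofReal]
          · exact (Continuous.integrableOn_Icc (by fun_prop)).mono_set Set.Ioo_subset_Icc_self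
          · exact Eventually.of_forall fun θ => by positivity
      _ = _ := by
          rw [ENNReal.ofReal_tsum_of_nonneg (fun n => by positivity) hs.summable,
            ← ENNReal.tsum_mul_left]
          refine tsum_congr fun n => ?_
          rw [← ENNReal.ofReal_mul (by positivity)]
          congr 1
          simp only [hx, norm_mul, norm_pow, Complex.norm_real, Real.norm_eq_abs, abs_of_pos hr0]
          ring
  rw [setLIntegral_congr_fun measurableSet_Ioi hin, lintegral_tsum fun n => by fun_prop]
  refine tsum_congr fun n => ?_
  rw [← ofReal_integral_eq_lintegral_ofReal]
  · rw [integral_const_mul, integral_pow_mul_exp_neg_sq]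
    congr 1
    ring
  · exact (integrableOn_pow_mul_exp_neg_sq n).const_mul _
  · filter_upwards [ae_restrict_mem measurableSet_Ioi] with r hr
    have : (0 : ℝ) < r := hr
    positivity


/-! ### The Bargmann-Fock space as a space of square-summable sequences. -/

/-- The Hilbert space of coefficients with respect to the Hermite basis `φ_n`. -/
abbrev Coeff : Type := lp (fun _ : ℕ => ℂ) 2

theorem Coeff.hasSum_norm_sq (c : Coeff) : HasSum (fun n => ‖c n‖ ^ 2) (‖c‖ ^ 2) := by
  have h := lp.hasSum_norm (p := 2) (by norm_num) c
  simpa using h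

theorem Coeff.norm_apply_le (c : Coeff) (n : ℕ) : ‖c n‖ ≤ ‖c‖ :=
  lp.norm_apply_le_norm (by norm_num) c n

theorem memℓp_two_iff {a : ℕ → ℂ} : Memℓp a 2 ↔ Summable fun n => ‖a n‖ ^ 2 := by
  rw [memℓp_gen_iff (by norm_num)]
  simp

/-- The element of `Coeff` with given square-summable coordinates. -/
def Coeff.mk (a : ℕ → ℂ) (ha : Summable fun n => ‖a n‖ ^ 2) : Coeff := ⟨a, memℓp_two_iff.2 ha⟩

@[simp] theorem Coeff.mk_apply (a : ℕ → ℂ) (ha : Summable fun n => ‖a n‖ ^ 2) (n : ℕ) :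
    Coeff.mk a ha n = a n := rfl

theorem Coeff.hasSum_inner (c d : Coeff) : HasSum (fun n => conj (c n) * d n) (inner ℂ c d) := by
  have h := lp.hasSum_inner (𝕜 := ℂ) c d
  simpa [RCLike.inner_apply, mul_comm] using h

/-- The coordinates of the evaluation functional at `z`. -/
def kerFun (z : ℂ) (n : ℕ) : ℂ :=
  (Real.exp (-‖z‖ ^ 2 / 2) / √(Real.pi * n.factorial) : ℝ) * conj z ^ n

theorem hasSum_norm_kerFun (z : ℂ) :
    HasSum (fun n => ‖kerFun z n‖ ^ 2) (1 / Real.pi) := by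
  have h := (NormedSpace.expSeries_div_hasSum_exp (𝔸 := ℝ) (‖z‖ ^ 2)).mul_left
    (Real.exp (-‖z‖ ^ 2) / Real.pi)
  rw [← Real.exp_eq_exp_ℝ, div_mul_eq_mul_div, ← Real.exp_add, neg_add_cancel, Real.exp_zero] at h
  refine h.congr_fun fun n => ?_
  have h1 : (0 : ℝ) ≤ Real.pi * n.factorial := by positivity
  have h2 : Real.exp (-‖z‖ ^ 2) = Real.exp (-‖z‖ ^ 2 / 2) ^ 2 := by
    rw [← Real.exp_nat_mul]; congr 1; push_cast; ring
  simp only [kerFun, norm_mul, norm_pow, RCLike.norm_conj, mul_pow, Complex.norm_real,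
    Real.norm_eq_abs, sq_abs, div_pow, Real.sq_sqrt h1, h2]
  field_simp
  ring

/-- The representer of the evaluation at `z` on the Bargmann-Fock space. -/
def ker (z : ℂ) : Coeff := Coeff.mk (kerFun z) (hasSum_norm_kerFun z).summable

/-- The function of the Bargmann-Fock space with given Hermite coefficients. -/
def fock (c : Coeff) (z : ℂ) : ℂ := inner ℂ (ker z) c

theorem fock_add (c d : Coeff) (z : ℂ) : fock (c + d) z = fock c z + fock d z := inner_add_right ..
theorem fock_sub (c d : Coeff) (z : ℂ) : fock (c - d) z = fock c z - fock d z := inner_sub_right ..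
theorem fock_smul (a : ℂ) (c : Coeff) (z : ℂ) : fock (a • c) z = a * fock c z :=
  inner_smul_right ..

/-- The Taylor coefficients of the entire part of `fock c`. -/
def taylorCoeff (c : Coeff) (n : ℕ) : ℂ := c n / (√(Real.pi * n.factorial) : ℝ)

/-- Each term is a product of `‖c n‖` and `|r| ^ n / √(π n!)`, both square summable in `n`, and `x y
≤ x² + y²` for nonnegative reals. -/
theorem summable_taylorCoeff (c : Coeff) (r : ℝ) :
    Summable fun n => ‖taylorCoeff c n‖ * |r| ^ n := by
  have h1 := (Real.summable_pow_div_factorial (r ^ 2)).mul_left (1 / Real.pi)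
  have h2 := (Coeff.hasSum_norm_sq c).summable
  refine Summable.of_nonneg_of_le (fun n => by positivity) (fun n => ?_) (h1.add h2)
  have h0 : (0 : ℝ) < Real.pi * n.factorial := by positivity
  have e : 1 / Real.pi * ((r ^ 2) ^ n / n.factorial) =
      (|r| ^ n / √(Real.pi * n.factorial)) ^ 2 := by
    rw [div_pow, Real.sq_sqrt h0.le, ← sq_abs r, ← pow_mul, ← pow_mul, mul_comm n 2]
    field_simp
  have e2 : ‖taylorCoeff c n‖ * |r| ^ n = ‖c n‖ * (|r| ^ n / √(Real.pi * n.factorial)) := by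
    simp only [taylorCoeff, norm_div, Complex.norm_real, Real.norm_eq_abs,
      abs_of_nonneg (Real.sqrt_nonneg _)]
    ring
  rw [e, e2]
  nlinarith [sq_nonneg (‖c n‖ - |r| ^ n / √(Real.pi * n.factorial)), norm_nonneg (c n),
    (by positivity : 0 ≤ |r| ^ n / √(Real.pi * n.factorial))]

/-- The entire part of `fock c`. -/
def entire (c : Coeff) (z : ℂ) : ℂ := ∑' n, taylorCoeff c n * z ^ n

theorem hasSum_entire (c : Coeff) (z : ℂ) :
    HasSum (fun n => taylorCoeff c n * z ^ n) (entire c z) := by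
  refine (Summable.of_norm ?_).hasSum
  simpa using summable_taylorCoeff c ‖z‖

theorem fock_eq (c : Coeff) (z : ℂ) :
    fock c z = (Real.exp (-‖z‖ ^ 2 / 2) : ℂ) * entire c z := by
  refine (Coeff.hasSum_inner (ker z) c).unique ?_
  refine ((hasSum_entire c z).mul_left _).congr_fun fun n => ?_
  simp only [ker, Coeff.mk_apply, kerFun, map_mul, map_pow, Complex.conj_conj, Complex.conj_ofReal,
    taylorCoeff]
  push_cast
  ring

theorem differentiable_entire (c : Coeff) : Differentiable ℂ (entire c) := by
  intro z
  have h := Complex.differentiableOn_tsum_of_summable_norm (U := Metric.ball 0 (‖z‖ + 1))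
    (F := fun n w => taylorCoeff c n * w ^ n) (summable_taylorCoeff c (‖z‖ + 1))
    (fun n => by fun_prop) Metric.isOpen_ball fun n w hw => by
      rw [norm_mul, norm_pow]
      have : ‖w‖ ≤ |‖z‖ + 1| := by
        rw [abs_of_nonneg (by positivity)]
        simpa using (Metric.mem_ball.1 hw).le
      gcongr
  exact (h z (by simp)).differentiableAt (Metric.isOpen_ball.mem_nhds (by simp))

theorem continuous_entire (c : Coeff) : Continuous (entire c) :=
  (differentiable_entire c).continuous

theorem continuous_fock (c : Coeff) : Continuous (fock c) := by
  have : fock c = fun z => (Real.exp (-‖z‖ ^ 2 / 2) : ℂ) * entire c z := funext (fock_eq c)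
  rw [this]
  have := continuous_entire c
  fun_prop

theorem norm_exp_mul_sq (z w : ℂ) :
    ‖(Real.exp (-‖z‖ ^ 2 / 2) : ℂ) * w‖ ^ 2 = ‖w‖ ^ 2 * Real.exp (-‖z‖ ^ 2) := by
  rw [norm_mul, mul_pow, Complex.norm_real, Real.norm_eq_abs, sq_abs, ← Real.exp_nat_mul, mul_comm]
  congr 2
  push_cast
  ring

theorem lintegral_norm_fock_sq (c : Coeff) :
    ∫⁻ z, ENNReal.ofReal (‖fock c z‖ ^ 2) = ENNReal.ofReal (‖c‖ ^ 2) := by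
  simp_rw [fock_eq, norm_exp_mul_sq]
  rw [lintegral_sq_powerSeries (summable_taylorCoeff c) 
      (f := entire c) (fun z => rfl) (continuous_entire c),
    ← (Coeff.hasSum_norm_sq c).tsum_eq, ENNReal.ofReal_tsum_of_nonneg (fun n => by positivity)
      (Coeff.hasSum_norm_sq c).summable]
  refine tsum_congr fun n => ?_
  have h0 : (0 : ℝ) < Real.pi * n.factorial := by positivity
  simp only [taylorCoeff, norm_div, Complex.norm_real, Real.norm_eq_abs,
      abs_of_nonneg (Real.sqrt_nonneg _), div_pow, Real.sq_sqrt h0.le]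
  congr 1
  field_simp

theorem eLpNorm_two_eq (u : ℂ → ℂ) :
    eLpNorm u 2 volume = (∫⁻ z, ENNReal.ofReal (‖u z‖ ^ 2)) ^ (1 / 2 : ℝ) := by
  rw [eLpNorm_eq_lintegral_rpow_enorm_toReal (by norm_num) (by norm_num)]
  simp only [ENNReal.toReal_ofNat]
  congr 1
  refine lintegral_congr fun z => ?_
  rw [← ofReal_norm, ENNReal.ofReal_rpow_of_nonneg (norm_nonneg _) (by norm_num)]
  norm_cast

theorem ofReal_sq_rpow_half {x : ℝ} (hx : 0 ≤ x) :
    (ENNReal.ofReal (x ^ 2)) ^ (1 / 2 : ℝ) = ENNReal.ofReal x := by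
  rw [ENNReal.ofReal_rpow_of_nonneg (by positivity) (by norm_num), ← Real.sqrt_eq_rpow,
    Real.sqrt_sq hx]

theorem normL2_fock (c : Coeff) : normL2 (fock c) = ENNReal.ofReal ‖c‖ := by
  rw [normL2, eLpNorm_two_eq, lintegral_norm_fock_sq, ofReal_sq_rpow_half (norm_nonneg _)]

theorem memLp_fock (c : Coeff) : MemLp (fock c) 2 volume :=
  ⟨(continuous_fock c).aestronglyMeasurable, by
    change normL2 (fock c) < ∞
    rw [normL2_fock]
    exact ENNReal.ofReal_lt_top⟩

theorem fock_mem (c : Coeff) : fock c ∈ fockSpace :=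
  ⟨⟨entire c, differentiable_entire c, fock_eq c⟩, memLp_fock c⟩

theorem fock_injective : Function.Injective fock := by
  intro c d h
  have : fock (c - d) = 0 := by
    ext z; simp [fock_sub, h]
  have h2 := normL2_fock (c - d)
  rw [this] at h2
  simp only [normL2, eLpNorm_zero] at h2
  have h3 := ENNReal.ofReal_eq_zero.1 h2.symm
  exact sub_eq_zero.1 (norm_le_zero_iff.1 h3)

theorem exists_powerSeries {f : ℂ → ℂ} (hf : Differentiable ℂ f) :
    ∃ a : ℕ → ℂ, (∀ r : ℝ, Summable fun n => ‖a n‖ * |r| ^ n) ∧ ∀ z, f z = ∑' n, a n * z ^ n := by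
  refine ⟨fun n => (n.factorial : ℂ)⁻¹ * iteratedDeriv n f 0, fun r => ?_, fun z => ?_⟩
  · have h := (Complex.hasSum_taylorSeries_of_entire hf 0 r).summable.norm
    refine h.congr fun n => ?_
    simp only [sub_zero, smul_eq_mul, norm_mul, norm_pow, Complex.norm_real, Real.norm_eq_abs]
    ring
  · rw [← Complex.taylorSeries_eq_of_entire' 0 z hf]
    simp

/-- Parseval's identity in `ℝ≥0∞` turns finiteness of the `L²` norm into square summability of the
rescaled Taylor coefficients. -/
theorem exists_fock {u : ℂ → ℂ} (hu : u ∈ fockSpace) : ∃ c : Coeff, u = fock c := by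
  obtain ⟨⟨f, hf, huf⟩, hL⟩ := hu
  obtain ⟨a, ha, hfa⟩ := exists_powerSeries hf
  have hP := lintegral_sq_powerSeries ha hfa hf.continuous
  have hfin : ∑' n : ℕ, ENNReal.ofReal (Real.pi * n.factorial * ‖a n‖ ^ 2) ≠ ∞ := by
    rw [← hP]
    have h2 := hL.2
    rw [eLpNorm_two_eq] at h2
    have h3 := (ENNReal.rpow_lt_top_iff_of_pos (by norm_num)).1 h2
    simp_rw [huf, norm_exp_mul_sq] at h3
    exact h3.ne
  have hsum : Summable fun n : ℕ => Real.pi * n.factorial * ‖a n‖ ^ 2 := by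
    have := ENNReal.summable_toReal hfin
    refine this.congr fun n => ENNReal.toReal_ofReal (by positivity)
  refine ⟨Coeff.mk (fun n => a n * (√(Real.pi * n.factorial) : ℝ)) (hsum.congr fun n => ?_), ?_⟩
  · rw [norm_mul, mul_pow, Complex.norm_real, Real.norm_eq_abs, sq_abs,
      Real.sq_sqrt (by positivity)]
    ring
  · ext z
    rw [huf, fock_eq, hfa, entire]
    congr 1
    refine tsum_congr fun n => ?_
    have h0 : √(Real.pi * n.factorial) ≠ 0 := (Real.sqrt_pos.2 (by positivity)).ne'
    simp only [taylorCoeff, Coeff.mk_apply]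
    rw [mul_div_cancel_right₀ _ (by exact_mod_cast h0)]

/-- The isometric embedding of the coefficient space into `L²(ℂ)`. -/
def fockLp : Coeff →ₗᵢ[ℂ] Lp ℂ 2 (volume : Measure ℂ) where
  toFun c := (memLp_fock c).toLp
  map_add' c d := by
    rw [← MemLp.toLp_add]
    congr 1
    ext z
    exact fock_add c d z
  map_smul' a c := by
    rw [RingHom.id_apply, ← MemLp.toLp_const_smul]
    congr 1
    ext z
    exact fock_smul a c z
  norm_map' c := by
    change ‖(memLp_fock c).toLp‖ = ‖c‖
    rw [Lp.norm_toLp]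
    have := normL2_fock c
    rw [normL2] at this
    rw [this, ENNReal.toReal_ofReal (norm_nonneg _)]

theorem integral_conj_fock_mul_fock (c d : Coeff) :
    ∫ z, conj (fock c z) * fock d z = inner ℂ c d := by
  rw [← fockLp.inner_map_map c d, L2.inner_def]
  refine integral_congr_ae ?_
  filter_upwards [(memLp_fock c).coeFn_toLp, (memLp_fock d).coeFn_toLp] with z hc hd
  have hc' : fockLp c z = fock c z := hc
  have hd' : fockLp d z = fock d z := hd
  rw [hc', hd', RCLike.inner_apply, mul_comm]


/-! ### Pointwise products and the cubic nonlinearity on coefficients. -/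

/-- The Clebsch-Gordan coefficients `(k+l choose k)^{1/2} 2^{-(k+l)/2}` of the product of two
Hermite functions. -/
def tau (k l : ℕ) : ℝ := √((k + l).choose k / 2 ^ (k + l))

theorem tau_nonneg (k l : ℕ) : 0 ≤ tau k l := Real.sqrt_nonneg _

theorem tau_pos (k l : ℕ) : 0 < tau k l := by
  have := Nat.choose_pos (Nat.le_add_right k l)
  exact Real.sqrt_pos.2 (by positivity)

theorem tau_sq (k l : ℕ) : tau k l ^ 2 = (k + l).choose k / 2 ^ (k + l) :=
  Real.sq_sqrt (by positivity)

theorem tau_comm (k l : ℕ) : tau k l = tau l k := by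
  rw [tau, tau, add_comm l k, Nat.choose_symm_add]

/-- The binomial theorem for `(1 + 1) ^ s`. By Cauchy-Schwarz this normalization makes `prodMap` a
contraction. -/
theorem sum_tau_sq (s : ℕ) : ∑ p ∈ Finset.HasAntidiagonal.antidiagonal s, tau p.1 p.2 ^ 2 = 1 := by
  have h : ∀ p ∈ Finset.HasAntidiagonal.antidiagonal s, tau p.1 p.2 ^ 2 = (s.choose p.1 : ℝ) / 2 ^ s := by
    intro p hp
    rw [tau_sq, Finset.HasAntidiagonal.mem_antidiagonal.1 hp]
  rw [Finset.sum_congr rfl h, ← Finset.sum_div,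
    Finset.Nat.sum_antidiagonal_eq_sum_range_succ_mk, ← Nat.cast_sum, Nat.sum_range_choose]
  simp

/-- The normalizations of the Hermite basis match: `√2 ^ (k + l)` comes from evaluation at `√2 z`
and cancels the power of two in `tau`. -/
theorem tau_mul_factorial (k l : ℕ) :
    tau k l * √2 ^ (k + l) / (√Real.pi * √(Real.pi * (k + l).factorial)) =
      1 / (√(Real.pi * k.factorial) * √(Real.pi * l.factorial)) := by
  have hc : ((k + l).choose k : ℝ) = (k + l).factorial / (k.factorial * l.factorial) := by
    rw [Nat.cast_add_choose]
  have h2 : √2 ^ (k + l) = √(2 ^ (k + l)) := by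
    rw [← Real.sqrt_sq (pow_nonneg (Real.sqrt_nonneg 2) (k + l)), ← pow_mul, mul_comm, pow_mul,
      Real.sq_sqrt (by norm_num)]
  rw [h2, tau, hc, ← Real.sqrt_mul (by positivity), ← Real.sqrt_mul (by positivity),
    ← Real.sqrt_mul (by positivity), ← Real.sqrt_div (by positivity), ← Real.sqrt_one,
    ← Real.sqrt_div (by positivity)]
  congr 1
  field_simp

theorem norm_sq_sum_tau_le (s : ℕ) (x : ℕ × ℕ → ℂ) :
    ‖∑ p ∈ Finset.HasAntidiagonal.antidiagonal s, tau p.1 p.2 * x p‖ ^ 2 ≤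
      ∑ p ∈ Finset.HasAntidiagonal.antidiagonal s, ‖x p‖ ^ 2 := by
  have h1 : ‖∑ p ∈ Finset.HasAntidiagonal.antidiagonal s, tau p.1 p.2 * x p‖ ≤
      ∑ p ∈ Finset.HasAntidiagonal.antidiagonal s, tau p.1 p.2 * ‖x p‖ := by
    refine (norm_sum_le _ _).trans_eq (Finset.sum_congr rfl fun p _ => ?_)
    rw [norm_mul, Complex.norm_real, Real.norm_eq_abs, abs_of_nonneg (tau_nonneg _ _)]
  calc _ ≤ (∑ p ∈ Finset.HasAntidiagonal.antidiagonal s, tau p.1 p.2 * ‖x p‖) ^ 2 := by gcongr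
    _ ≤ (∑ p ∈ Finset.HasAntidiagonal.antidiagonal s, tau p.1 p.2 ^ 2) *
        ∑ p ∈ Finset.HasAntidiagonal.antidiagonal s, ‖x p‖ ^ 2 := Finset.sum_mul_sq_le_sq_mul_sq ..
    _ = _ := by rw [sum_tau_sq, one_mul]

theorem hasSum_antidiagonal_mul {a b : ℕ → ℝ} {A B : ℝ}
    (hA : HasSum a A) (hB : HasSum b B) :
    HasSum (fun s => ∑ p ∈ Finset.HasAntidiagonal.antidiagonal s, a p.1 * b p.2) (A * B) := by
  have h := summable_norm_sum_mul_antidiagonal_of_summable_norm hA.summable.norm hB.summable.norm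
  rw [← hA.tsum_eq, ← hB.tsum_eq,
    tsum_mul_tsum_eq_tsum_sum_antidiagonal_of_summable_norm hA.summable.norm hB.summable.norm]
  exact h.of_norm.hasSum

/-- The coordinates of the product of two elements of the Bargmann-Fock space. -/
def prodFun (c d : Coeff) (s : ℕ) : ℂ :=
  ∑ p ∈ Finset.HasAntidiagonal.antidiagonal s, tau p.1 p.2 * (c p.1 * d p.2)

theorem hasSum_antidiagonal_norm (c d : Coeff) :
    HasSum (fun s => ∑ p ∈ Finset.HasAntidiagonal.antidiagonal s, ‖c p.1‖ ^ 2 * ‖d p.2‖ ^ 2)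
      (‖c‖ ^ 2 * ‖d‖ ^ 2) :=
  hasSum_antidiagonal_mul (a := fun n => ‖c n‖ ^ 2) (b := fun n => ‖d n‖ ^ 2)
    (Coeff.hasSum_norm_sq c) (Coeff.hasSum_norm_sq d)

theorem norm_prodFun_sq_le (c d : Coeff) (s : ℕ) : ‖prodFun c d s‖ ^ 2 ≤
    ∑ p ∈ Finset.HasAntidiagonal.antidiagonal s, ‖c p.1‖ ^ 2 * ‖d p.2‖ ^ 2 := by
  refine (norm_sq_sum_tau_le s _).trans_eq (Finset.sum_congr rfl fun p _ => ?_)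
  rw [norm_mul, mul_pow]

theorem summable_prodFun (c d : Coeff) : Summable fun s => ‖prodFun c d s‖ ^ 2 :=
  Summable.of_nonneg_of_le (fun s => by positivity) (norm_prodFun_sq_le c d)
    (hasSum_antidiagonal_norm c d).summable

/-- The bounded bilinear map on coefficients induced by the pointwise product. -/
def prodMap : Coeff →L[ℂ] Coeff →L[ℂ] Coeff :=
  LinearMap.mkContinuous₂
    (LinearMap.mk₂ ℂ (fun c d => Coeff.mk (prodFun c d) (summable_prodFun c d))
      (fun c c' d => by
        ext s
        simp only [Coeff.mk_apply, lp.coeFn_add, Pi.add_apply, prodFun, ← Finset.sum_add_distrib]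
        exact Finset.sum_congr rfl fun p _ => by ring)
      (fun a c d => by
        ext s
        simp only [Coeff.mk_apply, lp.coeFn_smul, Pi.smul_apply, prodFun, Finset.mul_sum,
          smul_eq_mul]
        exact Finset.sum_congr rfl fun p _ => by ring)
      (fun c d d' => by
        ext s
        simp only [Coeff.mk_apply, lp.coeFn_add, Pi.add_apply, prodFun, ← Finset.sum_add_distrib]
        exact Finset.sum_congr rfl fun p _ => by ring)
      (fun a c d => by
        ext s
        simp only [Coeff.mk_apply, lp.coeFn_smul, Pi.smul_apply, prodFun, Finset.mul_sum,
          smul_eq_mul]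
        exact Finset.sum_congr rfl fun p _ => by ring))
    1 fun c d => by
      have h : ‖Coeff.mk (prodFun c d) (summable_prodFun c d)‖ ^ 2 ≤ (‖c‖ * ‖d‖) ^ 2 := by
        rw [mul_pow]
        exact hasSum_le (norm_prodFun_sq_le c d)
          (Coeff.hasSum_norm_sq (Coeff.mk (prodFun c d) (summable_prodFun c d)))
          (hasSum_antidiagonal_norm c d)
      rw [one_mul]
      exact abs_le_of_sq_le_sq' h (by positivity) |>.2

theorem prodMap_apply (c d : Coeff) (s : ℕ) : prodMap c d s =
    ∑ p ∈ Finset.HasAntidiagonal.antidiagonal s, tau p.1 p.2 * (c p.1 * d p.2) := rfl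

theorem norm_prodMap_le (c d : Coeff) : ‖prodMap c d‖ ≤ ‖c‖ * ‖d‖ := by
  have h : ‖prodMap c d‖ ^ 2 ≤ (‖c‖ * ‖d‖) ^ 2 := by
    rw [mul_pow]
    exact hasSum_le (norm_prodFun_sq_le c d) (Coeff.hasSum_norm_sq (prodMap c d))
      (hasSum_antidiagonal_norm c d)
  exact abs_le_of_sq_le_sq' h (by positivity) |>.2

theorem prodMap_comm (c d : Coeff) : prodMap c d = prodMap d c := by
  ext s
  rw [prodMap_apply, prodMap_apply, ← Finset.Nat.sum_antidiagonal_swap]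
  exact Finset.sum_congr rfl fun p _ => by
    rw [tau_comm]; simp only [Prod.fst_swap, Prod.snd_swap]; ring

/-- The product carries the weight `exp (-‖z‖²)`, which is the Gaussian weight of the space at `√2
z`. Quartic integrals thereby become scalar products of coefficient sequences. -/
theorem fock_mul_fock (a b : Coeff) (z : ℂ) :
    fock a z * fock b z = (1 / √Real.pi : ℝ) * fock (prodMap a b) (√2 • z) := by
  have hn : ‖(√2 • z : ℂ)‖ ^ 2 = 2 * ‖z‖ ^ 2 := by
    rw [norm_smul, mul_pow, Real.norm_eq_abs, sq_abs, Real.sq_sqrt (by norm_num)]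
  have hE : Real.exp (-‖(√2 • z : ℂ)‖ ^ 2 / 2) =
      Real.exp (-‖z‖ ^ 2 / 2) * Real.exp (-‖z‖ ^ 2 / 2) := by
    rw [← Real.exp_add, hn]; congr 1; ring
  have hprod : entire a z * entire b z =
      (1 / √Real.pi : ℝ) * entire (prodMap a b) (√2 • z) := by
    have ha := (hasSum_entire a z).summable.norm
    have hb := (hasSum_entire b z).summable.norm
    rw [entire, entire, tsum_mul_tsum_eq_tsum_sum_antidiagonal_of_summable_norm ha hb, entire,
      ← tsum_mul_left]
    refine tsum_congr fun s => ?_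
    rw [taylorCoeff, prodMap_apply, Finset.sum_div, Finset.sum_mul, Finset.mul_sum]
    refine Finset.sum_congr rfl fun p hp => ?_
    have hs := Finset.HasAntidiagonal.mem_antidiagonal.1 hp
    subst hs
    have ht := tau_mul_factorial p.1 p.2
    have ht' : ((tau p.1 p.2 : ℂ) * (√2 : ℝ) ^ (p.1 + p.2) /
        ((√Real.pi : ℝ) * (√(Real.pi * (p.1 + p.2).factorial) : ℝ))) =
      1 / ((√(Real.pi * p.1.factorial) : ℝ) * (√(Real.pi * p.2.factorial) : ℝ)) := by
      exact_mod_cast congrArg (fun x : ℝ => (x : ℂ)) ht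
    simp only [taylorCoeff]
    calc _ = (a p.1 * b p.2) * z ^ (p.1 + p.2) * (1 / ((√(Real.pi * p.1.factorial) : ℝ) *
          (√(Real.pi * p.2.factorial) : ℝ))) := by rw [pow_add]; field_simp
      _ = _ := by
        rw [← ht', Complex.real_smul, mul_pow]
        push_cast
        field_simp
  rw [fock_eq, fock_eq, fock_eq, hE]
  push_cast
  push_cast at hprod
  linear_combination ((Complex.exp (-‖z‖ ^ 2 / 2)) ^ 2) * hprod

/-- In the constant, `1 / π` collects the prefactors of the two products and `1 / 2` is the Jacobian
of the dilation by `√2` in the plane. -/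
theorem integral_conj_mul_mul (a b c d : Coeff) :
    ∫ z, conj (fock a z * fock b z) * (fock c z * fock d z) =
      (1 / (2 * Real.pi) : ℂ) * inner ℂ (prodMap a b) (prodMap c d) := by
  simp_rw [fock_mul_fock]
  have h := Measure.integral_comp_smul (volume : Measure ℂ)
    (fun z => conj (fock (prodMap a b) z) * fock (prodMap c d) z) √2
  rw [integral_conj_fock_mul_fock, Complex.finrank_real_complex,
    Real.sq_sqrt (by norm_num)] at h
  have e : ∀ z : ℂ, conj (((1 / √Real.pi : ℝ) : ℂ) * fock (prodMap a b) (√2 • z)) *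
      (((1 / √Real.pi : ℝ) : ℂ) * fock (prodMap c d) (√2 • z)) = ((1 / Real.pi : ℝ) : ℂ) *
      (conj (fock (prodMap a b) (√2 • z)) * fock (prodMap c d) (√2 • z)) := by
    intro z
    have : ((1 / Real.pi : ℝ) : ℂ) = ((1 / √Real.pi : ℝ) : ℂ) * ((1 / √Real.pi : ℝ) : ℂ) := by
      rw [← Complex.ofReal_mul, div_mul_div_comm, Real.mul_self_sqrt Real.pi_pos.le, one_mul]
    rw [this, map_mul, Complex.conj_ofReal]
    ring
  simp_rw [e]
  rw [integral_const_mul, h, Complex.real_smul, abs_of_pos (by norm_num)]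
  push_cast
  field_simp

/-- The nonlinearity of the equation, read on coefficients. -/
def nonlin (c : Coeff) : Coeff :=
  (1 / (2 * Real.pi) : ℂ) • ContinuousLinearMap.adjoint (prodMap c) (prodMap c c)

theorem inner_nonlin (d c : Coeff) :
    inner ℂ d (nonlin c) = (1 / (2 * Real.pi) : ℂ) * inner ℂ (prodMap d c) (prodMap c c) := by
  rw [nonlin, inner_smul_right, ContinuousLinearMap.adjoint_inner_right, prodMap_comm c d]

/-- Summation of the exponential series; the outcome is the integral kernel of `proj`, which is
therefore the reproducing kernel of the space. -/
theorem inner_ker_ker (z w : ℂ) : inner ℂ (ker z) (ker w) =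
    (1 / Real.pi : ℂ) * (Real.exp (-‖z‖ ^ 2 / 2) : ℂ) *
      Complex.exp (conj w * z - (‖w‖ ^ 2 : ℝ) / 2) := by
  have h := (NormedSpace.expSeries_div_hasSum_exp (𝔸 := ℂ) (conj w * z)).mul_left
    ((1 / Real.pi : ℂ) * (Real.exp (-‖z‖ ^ 2 / 2) : ℂ) * (Real.exp (-‖w‖ ^ 2 / 2) : ℂ))
  rw [← Complex.exp_eq_exp_ℂ] at h
  refine (Coeff.hasSum_inner (ker z) (ker w)).unique ?_
  have e : (1 / Real.pi : ℂ) * (Real.exp (-‖z‖ ^ 2 / 2) : ℂ) *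
      Complex.exp (conj w * z - (‖w‖ ^ 2 : ℝ) / 2) =
      (1 / Real.pi : ℂ) * (Real.exp (-‖z‖ ^ 2 / 2) : ℂ) * (Real.exp (-‖w‖ ^ 2 / 2) : ℂ) *
        Complex.exp (conj w * z) := by
    rw [sub_eq_neg_add, Complex.exp_add]
    push_cast
    rw [neg_div]
    ring_nf
  rw [e]
  refine h.congr_fun fun n => ?_
  have h1 : (√(Real.pi * n.factorial) : ℂ) ^ 2 = Real.pi * n.factorial := by
    rw [← Complex.ofReal_pow, Real.sq_sqrt (by positivity)]
    push_cast; rfl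
  have h2 : (√(Real.pi * n.factorial) : ℂ) ≠ 0 := by
    have : √(Real.pi * n.factorial) ≠ 0 := (Real.sqrt_pos.2 (by positivity)).ne'
    exact_mod_cast this
  have h3 : (n.factorial : ℂ) ≠ 0 := by exact_mod_cast n.factorial_ne_zero
  have h4 : (Real.pi : ℂ) ≠ 0 := by exact_mod_cast Real.pi_ne_zero
  simp only [ker, Coeff.mk_apply, kerFun, map_mul, map_pow, Complex.conj_conj,
    Complex.conj_ofReal, mul_pow]
  simp only [Complex.ofReal_div]
  have h5 : (1 : ℂ) / (Real.pi * n.factorial) = 1 / (√(Real.pi * n.factorial) : ℂ) ^ 2 := by rw [h1]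
  calc _ = (Real.exp (-‖z‖ ^ 2 / 2) : ℂ) * (Real.exp (-‖w‖ ^ 2 / 2) : ℂ) * (conj w ^ n * z ^ n) *
        (1 / (√(Real.pi * n.factorial) : ℂ) ^ 2) := by field_simp
    _ = _ := by rw [← h5]; field_simp

/-- Since `proj` integrates against the reproducing kernel, its value at `z` is the quartic integral
of `ker z`, `c`, `c`, `c`. -/
theorem proj_cubic (c : Coeff) :
    proj (fun w => (‖fock c w‖ ^ 2 : ℝ) * fock c w) = fock (nonlin c) := by
  ext z
  rw [fock, inner_nonlin, ← integral_conj_mul_mul, proj, ← integral_const_mul]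
  refine integral_congr_ae (Eventually.of_forall fun w => ?_)
  have h : conj (fock (ker z) w) = inner ℂ (ker z) (ker w) := by
    rw [fock, inner_conj_symm]
  simp only [map_mul, h, inner_ker_ker]
  push_cast
  have hm : (‖fock c w‖ : ℂ) ^ 2 = conj (fock c w) * fock c w := (Complex.conj_mul' _).symm
  rw [hm]
  ring

/-! ### The equation as a differential equation in `ℓ²`. -/

/-- The equation, read on coefficients. -/
def Sol (c : ℝ → Coeff) : Prop := ∀ t, HasDerivAt c (-Complex.I • nonlin (c t)) t

theorem normL2_diffQuot (c : ℝ → Coeff) (t h : ℝ) :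
    normL2 (fun z => Complex.I * ((fock (c (t + h)) z - fock (c t) z) / (h : ℂ))
      - proj (fun w => (‖fock (c t) w‖ ^ 2 : ℝ) * fock (c t) w) z) =
      ENNReal.ofReal ‖h⁻¹ • (c (t + h) - c t) - (-Complex.I • nonlin (c t))‖ := by
  rw [proj_cubic]
  have : (fun z => Complex.I * ((fock (c (t + h)) z - fock (c t) z) / (h : ℂ))
      - fock (nonlin (c t)) z) =
      fock (Complex.I • ((h : ℂ)⁻¹ • (c (t + h) - c t) - (-Complex.I • nonlin (c t)))) := by
    ext z
    rw [fock_smul, fock_sub, fock_smul, fock_smul, fock_sub]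
    linear_combination (-fock (nonlin (c t)) z) * Complex.I_mul_I
  rw [this, normL2_fock, norm_smul, Complex.norm_I, one_mul, ← Complex.ofReal_inv,
    RCLike.real_smul_eq_coe_smul (K := ℂ) h⁻¹]
  rfl

theorem tendsto_diffQuot_iff (c : ℝ → Coeff) (t : ℝ) :
    Tendsto (fun h : ℝ => normL2 (fun z =>
      Complex.I * ((fock (c (t + h)) z - fock (c t) z) / (h : ℂ))
      - proj (fun w => (‖fock (c t) w‖ ^ 2 : ℝ) * fock (c t) w) z)) (𝓝[≠] 0) (𝓝 0) ↔
      HasDerivAt c (-Complex.I • nonlin (c t)) t := by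
  simp_rw [normL2_diffQuot]
  rw [hasDerivAt_iff_tendsto_slope_zero, tendsto_iff_norm_sub_tendsto_zero]
  constructor
  · intro h
    have := (ENNReal.tendsto_toReal ENNReal.zero_ne_top).comp h
    simpa [Function.comp_def] using this
  · intro h
    have := ENNReal.tendsto_ofReal h
    simpa using this

theorem IsSolution.exists_sol {u₀ : ℂ → ℂ} {u : ℝ → ℂ → ℂ} (hu : IsSolution u₀ u) :
    ∃ c : ℝ → Coeff, Sol c ∧ (∀ t, u t = fock (c t)) ∧ u₀ = fock (c 0) := by
  choose c hc using fun t => exists_fock (hu.mem t)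
  refine ⟨c, fun t => ?_, hc, by rw [← hc, hu.initial]⟩
  rw [← tendsto_diffQuot_iff]
  have := hu.eqn t
  simpa only [hc] using this

theorem Sol.isSolution {c : ℝ → Coeff} (hc : Sol c) :
    IsSolution (fock (c 0)) fun t => fock (c t) where
  initial := rfl
  mem _ := fock_mem _
  eqn _ := (tendsto_diffQuot_iff c _).2 (hc _)


/-! ### Coordinates as Taylor coefficients. -/

/-- Parseval's identity applied to the difference of the two series, whose sum is the zero function.
-/
theorem powerSeries_unique {a b : ℕ → ℂ} {f : ℂ → ℂ} (ha : ∀ z, HasSum (fun n => a n * z ^ n) (f z))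
    (hb : ∀ z, HasSum (fun n => b n * z ^ n) (f z)) (n : ℕ) : a n = b n := by
  have hd : ∀ z, HasSum (fun n => (a n - b n) * z ^ n) 0 := by
    intro z
    have := (ha z).sub (hb z)
    simpa [sub_mul] using this
  have hP := lintegral_sq_powerSeries (a := fun n => a n - b n) (f := fun _ => 0)
    (fun r => by simpa using (hd r).summable.norm) (fun z => (hd z).tsum_eq.symm) continuous_const
  simp only [norm_zero, ne_eq, OfNat.ofNat_ne_zero, not_false_eq_true, zero_pow, zero_mul,
    ENNReal.ofReal_zero, lintegral_zero] at hP
  have h := ENNReal.tsum_eq_zero.1 hP.symm n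
  rw [ENNReal.ofReal_eq_zero] at h
  have h0 : (0 : ℝ) < Real.pi * n.factorial := by positivity
  have h1 : ‖a n - b n‖ ^ 2 ≤ 0 := by nlinarith
  have h2 : ‖a n - b n‖ = 0 := by nlinarith [norm_nonneg (a n - b n)]
  exact sub_eq_zero.1 (norm_eq_zero.1 h2)

theorem taylorCoeff_eq_iteratedDeriv (c : Coeff) (n : ℕ) :
    taylorCoeff c n = (n.factorial : ℂ)⁻¹ * iteratedDeriv n (entire c) 0 := by
  refine powerSeries_unique (b := fun n => (n.factorial : ℂ)⁻¹ * iteratedDeriv n (entire c) 0)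
    (hasSum_entire c) (fun z => ?_) n
  have := Complex.hasSum_taylorSeries_of_entire (differentiable_entire c) 0 z
  refine this.congr_fun fun n => ?_
  simp only [sub_zero, smul_eq_mul]
  ring

theorem coeff_eq (c : Coeff) (n : ℕ) : c n = (√(Real.pi * n.factorial) : ℝ) *
    ((n.factorial : ℂ)⁻¹ * iteratedDeriv n (entire c) 0) := by
  have h0 : √(Real.pi * n.factorial) ≠ 0 := (Real.sqrt_pos.2 (by positivity)).ne'
  rw [← taylorCoeff_eq_iteratedDeriv, taylorCoeff, mul_div_cancel₀]
  exact_mod_cast h0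

theorem coeff_zero (c : Coeff) : c 0 = (√Real.pi : ℝ) * entire c 0 := by
  rw [coeff_eq]; simp

theorem coeff_one (c : Coeff) : c 1 = (√Real.pi : ℝ) * deriv (entire c) 0 := by
  rw [coeff_eq]; simp [iteratedDeriv_one]

theorem coeff_two (c : Coeff) : c 2 = (√(Real.pi * 2) / 2 : ℝ) * deriv (deriv (entire c)) 0 := by
  rw [coeff_eq, iteratedDeriv_succ, iteratedDeriv_one]
  simp [Nat.factorial]
  ring

theorem Coeff.eq_of_fock {c : Coeff} {a : ℕ → ℂ} (h : ∀ z, HasSum (fun n => a n * z ^ n)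
    (entire c z)) (n : ℕ) : c n = (√(Real.pi * n.factorial) : ℝ) * a n := by
  have h0 : √(Real.pi * n.factorial) ≠ 0 := (Real.sqrt_pos.2 (by positivity)).ne'
  rw [← powerSeries_unique (hasSum_entire c) h n, taylorCoeff, mul_div_cancel₀]
  exact_mod_cast h0

/-! ### Magnetic translations on coefficients -/

theorem norm_exp_magTrans (β z : ℂ) :
    ‖Complex.exp ((conj z * β - z * conj β) / 2)‖ = 1 := by
  have : (conj z * β - z * conj β) / 2 = ((conj z * β).im : ℂ) * Complex.I := by
    have h := Complex.sub_conj (conj z * β)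
    rw [map_mul, Complex.conj_conj] at h
    rw [h]; push_cast; ring
  rw [this, Complex.norm_exp_ofReal_mul_I]

theorem norm_magTrans (β : ℂ) (u : ℂ → ℂ) (z : ℂ) : ‖magTrans β u z‖ = ‖u (z + β)‖ := by
  rw [magTrans, norm_mul, norm_exp_magTrans, mul_one]

/-- The magnetic phase cancels exactly the antiholomorphic factor of the shifted Gaussian, so a
translate is again the weight times an entire function. -/
theorem exp_shift_eq (β z : ℂ) :
    (Real.exp (-‖z + β‖ ^ 2 / 2) : ℂ) * Complex.exp ((conj z * β - z * conj β) / 2) =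
      (Real.exp (-‖z‖ ^ 2 / 2) : ℂ) * Complex.exp (-(‖β‖ ^ 2 : ℝ) / 2 - conj β * z) := by
  push_cast
  rw [← Complex.exp_add, ← Complex.exp_add, ← Complex.conj_mul', ← Complex.conj_mul',
    ← Complex.conj_mul', map_add]
  congr 1
  ring

theorem magTrans_fock (β : ℂ) (c : Coeff) (z : ℂ) : magTrans β (fock c) z =
    (Real.exp (-‖z‖ ^ 2 / 2) : ℂ) *
      (Complex.exp (-(‖β‖ ^ 2 : ℝ) / 2 - conj β * z) * entire c (z + β)) := by
  rw [magTrans, fock_eq]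
  linear_combination (entire c (z + β)) * exp_shift_eq β z

theorem memLp_magTrans (β : ℂ) (c : Coeff) : MemLp (magTrans β (fock c)) 2 volume := by
  have h := (memLp_fock c).comp_measurePreserving (measurePreserving_add_right volume β)
  refine h.congr_norm ?_ (Eventually.of_forall fun z => (norm_magTrans β _ z).symm)
  have := continuous_fock c
  have h2 : Continuous (magTrans β (fock c)) := by unfold magTrans; fun_prop
  exact h2.aestronglyMeasurable

theorem magTrans_fock_mem (β : ℂ) (c : Coeff) : magTrans β (fock c) ∈ fockSpace := by
  refine ⟨⟨_, ?_, magTrans_fock β c⟩, memLp_magTrans β c⟩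
  have := differentiable_entire c
  fun_prop

theorem exists_trans (β : ℂ) (c : Coeff) : ∃ d, fock d = magTrans β (fock c) := by
  obtain ⟨d, hd⟩ := exists_fock (magTrans_fock_mem β c)
  exact ⟨d, hd.symm⟩

/-- The magnetic translation `R_β` on coefficients. -/
def trans (β : ℂ) : Coeff →ₗᵢ[ℂ] Coeff where
  toFun c := (exists_trans β c).choose
  map_add' c d := fock_injective <| by
    rw [(exists_trans β (c + d)).choose_spec]
    ext z
    rw [fock_add, (exists_trans β c).choose_spec, (exists_trans β d).choose_spec]
    simp only [magTrans, fock_add]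
    ring
  map_smul' a c := fock_injective <| by
    rw [(exists_trans β (a • c)).choose_spec]
    ext z
    rw [RingHom.id_apply, fock_smul, (exists_trans β c).choose_spec]
    simp only [magTrans, fock_smul]
    ring
  norm_map' c := by
    have h := normL2_fock (exists_trans β c).choose
    rw [(exists_trans β c).choose_spec] at h
    have h2 : normL2 (magTrans β (fock c)) = normL2 (fock c) := by
      unfold normL2
      rw [← eLpNorm_comp_measurePreserving (memLp_fock c).1 (measurePreserving_add_right volume β)]
      exact eLpNorm_congr_norm_ae (Eventually.of_forall (norm_magTrans β _))
    rw [h2, normL2_fock] at h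
    exact ((ENNReal.ofReal_eq_ofReal_iff (norm_nonneg _) (norm_nonneg _)).1 h).symm

theorem fock_trans (β : ℂ) (c : Coeff) : fock (trans β c) = magTrans β (fock c) :=
  (exists_trans β c).choose_spec

theorem entire_trans (β : ℂ) (c : Coeff) (z : ℂ) : entire (trans β c) z =
    Complex.exp (-(‖β‖ ^ 2 : ℝ) / 2 - conj β * z) * entire c (z + β) := by
  have h := congrFun (fock_trans β c) z
  rw [fock_eq, magTrans_fock] at h
  exact mul_left_cancel₀ (by exact_mod_cast (Real.exp_pos _).ne') h

theorem magTrans_magTrans (α β : ℂ) (u : ℂ → ℂ) (z : ℂ) :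
    magTrans α (magTrans β u) z =
      Complex.exp ((conj α * β - α * conj β) / 2) * magTrans (α + β) u z := by
  have h : Complex.exp ((conj (z + α) * β - (z + α) * conj β) / 2) *
      Complex.exp ((conj z * α - z * conj α) / 2) = Complex.exp ((conj α * β - α * conj β) / 2) *
      Complex.exp ((conj z * (α + β) - z * conj (α + β)) / 2) := by
    rw [← Complex.exp_add, ← Complex.exp_add, map_add, map_add]
    congr 1
    ring
  simp only [magTrans, add_assoc]
  linear_combination (u (z + (α + β))) * h

theorem trans_trans (α β : ℂ) (c : Coeff) :
    trans α (trans β c) = Complex.exp ((conj α * β - α * conj β) / 2) • trans (α + β) c := by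
  apply fock_injective
  ext z
  rw [fock_trans, fock_trans, magTrans_magTrans, fock_smul, fock_trans]

theorem trans_zero (c : Coeff) : trans 0 c = c := by
  apply fock_injective
  ext z
  simp [fock_trans, magTrans]

theorem trans_neg_trans (β : ℂ) (c : Coeff) : trans (-β) (trans β c) = c := by
  rw [trans_trans, neg_add_cancel, trans_zero, map_neg]
  ring_nf
  simp

theorem trans_trans_neg (β : ℂ) (c : Coeff) : trans β (trans (-β) c) = c := by
  simpa using trans_neg_trans (-β) c

/-- In the quartic integral the unimodular phases cancel, two being conjugated and two not, and
Lebesgue measure is translation invariant. -/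
theorem inner_prodMap_trans (β : ℂ) (a b c d : Coeff) :
    inner ℂ (prodMap (trans β a) (trans β b)) (prodMap (trans β c) (trans β d)) =
      inner ℂ (prodMap a b) (prodMap c d) := by
  have h : (1 / (2 * Real.pi) : ℂ) ≠ 0 := by
    have : (Real.pi : ℂ) ≠ 0 := by exact_mod_cast Real.pi_ne_zero
    simp [this]
  apply mul_left_cancel₀ h
  rw [← integral_conj_mul_mul, ← integral_conj_mul_mul,
    ← integral_add_right_eq_self (fun z => conj (fock a z * fock b z) * (fock c z * fock d z)) β]
  refine integral_congr_ae (Eventually.of_forall fun z => ?_)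
  simp only [fock_trans, magTrans, map_mul]
  have h1 : conj (Complex.exp ((conj z * β - z * conj β) / 2)) *
      Complex.exp ((conj z * β - z * conj β) / 2) = 1 := by
    rw [Complex.conj_mul', norm_exp_magTrans]; simp
  set e := Complex.exp ((conj z * β - z * conj β) / 2)
  linear_combination (conj (fock a (z + β)) * conj (fock b (z + β)) * fock c (z + β) *
    fock d (z + β)) * (conj e * e + 1) * h1

theorem norm_prodMap_trans (β : ℂ) (c : Coeff) :
    ‖prodMap (trans β c) (trans β c)‖ = ‖prodMap c c‖ := by
  have h := inner_prodMap_trans β c c c c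
  rw [inner_self_eq_norm_sq_to_K, inner_self_eq_norm_sq_to_K] at h
  have h2 : ‖prodMap (trans β c) (trans β c)‖ ^ 2 = ‖prodMap c c‖ ^ 2 := by exact_mod_cast h
  exact (sq_eq_sq₀ (norm_nonneg _) (norm_nonneg _)).1 h2

theorem nonlin_trans (β : ℂ) (c : Coeff) : nonlin (trans β c) = trans β (nonlin c) := by
  refine ext_inner_left ℂ fun d => ?_
  rw [← trans_trans_neg β d, inner_nonlin, inner_prodMap_trans, ← inner_nonlin,
    (trans β).inner_map_map]

theorem Sol.trans {c : ℝ → Coeff} (hc : Sol c) (β : ℂ) : Sol fun t => LLL.trans β (c t) := by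
  intro t
  have h := (LLL.trans β).toContinuousLinearMap.restrictScalars ℝ |>.hasFDerivAt.comp_hasDerivAt t
    (hc t)
  rw [nonlin_trans, ← map_smul]
  exact h

/-! ### Multiplication by the coordinate -/

/-- `Raise c e` says that `fock e` is the product of `fock c` with the coordinate `z`. -/
def Raise (c e : Coeff) : Prop := ∀ z, fock e z = z * fock c z

theorem Raise.entire {c e : Coeff} (h : Raise c e) (z : ℂ) :
    LLL.entire e z = z * LLL.entire c z := by
  have h := h z
  rw [fock_eq, fock_eq] at h
  refine mul_left_cancel₀ (a := (Real.exp (-‖z‖ ^ 2 / 2) : ℂ))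
    (by exact_mod_cast (Real.exp_pos _).ne') ?_
  rw [h]; ring

theorem Raise.unique {c e e' : Coeff} (h : Raise c e) (h' : Raise c e') : e = e' :=
  fock_injective (funext fun z => (h z).trans (h' z).symm)

theorem Raise.add {c e c' e' : Coeff} (h : Raise c e) (h' : Raise c' e') :
    Raise (c + c') (e + e') := fun z => by
  rw [fock_add, fock_add, h, h']; ring

theorem Raise.sub {c e c' e' : Coeff} (h : Raise c e) (h' : Raise c' e') :
    Raise (c - c') (e - e') := fun z => by
  rw [fock_sub, fock_sub, h, h']; ring

theorem Raise.smul {c e : Coeff} (h : Raise c e) (a : ℂ) : Raise (a • c) (a • e) := fun z => by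
  rw [fock_smul, fock_smul, h]; ring

theorem Raise.trans {c e : Coeff} (h : Raise c e) (β : ℂ) :
    Raise (LLL.trans β c) (LLL.trans β e - β • LLL.trans β c) := fun z => by
  rw [fock_sub, fock_smul, fock_trans, fock_trans, magTrans, magTrans, h]; ring

theorem hasSum_mul_entire (c : Coeff) (z : ℂ) :
    HasSum (fun n : ℕ => (if n = 0 then 0 else taylorCoeff c (n - 1)) * z ^ n) (z * entire c z) := by
  rw [← hasSum_nat_add_iff' 1]
  simp only [Finset.range_one, Finset.sum_singleton, if_pos, zero_mul, sub_zero,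
    Nat.add_eq_zero_iff, one_ne_zero, and_false, if_false, Nat.add_sub_cancel]
  refine ((hasSum_entire c z).mul_left z).congr_fun fun n => ?_
  ring

/-- Multiplication by `z` is the creation operator of the Hermite basis: a shift with the unbounded
weights `√(n + 1)`. This is why it is treated as a relation and not as an operator on `Coeff`. -/
theorem raise_iff {c e : Coeff} :
    Raise c e ↔ e 0 = 0 ∧ ∀ n : ℕ, e (n + 1) = (√(n + 1 : ℝ) : ℝ) * c n := by
  have key : ∀ n : ℕ, (√(Real.pi * (n + 1).factorial) : ℝ) / √(Real.pi * n.factorial) =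
      √(n + 1 : ℝ) := by
    intro n
    rw [← Real.sqrt_div (by positivity)]
    congr 1
    rw [Nat.factorial_succ]
    push_cast
    field_simp
  constructor
  · intro h
    have h1 : ∀ n, e n = _ := Coeff.eq_of_fock (c := e) fun z => by
      rw [h.entire]; exact hasSum_mul_entire c z
    refine ⟨by rw [h1]; simp, fun n => ?_⟩
    rw [h1, ← key]
    simp only [Nat.add_eq_zero_iff, one_ne_zero, and_false, if_false, Nat.add_sub_cancel,
      taylorCoeff]
    push_cast
    ring
  · rintro ⟨h0, h1⟩ z
    have : entire e z = z * entire c z := by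
      refine (hasSum_entire e z).unique ((hasSum_mul_entire c z).congr_fun fun n => ?_)
      cases n with
      | zero => simp [taylorCoeff, h0]
      | succ n =>
        have h2 : √(Real.pi * (n + 1).factorial) ≠ 0 := (Real.sqrt_pos.2 (by positivity)).ne'
        simp only [Nat.add_eq_zero_iff, one_ne_zero, and_false, if_false, Nat.add_sub_cancel,
          taylorCoeff, h1, ← key]
        congr 1
        have h2' : ((√(Real.pi * (n + 1).factorial) : ℝ) : ℂ) ≠ 0 := by exact_mod_cast h2
        rw [Complex.ofReal_div]
        field_simp
    rw [fock_eq, fock_eq, this]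
    ring

theorem Raise.hasSum {c e : Coeff} (h : Raise c e) :
    HasSum (fun n : ℕ => (n + 1 : ℝ) * ‖c n‖ ^ 2) (‖e‖ ^ 2) := by
  obtain ⟨h0, h1⟩ := raise_iff.1 h
  have h2 := (hasSum_nat_add_iff' 1).2 (Coeff.hasSum_norm_sq e)
  simp only [Finset.range_one, Finset.sum_singleton, h0, norm_zero, ne_eq, OfNat.ofNat_ne_zero,
    not_false_eq_true, zero_pow, sub_zero] at h2
  refine h2.congr_fun fun n => ?_
  rw [h1, norm_mul, mul_pow, Complex.norm_real, Real.norm_eq_abs, sq_abs,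
    Real.sq_sqrt (by positivity)]

theorem exists_raise {c : Coeff} (h : Summable fun n : ℕ => (n + 1 : ℝ) * ‖c n‖ ^ 2) :
    ∃ e, Raise c e := by
  refine ⟨Coeff.mk (fun n => if n = 0 then 0 else (√(n : ℝ) : ℝ) * c (n - 1)) ?_, ?_⟩
  · rw [← summable_nat_add_iff 1]
    refine h.congr fun n => ?_
    simp only [Nat.add_eq_zero_iff, one_ne_zero, and_false, if_false, Nat.add_sub_cancel]
    rw [norm_mul, mul_pow, Complex.norm_real, Real.norm_eq_abs, sq_abs,
      Real.sq_sqrt (by positivity)]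
    push_cast
    ring
  · rw [raise_iff]
    refine ⟨by simp, fun n => ?_⟩
    simp

/-- The `L^{2,1}` norm of an element of the Bargmann-Fock space. -/
theorem Raise.normL21 {c e : Coeff} (h : Raise c e) :
    LLL.normL21 (fock c) = ENNReal.ofReal √(‖c‖ ^ 2 + ‖e‖ ^ 2) := by
  have h1 : ∀ z : ℂ, ENNReal.ofReal (‖(√(1 + ‖z‖ ^ 2) : ℂ) * fock c z‖ ^ 2) =
      ENNReal.ofReal (‖fock c z‖ ^ 2) + ENNReal.ofReal (‖fock e z‖ ^ 2) := by
    intro z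
    rw [← ENNReal.ofReal_add (by positivity) (by positivity), h z, norm_mul, norm_mul, mul_pow,
      mul_pow, Complex.norm_real, Real.norm_eq_abs, sq_abs, Real.sq_sqrt (by positivity)]
    congr 1
    ring
  have hm : Measurable fun z => ENNReal.ofReal (‖fock c z‖ ^ 2) := by
    have := continuous_fock c
    fun_prop
  rw [LLL.normL21, eLpNorm_two_eq]
  simp_rw [h1]
  rw [lintegral_add_left hm, lintegral_norm_fock_sq, lintegral_norm_fock_sq,
    ← ENNReal.ofReal_add (by positivity) (by positivity), ← ofReal_sq_rpow_half (Real.sqrt_nonneg _),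
    Real.sq_sqrt (by positivity)]

theorem exists_raise_of_normL21 {c : Coeff} (h : normL21 (fock c) < ∞) : ∃ e, Raise c e := by
  have hc := continuous_fock c
  have hm : MemLp (fun z => (√(1 + ‖z‖ ^ 2) : ℂ) * fock c z) 2 volume :=
    ⟨(by fun_prop : Continuous fun z : ℂ => (√(1 + ‖z‖ ^ 2) : ℂ) * fock c z).aestronglyMeasurable,
      h⟩
  have hmem : (fun z => z * fock c z) ∈ fockSpace := by
    refine ⟨⟨fun z => z * entire c z, ?_, fun z => by simp only [fock_eq]; ring⟩, ?_⟩
    · have := differentiable_entire c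
      fun_prop
    · refine hm.mono (by fun_prop : Continuous fun z : ℂ => z * fock c z).aestronglyMeasurable
        (Eventually.of_forall fun z => ?_)
      rw [norm_mul, norm_mul, Complex.norm_real, Real.norm_eq_abs,
        abs_of_nonneg (Real.sqrt_nonneg _)]
      gcongr
      apply Real.le_sqrt_of_sq_le
      linarith
  obtain ⟨e, he⟩ := exists_fock hmem
  exact ⟨e, fun z => (congrFun he z).symm⟩


/-! ### Conservation of mass and energy. -/

theorem Sol.continuous {c : ℝ → Coeff} (hc : Sol c) : Continuous c :=
  continuous_iff_continuousAt.2 fun t => (hc t).continuousAt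

theorem inner_nonlin_self (c : Coeff) :
    inner ℂ c (nonlin c) = ((1 / (2 * Real.pi) * ‖prodMap c c‖ ^ 2 : ℝ) : ℂ) := by
  rw [inner_nonlin, inner_self_eq_norm_sq_to_K]
  push_cast
  rfl

/-- Conservation of mass. -/
theorem Sol.norm_eq {c : ℝ → Coeff} (hc : Sol c) (t : ℝ) : ‖c t‖ = ‖c 0‖ := by
  have h : ∀ t, HasDerivAt (fun t => inner ℂ (c t) (c t)) 0 t := by
    intro t
    have h := (hc t).inner ℂ (hc t)
    convert! h using 1
    rw [← inner_conj_symm (-Complex.I • nonlin (c t)), inner_smul_right, inner_nonlin_self, map_mul,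
      Complex.conj_ofReal, map_neg, Complex.conj_I]
    ring
  have h2 := is_const_of_deriv_eq_zero (fun t => (h t).differentiableAt) (fun t => (h t).deriv) t 0
  rw [inner_self_eq_norm_sq_to_K, inner_self_eq_norm_sq_to_K] at h2
  have h3 : ‖c t‖ ^ 2 = ‖c 0‖ ^ 2 := by exact_mod_cast h2
  exact (sq_eq_sq₀ (norm_nonneg _) (norm_nonneg _)).1 h3

theorem Sol.hasDerivAt_prodMap {c : ℝ → Coeff} {c' : Coeff} {t : ℝ} (hc : HasDerivAt c c' t) :
    HasDerivAt (fun t => prodMap (c t) (c t)) ((2 : ℂ) • prodMap c' (c t)) t := by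
  have h := (prodMap.isBoundedBilinearMap.hasFDerivAt (c t, c t)).restrictScalars ℝ
    |>.comp_hasDerivAt t (hc.prodMk hc)
  convert! h using 1
  simp only [ContinuousLinearMap.coe_restrictScalars', IsBoundedBilinearMap.deriv_apply]
  rw [prodMap_comm (c t) c', two_smul]

/-- Conservation of energy. -/
theorem Sol.norm_prodMap_eq {c : ℝ → Coeff} (hc : Sol c) (t : ℝ) :
    ‖prodMap (c t) (c t)‖ = ‖prodMap (c 0) (c 0)‖ := by
  have h : ∀ t, HasDerivAt (fun t => inner ℂ (prodMap (c t) (c t)) (prodMap (c t) (c t))) 0 t := by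
    intro t
    have h := (Sol.hasDerivAt_prodMap (hc t)).inner ℂ (Sol.hasDerivAt_prodMap (hc t))
    convert! h using 1
    have hpi : (Real.pi : ℂ) ≠ 0 := by exact_mod_cast Real.pi_ne_zero
    have h1 : inner ℂ (prodMap (-Complex.I • nonlin (c t)) (c t)) (prodMap (c t) (c t)) =
        (2 * Real.pi : ℂ) * inner ℂ (-Complex.I • nonlin (c t)) (nonlin (c t)) := by
      rw [inner_nonlin]
      field_simp
    rw [inner_smul_right, inner_smul_left, ← inner_conj_symm (prodMap (c t) (c t)), h1,
      inner_smul_left, inner_self_eq_norm_sq_to_K]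
    simp only [map_mul, map_neg, Complex.conj_I, Complex.conj_ofReal, map_ofNat, map_pow, neg_neg,
      Complex.coe_algebraMap]
    ring
  have h2 := is_const_of_deriv_eq_zero (fun t => (h t).differentiableAt) (fun t => (h t).deriv) t 0
  rw [inner_self_eq_norm_sq_to_K, inner_self_eq_norm_sq_to_K] at h2
  have h3 : ‖prodMap (c t) (c t)‖ ^ 2 = ‖prodMap (c 0) (c 0)‖ ^ 2 := by exact_mod_cast h2
  exact (sq_eq_sq₀ (norm_nonneg _) (norm_nonneg _)).1 h3

/-! ### Conservation of angular momentum -/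

/-- Multiplication of the coordinates by the truncated weights `min n N`. -/
def capWeight (N : ℕ) : Coeff →L[ℂ] Coeff :=
  LinearMap.mkContinuous
    { toFun := fun c => Coeff.mk (fun n => ((min n N : ℕ) : ℂ) * c n) (by
        refine Summable.of_nonneg_of_le (fun n => by positivity) (fun n => ?_)
          ((Coeff.hasSum_norm_sq c).summable.mul_left ((N : ℝ) ^ 2))
        rw [norm_mul, mul_pow, Complex.norm_natCast]
        gcongr
        exact min_le_right _ _)
      map_add' := fun c d => by
        ext n
        simp only [Coeff.mk_apply, lp.coeFn_add, Pi.add_apply]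
        ring
      map_smul' := fun a c => by
        ext n
        simp only [Coeff.mk_apply, lp.coeFn_smul, Pi.smul_apply, smul_eq_mul, RingHom.id_apply]
        ring }
    N fun c => by
      rw [← abs_of_nonneg (by positivity : (0 : ℝ) ≤ N * ‖c‖), ← abs_norm, ← sq_le_sq, mul_pow]
      refine hasSum_le (fun n => ?_) (Coeff.hasSum_norm_sq _)
        ((Coeff.hasSum_norm_sq c).mul_left ((N : ℝ) ^ 2))
      simp only [LinearMap.coe_mk, AddHom.coe_mk, Coeff.mk_apply]
      rw [norm_mul, mul_pow, Complex.norm_natCast]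
      gcongr
      exact min_le_right _ _

theorem capWeight_apply (N : ℕ) (c : Coeff) (n : ℕ) :
    capWeight N c n = ((min n N : ℕ) : ℂ) * c n := rfl

/-- The angular momentum with truncated weights. -/
def capMoment (N : ℕ) (c : Coeff) : ℝ := (inner ℂ (capWeight N c) c).re

theorem hasSum_capMoment (N : ℕ) (c : Coeff) :
    HasSum (fun n => ((min n N : ℕ) : ℝ) * ‖c n‖ ^ 2) (capMoment N c) := by
  have h := Complex.hasSum_re (Coeff.hasSum_inner (capWeight N c) c)
  refine h.congr_fun fun n => ?_
  rw [capWeight_apply, map_mul, Complex.conj_natCast, mul_assoc, Complex.conj_mul',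
    ← Complex.ofReal_pow, ← Complex.ofReal_natCast, ← Complex.ofReal_mul, Complex.ofReal_re]

theorem capMoment_nonneg (N : ℕ) (c : Coeff) : 0 ≤ capMoment N c :=
  (hasSum_capMoment N c).nonneg fun n => by positivity

theorem inner_capWeight_comm (N : ℕ) (c d : Coeff) :
    inner ℂ (capWeight N c) d = inner ℂ c (capWeight N d) := by
  refine (Coeff.hasSum_inner _ _).unique ((Coeff.hasSum_inner _ _).congr_fun fun n => ?_)
  rw [capWeight_apply, capWeight_apply, map_mul, Complex.conj_natCast]
  ring

/-- The time derivative of `capMoment`. -/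
def capFlux (N : ℕ) (c : Coeff) : ℝ :=
  1 / Real.pi * (inner ℂ (prodMap (capWeight N c) c) (prodMap c c)).im

theorem Sol.hasDerivAt_capMoment {c : ℝ → Coeff} (hc : Sol c) (N : ℕ) (t : ℝ) :
    HasDerivAt (fun t => capMoment N (c t)) (capFlux N (c t)) t := by
  have h1 : HasDerivAt (fun t => capWeight N (c t)) (capWeight N (-Complex.I • nonlin (c t))) t :=
    ((capWeight N).restrictScalars ℝ).hasFDerivAt.comp_hasDerivAt t (hc t)
  have h2 := Complex.reCLM.hasFDerivAt.comp_hasDerivAt t (h1.inner ℂ (hc t))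
  convert! h2 using 1
  rw [inner_capWeight_comm N (-Complex.I • nonlin (c t)),
    ← inner_conj_symm (-Complex.I • nonlin (c t)), inner_smul_right, inner_nonlin, capFlux]
  set x := inner ℂ (prodMap (capWeight N (c t)) (c t)) (prodMap (c t) (c t))
  have e : (-Complex.I * (1 / (2 * Real.pi) * x) : ℂ) = ((1 / (2 * Real.pi) : ℝ) : ℂ) * (-Complex.I * x) := by
    push_cast; ring
  rw [e]
  simp only [Complex.reCLM_apply, Complex.add_re, Complex.conj_re, Complex.re_ofReal_mul]
  simp
  field_simp
  norm_num

theorem continuous_capFlux (N : ℕ) : Continuous (capFlux N) := by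
  unfold capFlux
  have : Continuous fun c : Coeff => inner ℂ (prodMap (capWeight N c) c) (prodMap c c) := by
    fun_prop
  have := Complex.continuous_im.comp this
  exact this.const_mul _

/-- The mass of the tensor square on the level `k + l = s`. -/
def levelMass (c : Coeff) (s : ℕ) : ℝ :=
  ∑ p ∈ Finset.HasAntidiagonal.antidiagonal s, ‖c p.1‖ ^ 2 * ‖c p.2‖ ^ 2

theorem norm_prodMap_apply_sq_le (c : Coeff) (s : ℕ) :
    ‖prodMap c c s‖ ^ 2 ≤ levelMass c s := norm_prodFun_sq_le c c s

theorem levelMass_nonneg (c : Coeff) (s : ℕ) : 0 ≤ levelMass c s :=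
  Finset.sum_nonneg fun p _ => by positivity

/-- The antidiagonal and `tau` are symmetric, so the weight of the first index may be averaged with
the weight of the second. -/
theorem prodMap_capWeight_apply (N : ℕ) (c : Coeff) (s : ℕ) : prodMap (capWeight N c) c s =
    ∑ p ∈ Finset.HasAntidiagonal.antidiagonal s,
      tau p.1 p.2 * ((((min p.1 N + min p.2 N : ℕ) : ℂ) / 2) * (c p.1 * c p.2)) := by
  have h1 : prodMap (capWeight N c) c s = ∑ p ∈ Finset.HasAntidiagonal.antidiagonal s,
      tau p.1 p.2 * (((min p.1 N : ℕ) : ℂ) * (c p.1 * c p.2)) := by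
    rw [prodMap_apply]
    exact Finset.sum_congr rfl fun p _ => by rw [capWeight_apply]; ring
  have h2 : prodMap (capWeight N c) c s = ∑ p ∈ Finset.HasAntidiagonal.antidiagonal s,
      tau p.1 p.2 * (((min p.2 N : ℕ) : ℂ) * (c p.1 * c p.2)) := by
    rw [h1, ← Finset.Nat.sum_antidiagonal_swap]
    exact Finset.sum_congr rfl fun p _ => by
      rw [tau_comm]; simp only [Prod.fst_swap, Prod.snd_swap]; ring
  have h3 : prodMap (capWeight N c) c s = (prodMap (capWeight N c) c s +
      prodMap (capWeight N c) c s) / 2 := by ring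
  rw [h3]
  nth_rw 1 [h1]
  rw [h2, ← Finset.sum_add_distrib, Finset.sum_div]
  exact Finset.sum_congr rfl fun p _ => by push_cast; ring

/-- Up to level `N` nothing is truncated: the averaged weight is the constant `s / 2` on the
antidiagonal, and a real factor contributes no imaginary part. -/
theorem im_conj_capWeight_of_le {N s : ℕ} (hs : s ≤ N) (c : Coeff) :
    (conj (prodMap (capWeight N c) c s) * prodMap c c s).im = 0 := by
  have : prodMap (capWeight N c) c s = ((s / 2 : ℝ) : ℂ) * prodMap c c s := by
    rw [prodMap_capWeight_apply, prodMap_apply, Finset.mul_sum]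
    refine Finset.sum_congr rfl fun p hp => ?_
    have hp := Finset.HasAntidiagonal.mem_antidiagonal.1 hp
    rw [min_eq_left (by omega), min_eq_left (by omega), hp]
    push_cast
    ring
  rw [this, map_mul, Complex.conj_ofReal, mul_assoc, Complex.conj_mul', ← Complex.ofReal_pow,
    ← Complex.ofReal_mul, Complex.ofReal_im]

theorem abs_im_conj_capWeight_le {N : ℕ} (c : Coeff) (s : ℕ) {K : ℕ}
    (hK : ∀ p ∈ Finset.HasAntidiagonal.antidiagonal s, min p.1 N + min p.2 N ≤ K) :
    |(conj (prodMap (capWeight N c) c s) * prodMap c c s).im| ≤ K / 2 * levelMass c s := by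
  have h1 : ‖prodMap (capWeight N c) c s‖ ^ 2 ≤ (K / 2 : ℝ) ^ 2 * levelMass c s := by
    rw [prodMap_capWeight_apply, levelMass, Finset.mul_sum]
    refine (norm_sq_sum_tau_le s _).trans (Finset.sum_le_sum fun p hp => ?_)
    have : ((min p.1 N + min p.2 N : ℕ) : ℝ) ≤ K := by exact_mod_cast hK p hp
    rw [norm_mul, norm_mul, norm_div, Complex.norm_natCast, mul_pow, mul_pow, Complex.norm_ofNat]
    gcongr
  have h2 := norm_prodMap_apply_sq_le c s
  have h0 := levelMass_nonneg c s
  have h3 := Complex.abs_im_le_norm (conj (prodMap (capWeight N c) c s) * prodMap c c s)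
  rw [norm_mul, RCLike.norm_conj] at h3
  refine h3.trans (abs_le_of_sq_le_sq' ?_ ?_).2
  · rw [mul_pow]
    calc _ ≤ ((K / 2 : ℝ) ^ 2 * levelMass c s) * levelMass c s := by gcongr
      _ = _ := by ring
  · positivity

/-- The truncated angular momentum of the tensor square on the level `k + l = s`. -/
def capLevelMoment (N : ℕ) (c : Coeff) (s : ℕ) : ℝ :=
  ∑ p ∈ Finset.HasAntidiagonal.antidiagonal s,
    ((min p.1 N + min p.2 N : ℕ) : ℝ) * (‖c p.1‖ ^ 2 * ‖c p.2‖ ^ 2)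

theorem hasSum_capLevelMoment (N : ℕ) (c : Coeff) :
    HasSum (capLevelMoment N c) (2 * capMoment N c * ‖c‖ ^ 2) := by
  have h1 := hasSum_antidiagonal_mul (hasSum_capMoment N c) (Coeff.hasSum_norm_sq c)
  have h2 := hasSum_antidiagonal_mul (Coeff.hasSum_norm_sq c) (hasSum_capMoment N c)
  have h := h1.add h2
  convert! h using 1
  · ext s
    rw [capLevelMoment, ← Finset.sum_add_distrib]
    exact Finset.sum_congr rfl fun p _ => by push_cast; ring
  · ring

/-- Above level `N` the two truncated weights add up to at least `N` and at most `2 N`, so the flux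
is bounded by the truncated moment itself. This makes the Gronwall estimate uniform in `N`. -/
theorem abs_im_conj_capWeight_le_moment (N : ℕ) (c : Coeff) (s : ℕ) :
    |(conj (prodMap (capWeight N c) c s) * prodMap c c s).im| ≤ capLevelMoment N c s := by
  rcases le_or_gt s N with hs | hs
  · rw [im_conj_capWeight_of_le hs, abs_zero]
    exact Finset.sum_nonneg fun p _ => by positivity
  · refine (abs_im_conj_capWeight_le c s (K := 2 * N) fun p _ => by omega).trans ?_
    rw [levelMass, capLevelMoment, Finset.mul_sum]
    refine Finset.sum_le_sum fun p hp => ?_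
    have hp := Finset.HasAntidiagonal.mem_antidiagonal.1 hp
    have : N ≤ min p.1 N + min p.2 N := by omega
    have : (N : ℝ) ≤ ((min p.1 N + min p.2 N : ℕ) : ℝ) := by exact_mod_cast this
    push_cast at this ⊢
    gcongr
    linarith

theorem hasSum_capFlux (N : ℕ) (c : Coeff) :
    HasSum (fun s => (conj (prodMap (capWeight N c) c s) * prodMap c c s).im)
      (Real.pi * capFlux N c) := by
  have h := Complex.hasSum_im (Coeff.hasSum_inner (prodMap (capWeight N c) c) (prodMap c c))
  convert! h using 1
  rw [capFlux]
  field_simp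

theorem abs_capFlux_le (N : ℕ) (c : Coeff) :
    |capFlux N c| ≤ 2 * ‖c‖ ^ 2 * capMoment N c := by
  have h := hasSum_capFlux N c
  have h1 := hasSum_capLevelMoment N c
  have h3 : |Real.pi * capFlux N c| ≤ 2 * capMoment N c * ‖c‖ ^ 2 := by
    rw [abs_le]
    exact ⟨hasSum_le (fun s => (abs_le.1 (abs_im_conj_capWeight_le_moment N c s)).1) h1.neg h,
      hasSum_le (fun s => (abs_le.1 (abs_im_conj_capWeight_le_moment N c s)).2) h h1⟩
  rw [abs_mul, abs_of_pos Real.pi_pos] at h3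
  nlinarith [Real.pi_gt_three, abs_nonneg (capFlux N c)]

theorem summable_level_moment {c : Coeff} (h : Summable fun n : ℕ => (n : ℝ) * ‖c n‖ ^ 2) :
    Summable fun s : ℕ => (s : ℝ) * levelMass c s := by
  have h1 := (hasSum_antidiagonal_mul h.hasSum (Coeff.hasSum_norm_sq c)).summable
  have h2 := (hasSum_antidiagonal_mul (Coeff.hasSum_norm_sq c) h.hasSum).summable
  refine (h1.add h2).congr fun s => ?_
  rw [levelMass, Finset.mul_sum, ← Finset.sum_add_distrib]
  refine Finset.sum_congr rfl fun p hp => ?_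
  rw [← Finset.HasAntidiagonal.mem_antidiagonal.1 hp]
  push_cast
  ring

/-- Each level contributes zero as soon as `N` reaches it, and `s * levelMass c s` is a summable
majorant because the moment is finite. -/
theorem tendsto_capFlux {c : Coeff} (h : Summable fun n : ℕ => (n : ℝ) * ‖c n‖ ^ 2) :
    Tendsto (fun N => capFlux N c) atTop (𝓝 0) := by
  have hb := summable_level_moment h
  have h0 := tendsto_tsum_of_dominated_convergence (𝓕 := atTop)
    (f := fun (N : ℕ) (s : ℕ) => (conj (prodMap (capWeight N c) c s) * prodMap c c s).im)
    (g := fun _ => (0 : ℝ)) hb (fun s => ?_) (Eventually.of_forall fun N s => ?_)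
  · simp only [tsum_zero, fun N => (hasSum_capFlux N c).tsum_eq] at h0
    have h1 := h0.const_mul (1 / Real.pi)
    rw [mul_zero] at h1
    refine h1.congr fun N => ?_
    field_simp
  · refine tendsto_const_nhds.congr' ?_
    filter_upwards [eventually_ge_atTop s] with N hN
    exact (im_conj_capWeight_of_le hN c).symm
  · rw [Real.norm_eq_abs]
    refine (abs_im_conj_capWeight_le c s (K := s) fun p hp => ?_).trans ?_
    · have hp := Finset.HasAntidiagonal.mem_antidiagonal.1 hp
      omega
    · have h2 := levelMass_nonneg c s
      have : (0 : ℝ) ≤ s := by positivity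
      nlinarith

theorem tendsto_capMoment {c : Coeff} (h : Summable fun n : ℕ => (n : ℝ) * ‖c n‖ ^ 2) :
    Tendsto (fun N => capMoment N c) atTop (𝓝 (∑' n : ℕ, (n : ℝ) * ‖c n‖ ^ 2)) := by
  have h0 := tendsto_tsum_of_dominated_convergence (𝓕 := atTop)
    (f := fun (N : ℕ) (n : ℕ) => ((min n N : ℕ) : ℝ) * ‖c n‖ ^ 2)
    (g := fun n => (n : ℝ) * ‖c n‖ ^ 2) h (fun n => ?_) (Eventually.of_forall fun N n => ?_)
  · simpa only [fun N => (hasSum_capMoment N c).tsum_eq] using h0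
  · refine tendsto_const_nhds.congr' ?_
    filter_upwards [eventually_ge_atTop n] with N hN
    rw [min_eq_left hN]
  · rw [Real.norm_of_nonneg (by positivity)]
    gcongr
    exact min_le_left _ _

theorem abs_le_mul_exp_of_abs_deriv_le {f f' : ℝ → ℝ} {K : ℝ} (hf : ∀ t, HasDerivAt f (f' t) t)
    (hb : ∀ t, |f' t| ≤ K * |f t|) (t : ℝ) : |f t| ≤ |f 0| * Real.exp (K * |t|) := by
  have key : ∀ {g g' : ℝ → ℝ}, (∀ t, HasDerivAt g (g' t) t) → (∀ t, |g' t| ≤ K * |g t|) →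
      ∀ t, 0 ≤ t → |g t| ≤ |g 0| * Real.exp (K * t) := by
    intro g g' hg hgb t ht
    have h := norm_le_gronwallBound_of_norm_deriv_right_le (f := g) (f' := g') (δ := |g 0|)
      (K := K) (ε := 0) (a := 0) (b := t)
      (fun x _ => (hg x).continuousAt.continuousWithinAt) (fun x _ => (hg x).hasDerivWithinAt)
      le_rfl (fun x _ => by simpa using hgb x) t ⟨ht, le_rfl⟩
    rw [gronwallBound_ε0, sub_zero] at h
    exact h
  rcases le_total 0 t with ht | ht
  · rw [abs_of_nonneg ht]
    exact key hf hb t ht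
  · have h := key (g := fun t => f (-t)) (g' := fun t => -f' (-t)) (fun t => by
      have := (hf (-t)).scomp t (hasDerivAt_neg t)
      simpa using! this) (fun t => by rw [abs_neg]; exact hb (-t)) (-t) (by linarith)
    simpa [abs_of_nonpos ht] using h

theorem Sol.capMoment_le {c : ℝ → Coeff} (hc : Sol c) (N : ℕ) (t : ℝ) :
    capMoment N (c t) ≤ capMoment N (c 0) * Real.exp (2 * ‖c 0‖ ^ 2 * |t|) := by
  have h := abs_le_mul_exp_of_abs_deriv_le (K := 2 * ‖c 0‖ ^ 2) (hc.hasDerivAt_capMoment N)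
    (fun t => by
      rw [abs_of_nonneg (capMoment_nonneg N (c t)), ← hc.norm_eq t]
      exact abs_capFlux_le N (c t)) t
  rwa [abs_of_nonneg (capMoment_nonneg _ _), abs_of_nonneg (capMoment_nonneg _ _)] at h

theorem capMoment_le_tsum {c : Coeff} (h : Summable fun n : ℕ => (n : ℝ) * ‖c n‖ ^ 2) (N : ℕ) :
    capMoment N c ≤ ∑' n : ℕ, (n : ℝ) * ‖c n‖ ^ 2 :=
  hasSum_le (fun n => by gcongr; exact min_le_left _ _) (hasSum_capMoment N c) h.hasSum

theorem Sol.summable_moment {c : ℝ → Coeff} (hc : Sol c)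
    (h : Summable fun n : ℕ => (n : ℝ) * ‖c 0 n‖ ^ 2) (t : ℝ) :
    Summable fun n : ℕ => (n : ℝ) * ‖c t n‖ ^ 2 := by
  refine summable_of_sum_range_le (c := (∑' n : ℕ, (n : ℝ) * ‖c 0 n‖ ^ 2) *
    Real.exp (2 * ‖c 0‖ ^ 2 * |t|)) (fun n => by positivity) fun N => ?_
  calc _ = ∑ n ∈ Finset.range N, ((min n N : ℕ) : ℝ) * ‖c t n‖ ^ 2 :=
        Finset.sum_congr rfl fun n hn => by rw [min_eq_left (Finset.mem_range.1 hn).le]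
    _ ≤ capMoment N (c t) := sum_le_hasSum _ (fun n _ => by positivity) (hasSum_capMoment N _)
    _ ≤ _ := hc.capMoment_le N t
    _ ≤ _ := by gcongr; exact capMoment_le_tsum h N

theorem Sol.tsum_moment_eq {c : ℝ → Coeff} (hc : Sol c)
    (h : Summable fun n : ℕ => (n : ℝ) * ‖c 0 n‖ ^ 2) (t : ℝ) :
    ∑' n : ℕ, (n : ℝ) * ‖c t n‖ ^ 2 = ∑' n : ℕ, (n : ℝ) * ‖c 0 n‖ ^ 2 := by
  have hct := hc.continuous
  have hint : ∀ N, ∫ τ in (0 : ℝ)..t, capFlux N (c τ) = capMoment N (c t) - capMoment N (c 0) :=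
    fun N => intervalIntegral.integral_eq_sub_of_hasDerivAt
      (fun τ _ => hc.hasDerivAt_capMoment N τ)
      (((continuous_capFlux N).comp hct).intervalIntegrable _ _)
  -- At each time the flux tends to zero, and the Gronwall bound dominates it uniformly in `N` on
  -- the interval between `0` and `t`.
  have hlim : Tendsto (fun N => ∫ τ in (0 : ℝ)..t, capFlux N (c τ)) atTop
      (𝓝 (∫ _ in (0 : ℝ)..t, (0 : ℝ))) := by
    refine intervalIntegral.tendsto_integral_filter_of_dominated_convergence
      (fun _ => 2 * ‖c 0‖ ^ 2 * ((∑' n : ℕ, (n : ℝ) * ‖c 0 n‖ ^ 2) *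
        Real.exp (2 * ‖c 0‖ ^ 2 * |t|))) ?_ ?_ (by simp) ?_
    · exact Eventually.of_forall fun N =>
        ((continuous_capFlux N).comp hct).aestronglyMeasurable
    · refine Eventually.of_forall fun N => Eventually.of_forall fun τ hτ => ?_
      have hτ' : |τ| ≤ |t| := by
        rcases Set.mem_uIoc.1 hτ with h | h
        · rw [abs_of_pos h.1, abs_of_pos (h.1.trans_le h.2)]; exact h.2
        · rw [abs_of_nonpos h.2, abs_of_neg (h.1.trans_le h.2)]; linarith
      rw [Real.norm_eq_abs]
      refine (abs_capFlux_le N (c τ)).trans ?_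
      rw [hc.norm_eq τ]
      gcongr
      refine (hc.capMoment_le N τ).trans ?_
      gcongr
      exact capMoment_le_tsum h N
    · exact Eventually.of_forall fun τ _ => tendsto_capFlux (hc.summable_moment h τ)
  simp_rw [hint] at hlim
  rw [intervalIntegral.integral_zero] at hlim
  have h2 := (tendsto_capMoment (hc.summable_moment h t)).sub (tendsto_capMoment h)
  exact sub_eq_zero.1 (tendsto_nhds_unique h2 hlim)

theorem Raise.summable_moment {c e : Coeff} (h : Raise c e) :
    Summable fun n : ℕ => (n : ℝ) * ‖c n‖ ^ 2 :=
  (h.hasSum.summable.sub (Coeff.hasSum_norm_sq c).summable).congr fun n => by ring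

theorem Raise.norm_sq {c e : Coeff} (h : Raise c e) :
    ‖e‖ ^ 2 = ∑' n : ℕ, (n : ℝ) * ‖c n‖ ^ 2 + ‖c‖ ^ 2 := by
  refine h.hasSum.unique ?_
  exact (h.summable_moment.hasSum.add (Coeff.hasSum_norm_sq c)).congr_fun fun n => by ring

/-- Propagation and conservation of the angular momentum. -/
theorem Sol.exists_raise {c : ℝ → Coeff} (hc : Sol c) {e₀ : Coeff} (h : Raise (c 0) e₀) (t : ℝ) :
    ∃ e, Raise (c t) e ∧ ‖e‖ = ‖e₀‖ := by
  have hs := hc.summable_moment h.summable_moment t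
  obtain ⟨e, he⟩ := LLL.exists_raise
    ((hs.add (Coeff.hasSum_norm_sq (c t)).summable).congr fun n => by ring)
  refine ⟨e, he, ?_⟩
  rw [← sq_eq_sq₀ (norm_nonneg _) (norm_nonneg _), he.norm_sq, h.norm_sq,
    hc.tsum_moment_eq h.summable_moment, hc.norm_eq]

/-- Conservation of the magnetic momentum. -/
theorem Sol.inner_raise_eq {c : ℝ → Coeff} (hc : Sol c) {e₀ e : Coeff} {t : ℝ}
    (h₀ : Raise (c 0) e₀) (h : Raise (c t) e) : inner ℂ (c t) e = inner ℂ (c 0) e₀ := by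
  have hn : ‖e‖ = ‖e₀‖ := by
    obtain ⟨e', he', hn⟩ := hc.exists_raise h₀ t
    rw [h.unique he', hn]
  -- The angular momentum of the translated solution is conserved too. Expanding it in `β` isolates
  -- this real part; the values `1` and `I` of `β` then recover the complex identity.
  have key : ∀ β : ℂ, (conj β * inner ℂ (c t) e).re = (conj β * inner ℂ (c 0) e₀).re := by
    intro β
    obtain ⟨e', he', hn'⟩ := (hc.trans β).exists_raise (h₀.trans β) t
    rw [he'.unique (h.trans β), ← map_smul, ← map_smul, ← map_sub, ← map_sub,
      LinearIsometry.norm_map, LinearIsometry.norm_map] at hn'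
    have h1 := norm_sub_sq (𝕜 := ℂ) e (β • c t)
    have h2 := norm_sub_sq (𝕜 := ℂ) e₀ (β • c 0)
    rw [hn', hn, h2, ← inner_conj_symm, ← inner_conj_symm e, inner_smul_left, inner_smul_left,
      norm_smul, norm_smul, hc.norm_eq t] at h1
    simp only [RCLike.re_to_complex, Complex.conj_re] at h1
    linarith
  apply Complex.ext
  · simpa using key 1
  · simpa using key Complex.I


/-! ### The Hermite basis -/

/-- The coefficients of the Hermite function `φ_n`. -/
def hermite (n : ℕ) : Coeff := lp.single 2 n 1

@[simp] theorem hermite_self (n : ℕ) : hermite n n = 1 := lp.single_apply_self 2 n 1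

theorem hermite_ne {n m : ℕ} (h : m ≠ n) : hermite n m = 0 := lp.single_apply_ne 2 n 1 h

theorem hermite_apply (n m : ℕ) : hermite n m = if m = n then 1 else 0 := by
  split_ifs with h
  · rw [h, hermite_self]
  · exact hermite_ne h

theorem norm_hermite (n : ℕ) : ‖hermite n‖ = 1 := by
  rw [hermite, lp.norm_single (by norm_num), norm_one]

theorem inner_hermite (n : ℕ) (c : Coeff) : inner ℂ (hermite n) c = c n := by
  rw [hermite, lp.inner_single_left]
  simp

theorem entire_hermite (n : ℕ) (z : ℂ) :
    entire (hermite n) z = (1 / √(Real.pi * n.factorial) : ℝ) * z ^ n := by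
  refine (hasSum_entire (hermite n) z).unique ?_
  convert! hasSum_ite_eq n ((1 / √(Real.pi * n.factorial) : ℝ) * z ^ n) using 1
  ext m
  rw [taylorCoeff, hermite_apply]
  split_ifs with h
  · subst h; push_cast; ring
  · simp

theorem hasSum_hermite (c : Coeff) : HasSum (fun n => c n • hermite n) c := by
  have h := lp.hasSum_single (p := 2) (by norm_num) c
  refine h.congr_fun fun n => ?_
  rw [hermite, ← lp.single_smul, smul_eq_mul, mul_one]

/-! ### The first coordinates of the translates -/

theorem trans_coeff_zero (β : ℂ) (c : Coeff) : trans β c 0 =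
    (√Real.pi : ℝ) * (Complex.exp (-(‖β‖ ^ 2 : ℝ) / 2) * entire c β) := by
  rw [coeff_zero, entire_trans]
  simp

theorem trans_coeff_one (β : ℂ) (c : Coeff) : trans β c 1 =
    (√Real.pi : ℝ) * (Complex.exp (-(‖β‖ ^ 2 : ℝ) / 2) *
      (deriv (entire c) β - conj β * entire c β)) := by
  have h : HasDerivAt (entire (trans β c)) (Complex.exp (-(‖β‖ ^ 2 : ℝ) / 2) *
      (deriv (entire c) β - conj β * entire c β)) 0 := by
    have e : entire (trans β c) =
        fun z => Complex.exp (-(‖β‖ ^ 2 : ℝ) / 2 - conj β * z) * entire c (z + β) :=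
      funext (entire_trans β c)
    rw [e]
    have h1 : HasDerivAt (fun z : ℂ => -(‖β‖ ^ 2 : ℝ) / 2 - conj β * z) (-conj β) 0 := by
      simpa [-Complex.ofReal_pow] using! ((hasDerivAt_id (0 : ℂ)).const_mul (conj β)).const_sub
        (-((‖β‖ ^ 2 : ℝ) : ℂ) / 2)
    have h2 : HasDerivAt (fun z : ℂ => entire c (z + β)) (deriv (entire c) β) 0 := by
      have := (differentiable_entire c (0 + β)).hasDerivAt.comp_add_const 0 β
      rwa [zero_add] at this
    convert! h1.cexp.mul h2 using 1
    simp only [mul_zero, sub_zero, zero_add]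
    ring
  rw [coeff_one, h.deriv]

theorem continuous_deriv_entire (c : Coeff) : Continuous (deriv (entire c)) :=
  (differentiable_entire c).contDiff.continuous_deriv (n := 1) le_rfl

theorem continuous_trans_coeff_zero (c : Coeff) : Continuous fun β => trans β c 0 := by
  simp_rw [trans_coeff_zero]
  have := continuous_entire c
  fun_prop

theorem continuous_trans_coeff_one (c : Coeff) : Continuous fun β => trans β c 1 := by
  simp_rw [trans_coeff_one]
  have := continuous_entire c
  have := continuous_deriv_entire c
  fun_prop

theorem tendsto_pow_mul_gauss (n : ℕ) : Tendsto (fun β : ℂ => ‖β‖ ^ n * Real.exp (-‖β‖ ^ 2 / 2))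
    (cocompact ℂ) (𝓝 0) := by
  have h1 : Tendsto (fun x : ℝ => Real.exp (1 / 2) * (x ^ n * Real.exp (-x))) atTop (𝓝 0) := by
    simpa using (Real.tendsto_pow_mul_exp_neg_atTop_nhds_zero n).const_mul (Real.exp (1 / 2))
  refine squeeze_zero (fun β => by positivity) (fun β => ?_)
    (h1.comp (tendsto_norm_cocompact_atTop (E := ℂ)))
  simp only [Function.comp_apply]
  rw [mul_left_comm, ← Real.exp_add]
  gcongr
  nlinarith [sq_nonneg (‖β‖ - 1)]

theorem norm_cexp_neg_sq (β : ℂ) :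
    ‖Complex.exp (-(‖β‖ ^ 2 : ℝ) / 2)‖ = Real.exp (-‖β‖ ^ 2 / 2) := by
  rw [Complex.norm_exp]
  congr 1
  rw [← Complex.ofReal_neg, show (2 : ℂ) = ((2 : ℝ) : ℂ) by norm_num, ← Complex.ofReal_div,
    Complex.ofReal_re]

theorem tendsto_trans_hermite_coeff (n : ℕ) :
    Tendsto (fun β => trans β (hermite n) 0) (cocompact ℂ) (𝓝 0) ∧
      Tendsto (fun β => trans β (hermite n) 1) (cocompact ℂ) (𝓝 0) := by
  set C : ℝ := √Real.pi * (1 / √(Real.pi * n.factorial)) with hC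
  have hCn : ‖((√Real.pi : ℝ) : ℂ)‖ * ‖((1 / √(Real.pi * n.factorial) : ℝ) : ℂ)‖ = C := by
    rw [Complex.norm_real, Complex.norm_real, Real.norm_of_nonneg (by positivity),
      Real.norm_of_nonneg (by positivity)]
  have hd : ∀ β, deriv (entire (hermite n)) β =
      (1 / √(Real.pi * n.factorial) : ℝ) * (n * β ^ (n - 1)) := by
    intro β
    have : entire (hermite n) = fun z => ((1 / √(Real.pi * n.factorial) : ℝ) : ℂ) * z ^ n :=
      funext (entire_hermite n)
    rw [this, deriv_const_mul _ (by fun_prop)]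
    simp
  constructor
  · refine squeeze_zero_norm (a := fun β : ℂ => C * (‖β‖ ^ n * Real.exp (-‖β‖ ^ 2 / 2)))
      (fun β => ?_) (by simpa using (tendsto_pow_mul_gauss n).const_mul C)
    rw [trans_coeff_zero, entire_hermite, norm_mul, norm_mul, norm_mul, norm_cexp_neg_sq, norm_pow,
      ← hCn]
    apply le_of_eq
    ring
  · refine squeeze_zero_norm (a := fun β : ℂ => C * (n * (‖β‖ ^ (n - 1) * Real.exp (-‖β‖ ^ 2 / 2))
        + ‖β‖ ^ (n + 1) * Real.exp (-‖β‖ ^ 2 / 2))) (fun β => ?_) ?_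
    · rw [trans_coeff_one, entire_hermite, hd, norm_mul, norm_mul, norm_cexp_neg_sq, ← hCn]
      have : ‖((1 / √(Real.pi * n.factorial) : ℝ) : ℂ) * (n * β ^ (n - 1)) -
          conj β * (((1 / √(Real.pi * n.factorial) : ℝ) : ℂ) * β ^ n)‖ ≤
          ‖((1 / √(Real.pi * n.factorial) : ℝ) : ℂ)‖ * (n * ‖β‖ ^ (n - 1)) +
          ‖β‖ * (‖((1 / √(Real.pi * n.factorial) : ℝ) : ℂ)‖ * ‖β‖ ^ n) := by
        refine (norm_sub_le _ _).trans_eq ?_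
        simp only [norm_mul, norm_pow, Complex.norm_natCast, RCLike.norm_conj]
      calc _ ≤ ‖((√Real.pi : ℝ) : ℂ)‖ * (Real.exp (-‖β‖ ^ 2 / 2) *
            (‖((1 / √(Real.pi * n.factorial) : ℝ) : ℂ)‖ * (n * ‖β‖ ^ (n - 1)) +
          ‖β‖ * (‖((1 / √(Real.pi * n.factorial) : ℝ) : ℂ)‖ * ‖β‖ ^ n))) := by gcongr
        _ = _ := by ring
    · simpa using ((((tendsto_pow_mul_gauss (n - 1)).const_mul (n : ℝ)).add
        (tendsto_pow_mul_gauss (n + 1))).const_mul C)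

/-- For finite combinations of Hermite functions the coordinates are polynomials times a Gaussian in
`β`. Density concludes, because translations are isometries and the approximation error is uniform
in `β`. -/
theorem tendsto_trans_coeff (c : Coeff) {j : ℕ} (hj : j = 0 ∨ j = 1) :
    Tendsto (fun β => trans β c j) (cocompact ℂ) (𝓝 0) := by
  have hs := hasSum_hermite c
  have hfin : ∀ s : Finset ℕ,
      Tendsto (fun β => trans β (∑ n ∈ s, c n • hermite n) j) (cocompact ℂ) (𝓝 0) := by
    intro s
    have e : ∀ β, trans β (∑ n ∈ s, c n • hermite n) j = ∑ n ∈ s, c n * trans β (hermite n) j := by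
      intro β
      rw [map_sum, lp.coeFn_sum, Finset.sum_apply]
      simp
    simp_rw [e]
    rw [show (0 : ℂ) = ∑ n ∈ s, c n * 0 by simp]
    refine tendsto_finsetSum _ fun n _ => Tendsto.const_mul _ ?_
    rcases hj with rfl | rfl
    · exact (tendsto_trans_hermite_coeff n).1
    · exact (tendsto_trans_hermite_coeff n).2
  rw [Metric.tendsto_nhds]
  intro ε hε
  obtain ⟨s, hs⟩ := (Metric.tendsto_nhds.1 hs (ε / 2) (by linarith)).exists
  filter_upwards [Metric.tendsto_nhds.1 (hfin s) (ε / 2) (by linarith)] with β hβ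
  rw [dist_zero_right] at hβ ⊢
  have h1 : ‖trans β (c - ∑ n ∈ s, c n • hermite n) j‖ < ε / 2 := by
    refine (Coeff.norm_apply_le _ j).trans_lt ?_
    rw [LinearIsometry.norm_map, ← dist_eq_norm, dist_comm]
    exact hs
  have h2 : trans β c j = trans β (c - ∑ n ∈ s, c n • hermite n) j +
      trans β (∑ n ∈ s, c n • hermite n) j := by
    rw [map_sub, lp.coeFn_sub, Pi.sub_apply, sub_add_cancel]
  rw [h2]
  refine (norm_add_le _ _).trans_lt ?_
  linarith

/-! ### Optimal frames -/

/-- The mass carried by the first `J` coordinates. -/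
def low (J : ℕ) (c : Coeff) : ℝ := ∑ j ∈ Finset.range J, ‖c j‖ ^ 2

theorem low_nonneg (J : ℕ) (c : Coeff) : 0 ≤ low J c := Finset.sum_nonneg fun _ _ => by positivity

theorem low_le (J : ℕ) (c : Coeff) : low J c ≤ ‖c‖ ^ 2 :=
  sum_le_hasSum _ (fun n _ => by positivity) (Coeff.hasSum_norm_sq c)

theorem low_sub_low_le (J : ℕ) (c d : Coeff) :
    low J c - low J d ≤ J * (‖c - d‖ * (‖c‖ + ‖d‖)) := by
  rw [low, low, ← Finset.sum_sub_distrib]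
  calc _ ≤ ∑ j ∈ Finset.range J, ‖c - d‖ * (‖c‖ + ‖d‖) := by
        refine Finset.sum_le_sum fun j _ => ?_
        have h1 : ‖c j‖ - ‖d j‖ ≤ ‖c - d‖ :=
          (norm_sub_norm_le _ _).trans (Coeff.norm_apply_le (c - d) j)
        have h2 : ‖c j‖ + ‖d j‖ ≤ ‖c‖ + ‖d‖ :=
          add_le_add (Coeff.norm_apply_le c j) (Coeff.norm_apply_le d j)
        calc ‖c j‖ ^ 2 - ‖d j‖ ^ 2 = (‖c j‖ - ‖d j‖) * (‖c j‖ + ‖d j‖) := by ring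
          _ ≤ ‖c - d‖ * (‖c‖ + ‖d‖) := by gcongr
    _ = _ := by simp

theorem low_smul (J : ℕ) {a : ℂ} (ha : ‖a‖ = 1) (c : Coeff) : low J (a • c) = low J c := by
  refine Finset.sum_congr rfl fun j _ => ?_
  rw [lp.coeFn_smul, Pi.smul_apply, smul_eq_mul, norm_mul, ha, one_mul]

theorem low_trans_trans (J : ℕ) (α β : ℂ) (c : Coeff) :
    low J (trans α (trans β c)) = low J (trans (α + β) c) := by
  rw [trans_trans, low_smul]
  exact norm_exp_magTrans β α

/-- The largest mass that the first `J` coordinates may carry in a translated frame. -/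
def peak (J : ℕ) (c : Coeff) : ℝ := ⨆ β : ℂ, low J (trans β c)

theorem bddAbove_low (J : ℕ) (c : Coeff) : BddAbove (Set.range fun β => low J (trans β c)) := by
  refine ⟨‖c‖ ^ 2, ?_⟩
  rintro _ ⟨β, rfl⟩
  simpa using low_le J (trans β c)

theorem low_le_peak (J : ℕ) (c : Coeff) (β : ℂ) : low J (trans β c) ≤ peak J c :=
  le_ciSup (bddAbove_low J c) β

theorem peak_sub_peak_le (J : ℕ) (c d : Coeff) :
    peak J c - peak J d ≤ J * (‖c - d‖ * (‖c‖ + ‖d‖)) := by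
  rw [sub_le_iff_le_add]
  refine ciSup_le fun β => ?_
  have h := low_sub_low_le J (trans β c) (trans β d)
  rw [← map_sub, LinearIsometry.norm_map, LinearIsometry.norm_map, LinearIsometry.norm_map] at h
  linarith [low_le_peak J d β]

/-- The functions under the supremum are Lipschitz on bounded sets, uniformly in `β`. Continuity is
what the continuity argument `bootstrap` requires. -/
theorem continuous_peak (J : ℕ) : Continuous (peak J) := by
  rw [continuous_iff_continuousAt]
  intro c
  rw [ContinuousAt, tendsto_iff_dist_tendsto_zero]
  have hc : Continuous fun d : Coeff => J * (‖d - c‖ * (‖d‖ + ‖c‖)) := by fun_prop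
  have h := hc.tendsto c
  simp only [sub_self, norm_zero, zero_mul, mul_zero] at h
  refine squeeze_zero (fun _ => dist_nonneg) (fun d => ?_) h
  rw [Real.dist_eq, abs_le]
  have h1 := peak_sub_peak_le J d c
  have h2 := peak_sub_peak_le J c d
  rw [norm_sub_rev, add_comm ‖c‖] at h2
  constructor <;> linarith

/-- The low mass is continuous in `β` and tends to zero at infinity, hence attains its supremum. For
`J ≤ 2` only the coordinates zero and one occur, whose decay is `tendsto_trans_coeff`. -/
theorem exists_peak {J : ℕ} (hJ : J ≤ 2) (c : Coeff) : ∃ β, low J (trans β c) = peak J c := by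
  have hj : ∀ j ∈ Finset.range J, j = 0 ∨ j = 1 := fun j hj => by
    have := Finset.mem_range.1 hj; omega
  have hcont : Continuous fun β => low J (trans β c) := by
    refine continuous_finsetSum _ fun j h => ?_
    rcases hj j h with rfl | rfl
    · exact (continuous_trans_coeff_zero c).norm.pow 2
    · exact (continuous_trans_coeff_one c).norm.pow 2
  have hlim : Tendsto (fun β => low J (trans β c)) (cocompact ℂ) (𝓝 0) := by
    rw [show (0 : ℝ) = ∑ j ∈ Finset.range J, ‖(0 : ℂ)‖ ^ 2 by simp]
    exact tendsto_finsetSum _ fun j h => (tendsto_trans_coeff c (hj j h)).norm.pow 2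
  have hmax : ∃ β, ∀ β', low J (trans β' c) ≤ low J (trans β c) := by
    by_cases h0 : ∀ β', low J (trans β' c) ≤ 0
    · exact ⟨0, fun β' => (h0 β').trans (low_nonneg _ _)⟩
    · push Not at h0
      obtain ⟨β₀, h0⟩ := h0
      refine hcont.exists_forall_ge' (x₀ := β₀) ?_
      filter_upwards [hlim.eventually (gt_mem_nhds h0)] with β hβ using hβ.le
  obtain ⟨β, hβ⟩ := hmax
  exact ⟨β, le_antisymm (low_le_peak J c β) (ciSup_le hβ)⟩

theorem hasDerivAt_norm_sq_of {a : ℝ → ℂ} {a' : ℂ} {t : ℝ} (h : HasDerivAt a a' t) :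
    HasDerivAt (fun t => ‖a t‖ ^ 2) (2 * (conj (a t) * a').re) t := by
  have := h.norm_sq
  rw [Complex.inner, mul_comm a'] at this
  simpa [mul_comm] using this

theorem hasDerivAt_gauss_ray (ζ : ℂ) :
    HasDerivAt (fun t : ℝ => Complex.exp (-(‖(t : ℂ) * ζ‖ ^ 2 : ℝ) / 2)) 0 0 := by
  have e : (fun t : ℝ => Complex.exp (-(‖(t : ℂ) * ζ‖ ^ 2 : ℝ) / 2)) =
      fun t : ℝ => Complex.exp ((t : ℂ) ^ 2 * (-(‖ζ‖ ^ 2 : ℝ) / 2)) := by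
    ext t
    rw [norm_mul, mul_pow, Complex.norm_real, Real.norm_eq_abs, sq_abs]
    push_cast
    ring_nf
  rw [e]
  have h := (((hasDerivAt_id (0 : ℝ)).ofReal_comp.pow 2).mul_const
    (-(‖ζ‖ ^ 2 : ℝ) / 2 : ℂ)).cexp
  simpa using! h

theorem hasDerivAt_ray {f : ℂ → ℂ} (hf : Differentiable ℂ f) (ζ : ℂ) :
    HasDerivAt (fun t : ℝ => f ((t : ℂ) * ζ)) (deriv f 0 * ζ) 0 := by
  have h1 : HasDerivAt (fun t : ℝ => (t : ℂ) * ζ) ζ 0 := by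
    simpa using! (hasDerivAt_id (0 : ℝ)).ofReal_comp.mul_const ζ
  have h2 : HasDerivAt f (deriv f 0) (((0 : ℝ) : ℂ) * ζ) := by
    simpa using (hf 0).hasDerivAt
  exact h2.comp (0 : ℝ) h1

theorem hasDerivAt_trans_coeff_zero (c : Coeff) (ζ : ℂ) :
    HasDerivAt (fun t : ℝ => trans (t * ζ) c 0) (ζ * c 1) 0 := by
  simp_rw [trans_coeff_zero]
  have h := ((hasDerivAt_gauss_ray ζ).mul (hasDerivAt_ray (differentiable_entire c) ζ)).const_mul
    ((√Real.pi : ℝ) : ℂ)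
  convert! h using 1
  rw [coeff_one]
  simp
  ring

theorem hasDerivAt_trans_coeff_one (c : Coeff) (ζ : ℂ) :
    HasDerivAt (fun t : ℝ => trans (t * ζ) c 1) (ζ * (√2 : ℝ) * c 2 - conj ζ * c 0) 0 := by
  simp_rw [trans_coeff_one]
  have h0 : HasDerivAt (fun t : ℝ => conj ((t : ℂ) * ζ)) (conj ζ) 0 := by
    have : (fun t : ℝ => conj ((t : ℂ) * ζ)) = fun t : ℝ => (t : ℂ) * conj ζ := by
      ext t; rw [map_mul, Complex.conj_ofReal]
    rw [this]
    simpa using! (hasDerivAt_id (0 : ℝ)).ofReal_comp.mul_const (conj ζ)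
  have hd : Differentiable ℂ (deriv (entire c)) := (differentiable_entire c).deriv
  have h := ((hasDerivAt_gauss_ray ζ).mul ((hasDerivAt_ray hd ζ).sub
    (h0.mul (hasDerivAt_ray (differentiable_entire c) ζ)))).const_mul ((√Real.pi : ℝ) : ℂ)
  convert! h using 1
  rw [coeff_zero, coeff_two]
  have e : ((√2 : ℝ) : ℂ) * ((√2 : ℝ) : ℂ) = 2 := by
    rw [← Complex.ofReal_mul, Real.mul_self_sqrt (by norm_num)]
    norm_num
  simp
  linear_combination (ζ * deriv (deriv (entire c)) 0 * (√Real.pi : ℝ) / 2) * e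

theorem low_ray_le {J : ℕ} {c : Coeff} (hc : low J c = peak J c) (ζ : ℂ) (t : ℝ) :
    low J (trans (t * ζ) c) ≤ low J (trans ((0 : ℝ) * ζ) c) := by
  simpa [trans_zero, hc] using low_le_peak J c (t * ζ)

theorem mul_eq_zero_of_re_mul_eq_zero {a : ℂ} (h : ∀ ζ : ℂ, (ζ * a).re = 0) : a = 0 := by
  have := h (conj a)
  rw [Complex.conj_mul', ← Complex.ofReal_pow, Complex.ofReal_re] at this
  simpa using this

/-- Along the ray `t ζ` the mass of mode zero has derivative `2 Re (ζ conj (c 0) c 1)` at `t = 0`.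
At a maximum this vanishes for every `ζ`. -/
theorem peak_one_critical {c : Coeff} (hc : low 1 c = peak 1 c) : c 0 = 0 ∨ c 1 = 0 := by
  have : conj (c 0) * c 1 = 0 := by
    refine mul_eq_zero_of_re_mul_eq_zero fun ζ => ?_
    have h := hasDerivAt_norm_sq_of (hasDerivAt_trans_coeff_zero c ζ)
    have hmax : IsLocalMax (fun t : ℝ => ‖trans (t * ζ) c 0‖ ^ 2) 0 :=
      Eventually.of_forall fun t => by simpa [low] using low_ray_le hc ζ t
    have h0 := hmax.hasDerivAt_eq_zero h
    rw [Complex.ofReal_zero, zero_mul, trans_zero] at h0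
    rw [← mul_assoc, mul_comm ζ, mul_assoc]
    linarith
  simpa using this

/-- In the derivative of the total low mass the exchange between modes zero and one cancels; only
the flux between modes one and two remains. -/
theorem peak_two_critical {c : Coeff} (hc : low 2 c = peak 2 c) : c 1 = 0 ∨ c 2 = 0 := by
  have : conj (c 1) * c 2 = 0 := by
    refine mul_eq_zero_of_re_mul_eq_zero fun ζ => ?_
    have h := (hasDerivAt_norm_sq_of (hasDerivAt_trans_coeff_zero c ζ)).add
      (hasDerivAt_norm_sq_of (hasDerivAt_trans_coeff_one c ζ))
    have hmax : IsLocalMax ((fun t : ℝ => ‖trans (t * ζ) c 0‖ ^ 2) +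
        fun t : ℝ => ‖trans (t * ζ) c 1‖ ^ 2) 0 :=
      Eventually.of_forall fun t => by
        simpa [low, Finset.sum_range_succ] using low_ray_le hc ζ t
    have h0 := hmax.hasDerivAt_eq_zero h
    rw [Complex.ofReal_zero, zero_mul, trans_zero] at h0
    have e : (conj (c 1) * (ζ * (√2 : ℝ) * c 2 - conj ζ * c 0)).re =
        √2 * (ζ * (conj (c 1) * c 2)).re - (conj (c 0) * (ζ * c 1)).re := by
      have e1 : (conj (c 0) * (ζ * c 1)).re = (conj (c 1) * (conj ζ * c 0)).re := by
        rw [← Complex.conj_re]; simp only [map_mul, Complex.conj_conj]; ring_nf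
      rw [e1, mul_sub, Complex.sub_re, ← Complex.re_ofReal_mul]
      ring_nf
    rw [e] at h0
    have h2 : (0 : ℝ) < √2 := by positivity
    have : √2 * (ζ * (conj (c 1) * c 2)).re = 0 := by linarith
    exact (mul_eq_zero.1 this).resolve_left h2.ne'
  simpa using this

/-- The continuity argument behind the stability statements. -/
theorem bootstrap {X : ℝ → ℝ} (hX : Continuous X) {η ε : ℝ} (h0 : X 0 ≤ η) (hηε : η < ε)
    (h : ∀ t, X t ≤ ε → X t ≤ η) (t : ℝ) : X t ≤ η := by
  -- By the implication this closed set equals the open set `{X < ε}`, and the real line is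
  -- connected.
  have hcl : IsClopen {t | X t ≤ η} := by
    refine ⟨isClosed_le hX continuous_const, ?_⟩
    have : {t | X t ≤ η} = {t | X t < ε} :=
      Set.ext fun t => ⟨fun ht => lt_of_le_of_lt ht hηε, fun ht => h t (le_of_lt ht)⟩
    rw [this]
    exact isOpen_lt hX continuous_const
  have := hcl.eq_univ ⟨0, h0⟩
  exact Set.eq_univ_iff_forall.1 this t


/-! ### Stability of the Gaussians in `L²`. -/

theorem phi_eq (n : ℕ) (α : ℂ) : phi n α = fock (trans (-conj α) (hermite n)) := by
  ext z
  rw [fock_trans, magTrans_fock, entire_hermite, phi, map_neg, Complex.conj_conj, norm_neg,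
    RCLike.norm_conj, ← sub_eq_add_neg]
  have h : Complex.exp (-(‖z‖ ^ 2 : ℝ) / 2 - (‖α‖ ^ 2 : ℝ) / 2 + α * z) =
      (Real.exp (-‖z‖ ^ 2 / 2) : ℂ) * Complex.exp (-(‖α‖ ^ 2 : ℝ) / 2 - -α * z) := by
    push_cast
    rw [← Complex.exp_add]
    congr 1
    ring
  rw [h]
  push_cast
  ring

theorem phaseRot_fock (θ : ℝ) (c : Coeff) :
    phaseRot θ (fock c) = fock (Complex.exp (Complex.I * θ) • c) := by
  ext z
  rw [phaseRot, fock_smul]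

theorem norm_exp_I_mul (θ : ℝ) : ‖Complex.exp (Complex.I * θ)‖ = 1 := by
  rw [mul_comm, Complex.norm_exp_ofReal_mul_I]

theorem exists_phase (a : ℂ) : ∃ θ : ℝ, a = ‖a‖ * Complex.exp (Complex.I * θ) :=
  ⟨a.arg, by rw [mul_comm Complex.I, Complex.norm_mul_exp_arg_mul_I]⟩

/-- The part of `c` beyond the first `J` coordinates. -/
def tail (J : ℕ) (c : Coeff) : Coeff := c - ∑ j ∈ Finset.range J, c j • hermite j

theorem tail_apply (J : ℕ) (c : Coeff) (n : ℕ) : tail J c n = if n < J then 0 else c n := by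
  rw [tail, lp.coeFn_sub, Pi.sub_apply, lp.coeFn_sum, Finset.sum_apply]
  simp only [lp.coeFn_smul, Pi.smul_apply, hermite_apply, smul_eq_mul, mul_ite, mul_one, mul_zero,
    Finset.sum_ite_eq, Finset.mem_range]
  split_ifs <;> simp

theorem norm_tail_sq (J : ℕ) (c : Coeff) : ‖tail J c‖ ^ 2 = ‖c‖ ^ 2 - low J c := by
  have h1 : HasSum (fun n => if n < J then ‖c n‖ ^ 2 else 0) (low J c) := by
    have : HasSum (fun n => if n < J then ‖c n‖ ^ 2 else 0)
        (∑ n ∈ Finset.range J, if n < J then ‖c n‖ ^ 2 else 0) :=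
      hasSum_sum_of_ne_finset_zero fun n hn => if_neg (by simpa using hn)
    convert! this using 1
    exact Finset.sum_congr rfl fun n hn => by rw [if_pos (Finset.mem_range.1 hn)]
  refine (Coeff.hasSum_norm_sq (tail J c)).unique
    (((Coeff.hasSum_norm_sq c).sub h1).congr_fun fun n => ?_)
  rw [tail_apply]
  split_ifs <;> simp

theorem prodMap_hermite_apply (k : ℕ) (w : Coeff) (s : ℕ) :
    prodMap (hermite k) w s = if k ≤ s then tau k (s - k) * w (s - k) else 0 := by
  rw [prodMap_apply]
  split_ifs with h
  · rw [Finset.sum_eq_single (k, s - k)]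
    · simp
    · intro p hp hne
      have hp := Finset.HasAntidiagonal.mem_antidiagonal.1 hp
      rw [hermite_ne, zero_mul, mul_zero]
      rintro rfl
      exact hne (Prod.ext rfl (by simp; omega))
    · intro hn
      exact absurd (Finset.HasAntidiagonal.mem_antidiagonal.2 (by simp; omega)) hn
  · refine Finset.sum_eq_zero fun p hp => ?_
    have hp := Finset.HasAntidiagonal.mem_antidiagonal.1 hp
    rw [hermite_ne (by omega), zero_mul, mul_zero]

theorem tau_zero_sq (s : ℕ) : tau 0 s ^ 2 = 1 / 2 ^ s := by
  rw [tau_sq]; simp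

theorem prodMap_hermite_zero_zero : prodMap (hermite 0) (hermite 0) = hermite 0 := by
  ext s
  rw [prodMap_hermite_apply, if_pos (Nat.zero_le _), Nat.sub_zero, hermite_apply]
  split_ifs with h
  · subst h
    simp [tau]
  · simp

theorem norm_prodMap_hermite_zero_le {w : Coeff} {J : ℕ} (hw : ∀ n < J, w n = 0) :
    ‖prodMap (hermite 0) w‖ ^ 2 ≤ 1 / 2 ^ J * ‖w‖ ^ 2 := by
  refine hasSum_le (fun s => ?_) (Coeff.hasSum_norm_sq _)
    ((Coeff.hasSum_norm_sq w).mul_left (1 / 2 ^ J))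
  rw [prodMap_hermite_apply, if_pos (Nat.zero_le _), Nat.sub_zero, norm_mul, mul_pow,
    Complex.norm_real, Real.norm_eq_abs, sq_abs, tau_zero_sq]
  rcases lt_or_ge s J with h | h
  · simp [hw s h]
  · gcongr
    norm_num

/-- The quartic energy is at most the one of the Gaussian part plus a small contribution. -/
theorem norm_prodMap_sq_le_of_coeff_one {d : Coeff} (h1 : d 1 = 0) :
    ‖prodMap d d‖ ^ 2 ≤ ‖d 0‖ ^ 4 + (‖d 0‖ * ‖tail 2 d‖ + ‖tail 2 d‖ ^ 2) ^ 2 := by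
  set w := tail 2 d with hw
  have hd : d = d 0 • hermite 0 + w := by
    rw [hw, tail, Finset.sum_range_succ, Finset.sum_range_one, h1]
    simp
  have hw0 : ∀ n < 2, w n = 0 := fun n hn => by rw [hw, tail_apply, if_pos hn]
  set y := (2 * d 0) • prodMap (hermite 0) w + prodMap w w with hy
  have hB : prodMap d d = (d 0 ^ 2) • hermite 0 + y := by
    rw [hy]
    nth_rw 1 2 [hd]
    simp only [map_add, map_smul, add_apply, smul_apply,
      prodMap_hermite_zero_zero]
    rw [prodMap_comm w (hermite 0)]
    module
  have hy0 : y 0 = 0 := by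
    rw [hy, lp.coeFn_add, Pi.add_apply, lp.coeFn_smul, Pi.smul_apply, prodMap_hermite_apply,
      prodMap_apply]
    simp [hw0]
  have hpy : ‖prodMap d d‖ ^ 2 = ‖d 0‖ ^ 4 + ‖y‖ ^ 2 := by
    have := norm_add_sq_eq_norm_sq_add_norm_sq_of_inner_eq_zero ((d 0 ^ 2) • hermite 0) y
      (by rw [inner_smul_left, inner_hermite, hy0, mul_zero] : inner ℂ _ _ = 0)
    rw [hB, sq, this, norm_smul, norm_hermite, norm_pow]
    ring
  have hyn : ‖y‖ ≤ ‖d 0‖ * ‖w‖ + ‖w‖ ^ 2 := by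
    -- The factor is `tau 0 2`. With mode one present it would be `tau 0 1 = √(1 / 2)`, and the
    -- quadratic part of the energy deficit would degenerate in that direction.
    have h3 : ‖prodMap (hermite 0) w‖ ≤ 1 / 2 * ‖w‖ := by
      have := norm_prodMap_hermite_zero_le hw0
      refine (abs_le_of_sq_le_sq' ?_ (by positivity)).2
      rw [mul_pow]
      linarith
    calc ‖y‖ ≤ ‖(2 * d 0) • prodMap (hermite 0) w‖ + ‖prodMap w w‖ := norm_add_le _ _
      _ ≤ (2 * ‖d 0‖) * (1 / 2 * ‖w‖) + ‖w‖ * ‖w‖ := by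
        rw [norm_smul, norm_mul, Complex.norm_ofNat]
        gcongr
        exact norm_prodMap_le _ _
      _ = _ := by ring
  rw [hpy]
  gcongr

theorem norm_prodMap_sub_le (c d : Coeff) :
    ‖prodMap c c - prodMap d d‖ ≤ ‖c - d‖ * (‖c‖ + ‖d‖) := by
  have : prodMap c c - prodMap d d = prodMap (c - d) c + prodMap d (c - d) := by
    simp only [map_sub, sub_apply]
    abel
  rw [this]
  refine (norm_add_le _ _).trans ?_
  have h1 := norm_prodMap_le (c - d) c
  have h2 := norm_prodMap_le d (c - d)
  linarith

/-- Quantitative stability of the Gaussians in terms of the deficit of the energy. -/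
theorem peak_deficit_le {c : Coeff} (hM : 1 / 2 ≤ ‖c‖ ^ 2) (hX : ‖c‖ ^ 2 - peak 1 c ≤ 1 / 64) :
    ‖c‖ ^ 2 - peak 1 c ≤ 5 * (‖c‖ ^ 4 - ‖prodMap c c‖ ^ 2) := by
  obtain ⟨β, hβ⟩ := exists_peak (J := 1) (by norm_num) c
  set d := trans β c with hd
  have hn : ‖d‖ = ‖c‖ := LinearIsometry.norm_map _ _
  have hl : low 1 d = ‖d 0‖ ^ 2 := by simp [low]
  have hpk : low 1 d = peak 1 d := by
    refine le_antisymm (by simpa [trans_zero] using low_le_peak 1 d 0) (ciSup_le fun β' => ?_)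
    rw [hd, low_trans_trans, ← hd, hβ]
    exact low_le_peak 1 c _
  -- In the other case `d 0 = 0` the peak vanishes, and a mass of at least `1 / 2` contradicts a
  -- deficit of at most `1 / 64`.
  have hd1 : d 1 = 0 := by
    refine (peak_one_critical hpk).resolve_left fun h => ?_
    rw [h] at hl
    rw [← hβ, hl, norm_zero] at hX
    norm_num at hX
    linarith
  have hB := norm_prodMap_sq_le_of_coeff_one hd1
  have ht : ‖tail 2 d‖ ^ 2 = ‖c‖ ^ 2 - peak 1 c := by
    rw [norm_tail_sq, hn, ← hβ, low, low, Finset.sum_range_succ _ 1, hd1]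
    simp
  rw [hd, norm_prodMap_trans, ← hd] at hB
  rw [← ht] at hX ⊢
  have hM2 : ‖c‖ ^ 2 = ‖d 0‖ ^ 2 + ‖tail 2 d‖ ^ 2 := by rw [ht, ← hβ, hl]; ring
  have hc4 : ‖c‖ ^ 4 = (‖d 0‖ ^ 2 + ‖tail 2 d‖ ^ 2) ^ 2 := by rw [← hM2]; ring
  rw [hM2] at hM
  rw [hc4]
  set m := ‖d 0‖
  set ν := ‖tail 2 d‖
  have hm0 : 0 ≤ m := norm_nonneg _
  have hν0 : 0 ≤ ν := norm_nonneg _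
  have hν : ν ≤ 1 / 8 := by nlinarith
  have hm : 2 / 3 ≤ m := by nlinarith
  have h4 : 4 * ν ≤ m := by linarith
  -- The left side equals `(m² + ν²)² - m⁴ - (m ν + ν²)²` exactly.
  have : m ^ 2 * ν ^ 2 - 2 * m * ν ^ 3 ≤ (m ^ 2 + ν ^ 2) ^ 2 - ‖prodMap c c‖ ^ 2 := by nlinarith
  have h5 : ν ^ 2 * (1 / 5) ≤ ν ^ 2 * (m ^ 2 - 2 * m * ν) := by
    gcongr
    nlinarith
  nlinarith

/-- The deficit vanishes at `d`, and both of its terms are Lipschitz on bounded sets. This gives its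
smallness at the initial time. -/
theorem peak_deficit_sub_le {J : ℕ} {c d : Coeff} {β : ℂ} (hd : low J (trans β d) = ‖d‖ ^ 2) :
    ‖c‖ ^ 2 - peak J c ≤ (J + 1) * (‖c - d‖ * (‖c‖ + ‖d‖)) := by
  have h1 := low_sub_low_le J (trans β d) (trans β c)
  rw [← map_sub, LinearIsometry.norm_map, LinearIsometry.norm_map, LinearIsometry.norm_map, hd,
    norm_sub_rev, add_comm ‖d‖] at h1
  have h2 := low_le_peak J c β
  have h3 : ‖c‖ ^ 2 - ‖d‖ ^ 2 ≤ ‖c - d‖ * (‖c‖ + ‖d‖) := by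
    have := norm_sub_norm_le c d
    nlinarith [norm_nonneg c, norm_nonneg d]
  linarith

theorem sq_sub_one_le {a : ℝ} (ha : 0 ≤ a) : (a - 1) ^ 2 ≤ |a ^ 2 - 1| := by
  have : a ^ 2 - 1 = (a - 1) * (a + 1) := by ring
  rw [this, abs_mul, ← sq_abs, sq]
  refine mul_le_mul_of_nonneg_left ?_ (abs_nonneg _)
  rw [abs_le, abs_of_nonneg (by linarith : 0 ≤ a + 1)]
  constructor <;> linarith

theorem Sol.stability_gaussian {c : ℝ → Coeff} (hc : Sol c) {γ : ℂ} {δ : ℝ} (hδ0 : 0 ≤ δ)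
    (hδ : δ ≤ 1 / 10000) (h0 : ‖c 0 - LLL.trans γ (hermite 0)‖ = δ) (t : ℝ) :
    ∃ (θ : ℝ) (β : ℂ),
      ‖c t - Complex.exp (Complex.I * θ) • LLL.trans β (hermite 0)‖ ≤ 21 * √δ := by
  set φ := LLL.trans γ (hermite 0) with hφ
  have hφn : ‖φ‖ = 1 := by rw [hφ, LinearIsometry.norm_map, norm_hermite]
  have hBφ : ‖prodMap φ φ‖ = 1 := by
    rw [hφ, norm_prodMap_trans, prodMap_hermite_zero_zero, norm_hermite]
  have hn1 : ‖c 0‖ ≤ 1 + δ := by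
    have := norm_sub_norm_le (c 0) φ; rw [h0, hφn] at this; linarith
  have hn2 : 1 - δ ≤ ‖c 0‖ := by
    have := norm_sub_norm_le φ (c 0); rw [norm_sub_rev, h0, hφn] at this; linarith
  have hB1 : 1 - δ * (2 + δ) ≤ ‖prodMap (c 0) (c 0)‖ := by
    have h1 := norm_prodMap_sub_le (c 0) φ
    have h2 := norm_sub_norm_le (prodMap φ φ) (prodMap (c 0) (c 0))
    rw [norm_sub_rev, hBφ] at h2
    rw [h0, hφn] at h1
    nlinarith
  have hM1 : |‖c 0‖ ^ 2 - 1| ≤ 3 * δ := by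
    rw [abs_le]; constructor <;> nlinarith
  have hdef : ‖c 0‖ ^ 4 - ‖prodMap (c 0) (c 0)‖ ^ 2 ≤ 21 * δ := by
    have h1 : ‖c 0‖ ^ 4 ≤ (1 + δ) ^ 4 := by gcongr
    have h2 : (1 - 3 * δ) ^ 2 ≤ ‖prodMap (c 0) (c 0)‖ ^ 2 := by
      gcongr
      · linarith
      · nlinarith
    nlinarith [mul_nonneg hδ0 hδ0, pow_nonneg hδ0 3]
  have hX0 : ‖c 0‖ ^ 2 - peak 1 (c 0) ≤ 105 * δ := by
    have h1 := peak_deficit_sub_le (J := 1) (c := c 0) (d := φ) (β := -γ) (by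
      rw [hφ, trans_neg_trans]; simp [low, norm_hermite])
    rw [h0, hφn] at h1
    push_cast at h1
    nlinarith
  -- Here `105 = 5 · 21` combines `peak_deficit_le` with the bound on the conserved energy deficit;
  -- `δ ≤ 1 / 10000` ensures `105 δ < 1 / 64`.
  have hX : ∀ t, ‖c t‖ ^ 2 - peak 1 (c t) ≤ 105 * δ := by
    refine bootstrap (ε := 1 / 64) ?_ hX0 (by linarith) fun t ht => ?_
    · exact (hc.continuous.norm.pow 2).sub ((continuous_peak 1).comp hc.continuous)
    · have := peak_deficit_le (c := c t) (by
        rw [hc.norm_eq]; have := (abs_le.1 hM1).1; linarith) ht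
      rw [hc.norm_prodMap_eq t] at this
      rw [hc.norm_eq t] at this ⊢
      linarith
  obtain ⟨β, hβ⟩ := exists_peak (J := 1) (by norm_num) (c t)
  set d := LLL.trans β (c t) with hd
  have hl : low 1 d = ‖d 0‖ ^ 2 := by simp [low]
  obtain ⟨θ, hθ⟩ := exists_phase (d 0)
  refine ⟨θ, -β, ?_⟩
  have hct : c t = LLL.trans (-β) d := by rw [hd, trans_neg_trans]
  rw [hct, ← map_smul, ← map_sub, LinearIsometry.norm_map]
  have hdec : d - Complex.exp (Complex.I * θ) • hermite 0 =
      tail 1 d + (((‖d 0‖ - 1 : ℝ) : ℂ) * Complex.exp (Complex.I * θ)) • hermite 0 := by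
    have e : ((‖d 0‖ - 1 : ℝ) : ℂ) * Complex.exp (Complex.I * θ) =
        d 0 - Complex.exp (Complex.I * θ) := by
      push_cast
      rw [sub_mul, one_mul, ← hθ]
    rw [tail, Finset.sum_range_one, e]
    module
  have h1 : ‖tail 1 d‖ ^ 2 ≤ 105 * δ := by
    rw [norm_tail_sq, hβ, hd, LinearIsometry.norm_map]
    exact hX t
  have h2 : (‖d 0‖ - 1) ^ 2 ≤ 108 * δ := by
    refine (sq_sub_one_le (norm_nonneg _)).trans ?_
    have h3 : ‖d 0‖ ^ 2 = ‖c 0‖ ^ 2 - ‖tail 1 d‖ ^ 2 := by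
      rw [norm_tail_sq, hl, hd, LinearIsometry.norm_map, hc.norm_eq t]; ring
    rw [h3]
    rw [abs_le] at hM1 ⊢
    constructor <;> nlinarith [hM1.1, hM1.2, sq_nonneg ‖tail 1 d‖]
  have hs : √δ ^ 2 = δ := Real.sq_sqrt hδ0
  have hs0 := Real.sqrt_nonneg δ
  rw [hdec]
  refine (norm_add_le _ _).trans ?_
  rw [norm_smul, norm_mul, norm_exp_I_mul, norm_hermite, mul_one, mul_one, Complex.norm_real,
    Real.norm_eq_abs]
  have h3 : ‖tail 1 d‖ ≤ 10.3 * √δ :=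
    (abs_le_of_sq_le_sq' (by rw [mul_pow, hs]; linarith) (by positivity)).2
  have h4 : |‖d 0‖ - 1| ≤ 10.4 * √δ :=
    (abs_le_of_sq_le_sq' (by rw [mul_pow, hs, sq_abs]; linarith) (by positivity)).2
  linarith


/-! ### Functions of degree at most one and the expansion around them. -/

theorem Coeff.add_apply (c d : Coeff) (n : ℕ) : (c + d) n = c n + d n := rfl
theorem Coeff.smul_apply (a : ℂ) (c : Coeff) (n : ℕ) : (a • c) n = a * c n := rfl

theorem raise_hermite (n : ℕ) : Raise (hermite n) (((√(n + 1 : ℝ) : ℝ) : ℂ) • hermite (n + 1)) := by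
  refine raise_iff.2 ⟨?_, fun m => ?_⟩
  · rw [Coeff.smul_apply, hermite_ne (by omega), mul_zero]
  · rw [Coeff.smul_apply]
    by_cases h : m = n
    · subst h; simp
    · simp [hermite_apply, h]

theorem prodMap_hermite_hermite (i j : ℕ) :
    prodMap (hermite i) (hermite j) = (tau i j : ℂ) • hermite (i + j) := by
  ext s
  rw [prodMap_hermite_apply, lp.coeFn_smul, Pi.smul_apply, smul_eq_mul, hermite_apply,
    hermite_apply]
  by_cases h : s = i + j
  · subst h; simp
  · rw [if_neg h]
    split_ifs with h1 h2
    · omega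
    all_goals simp

theorem norm_smul_hermite_add_sq {n : ℕ} {x : Coeff} (hx : x n = 0) (a : ℂ) :
    ‖a • hermite n + x‖ ^ 2 = ‖a‖ ^ 2 + ‖x‖ ^ 2 := by
  rw [norm_add_sq (𝕜 := ℂ), inner_smul_left, inner_hermite, hx, norm_smul, norm_hermite]
  simp

/-- The function of degree at most one with the given coordinates. -/
def lin (a b : ℂ) : Coeff := a • hermite 0 + b • hermite 1

/-- The image of `lin a b` under multiplication by `z`. -/
def linRaise (a b : ℂ) : Coeff := a • hermite 1 + (((√2 : ℝ) : ℂ) * b) • hermite 2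

theorem raise_lin (a b : ℂ) : Raise (lin a b) (linRaise a b) := by
  have h := ((raise_hermite 0).smul a).add ((raise_hermite 1).smul b)
  convert! h using 1
  rw [linRaise, smul_smul, smul_smul]
  norm_num [mul_comm]

theorem norm_lin_sq (a b : ℂ) : ‖lin a b‖ ^ 2 = ‖a‖ ^ 2 + ‖b‖ ^ 2 := by
  rw [lin, norm_smul_hermite_add_sq (by simp [hermite_apply]), norm_smul, norm_hermite, mul_one]

theorem norm_linRaise_sq (a b : ℂ) : ‖linRaise a b‖ ^ 2 = ‖a‖ ^ 2 + 2 * ‖b‖ ^ 2 := by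
  rw [linRaise, norm_smul_hermite_add_sq (by simp [hermite_apply]), norm_smul, norm_hermite,
    mul_one, norm_mul, mul_pow, Complex.norm_real, Real.norm_eq_abs, sq_abs,
    Real.sq_sqrt (by norm_num)]

theorem inner_lin (a b : ℂ) (x : Coeff) : inner ℂ (lin a b) x = conj a * x 0 + conj b * x 1 := by
  rw [lin, inner_add_left, inner_smul_left, inner_smul_left, inner_hermite, inner_hermite]

theorem lin_zero_apply (a b : ℂ) : lin a b 0 = a := by simp [-lp.coeFn_add, -lp.coeFn_smul, Coeff.add_apply, Coeff.smul_apply, lin, hermite_apply]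
theorem lin_one_apply (a b : ℂ) : lin a b 1 = b := by simp [-lp.coeFn_add, -lp.coeFn_smul, Coeff.add_apply, Coeff.smul_apply, lin, hermite_apply]

theorem inner_linRaise (a b : ℂ) (x : Coeff) :
    inner ℂ (linRaise a b) x = conj a * x 1 + (√2 : ℝ) * conj b * x 2 := by
  rw [linRaise, inner_add_left, inner_smul_left, inner_smul_left, inner_hermite, inner_hermite,
    map_mul, Complex.conj_ofReal]

/-- The defect `‖b‖⁴ / 2` comes from `tau 1 1 ² = 1 / 2`. Twice this defect is the value of `gram`
on the family, whence the coefficients of `lyap`. -/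
theorem norm_prodMap_lin_sq (a b : ℂ) :
    ‖prodMap (lin a b) (lin a b)‖ ^ 2 = (‖a‖ ^ 2 + ‖b‖ ^ 2) ^ 2 - ‖b‖ ^ 4 / 2 := by
  have h : prodMap (lin a b) (lin a b) = (a ^ 2 * tau 0 0) • hermite 0 +
      ((2 * a * b * tau 0 1) • hermite 1 + (b ^ 2 * tau 1 1) • hermite 2) := by
    simp only [lin, map_add, map_smul, add_apply, smul_apply, prodMap_hermite_hermite, tau_comm 1 0]
    norm_num
    module
  rw [h, norm_smul_hermite_add_sq (by rw [Coeff.add_apply, Coeff.smul_apply, Coeff.smul_apply,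
      hermite_ne (by norm_num), hermite_ne (by norm_num), mul_zero, mul_zero, add_zero]),
    norm_smul_hermite_add_sq (by simp [hermite_apply]), norm_smul, norm_hermite]
  simp only [norm_mul, norm_pow, Complex.norm_real, Real.norm_eq_abs, mul_pow, sq_abs, tau_sq]
  norm_num
  ring

section Remainder

variable {a b : ℂ} {w k : Coeff}

theorem Raise.coeff_eq_zero (h : Raise w k) {J : ℕ} (hw : ∀ n < J, w n = 0) {n : ℕ} (hn : n ≤ J) :
    k n = 0 := by
  obtain ⟨h0, h1⟩ := raise_iff.1 h
  cases n with
  | zero => exact h0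
  | succ n => rw [h1, hw n (by omega), mul_zero]

theorem norm_lin_add_sq (hw : ∀ n < 3, w n = 0) :
    ‖lin a b + w‖ ^ 2 = ‖a‖ ^ 2 + ‖b‖ ^ 2 + ‖w‖ ^ 2 := by
  rw [norm_add_sq (𝕜 := ℂ), inner_lin, hw 0 (by norm_num), hw 1 (by norm_num), norm_lin_sq]
  simp

theorem norm_linRaise_add_sq (h : Raise w k) (hw : ∀ n < 3, w n = 0) :
    ‖linRaise a b + k‖ ^ 2 = ‖a‖ ^ 2 + 2 * ‖b‖ ^ 2 + ‖k‖ ^ 2 := by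
  rw [norm_add_sq (𝕜 := ℂ), inner_linRaise, h.coeff_eq_zero hw (by norm_num),
    h.coeff_eq_zero hw (by norm_num), norm_linRaise_sq]
  simp

theorem inner_lin_add (h : Raise w k) (hw : ∀ n < 3, w n = 0) :
    inner ℂ (lin a b + w) (linRaise a b + k) = conj b * a + inner ℂ w k := by
  rw [inner_add_left, inner_lin, inner_add_right, ← inner_conj_symm w (linRaise a b),
    inner_linRaise, hw 1 (by norm_num), hw 2 (by norm_num)]
  simp only [lp.coeFn_add, Pi.add_apply, h.coeff_eq_zero hw (show 0 ≤ 3 by norm_num),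
    h.coeff_eq_zero hw (show 1 ≤ 3 by norm_num)]
  simp [-lp.coeFn_add, -lp.coeFn_smul, Coeff.add_apply, Coeff.smul_apply, linRaise,
    hermite_apply]

/-- The part of `prodMap (lin a b + w) (lin a b + w) / 2` which is linear in `w`. -/
def cross (a b : ℂ) (w : Coeff) : Coeff := prodMap (lin a b) w

/-- The identity `tau 1 s = tau 0 (s + 1) √(s + 1)` trades the product with mode one for
multiplication by `z`, so both parts acquire the same factor `tau 0 s`. -/
theorem cross_apply (h : Raise w k) (s : ℕ) :
    cross a b w s = tau 0 s * (a * w s + b * k s) := by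
  rw [cross, lin, map_add, map_smul, map_smul, add_apply, smul_apply, smul_apply, lp.coeFn_add,
    Pi.add_apply, lp.coeFn_smul, lp.coeFn_smul, Pi.smul_apply, Pi.smul_apply,
    prodMap_hermite_apply, prodMap_hermite_apply, if_pos (Nat.zero_le _), Nat.sub_zero]
  obtain ⟨h0, h1⟩ := raise_iff.1 h
  cases s with
  | zero => rw [h0]; simp; ring
  | succ s =>
    have ht : tau 1 s = tau 0 (s + 1) * √(s + 1 : ℝ) := by
      rw [tau, tau, ← Real.sqrt_mul (by positivity)]
      congr 1
      rw [add_comm 1 s, zero_add]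
      simp
      ring
    rw [if_pos (by omega), Nat.add_sub_cancel, ht, h1]
    push_cast
    simp only [smul_eq_mul]
    ring

theorem norm_cross_apply_sq (h : Raise w k) (s : ℕ) :
    ‖cross a b w s‖ ^ 2 = 1 / 2 ^ s * ‖a * w s + b * k s‖ ^ 2 := by
  rw [cross_apply h, norm_mul, mul_pow, Complex.norm_real, Real.norm_eq_abs, sq_abs, tau_zero_sq]

theorem norm_cross_le : ‖cross a b w‖ ≤ ‖lin a b‖ * ‖w‖ := norm_prodMap_le _ _

/-- The square of `lin a b` occupies levels zero to two, and every product with `w` starts at level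
three, so the two parts are orthogonal. -/
theorem norm_prodMap_lin_add_sq (hw : ∀ n < 3, w n = 0) :
    ‖prodMap (lin a b + w) (lin a b + w)‖ ^ 2 = (‖a‖ ^ 2 + ‖b‖ ^ 2) ^ 2 - ‖b‖ ^ 4 / 2 +
      ‖(2 : ℂ) • cross a b w + prodMap w w‖ ^ 2 := by
  have h : prodMap (lin a b + w) (lin a b + w) = prodMap (lin a b) (lin a b) +
      ((2 : ℂ) • cross a b w + prodMap w w) := by
    simp only [map_add, add_apply, cross]
    rw [prodMap_comm w (lin a b)]
    module
  have hvan : ∀ s < 3, ∀ c : Coeff, prodMap c w s = 0 := fun s hs c => by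
    rw [prodMap_apply]
    refine Finset.sum_eq_zero fun p hp => ?_
    have hp := Finset.HasAntidiagonal.mem_antidiagonal.1 hp
    rw [hw p.2 (by omega), mul_zero, mul_zero]
  have hvan' : ∀ s < 3, ((2 : ℂ) • cross a b w + prodMap w w) s = 0 := fun s hs => by
    rw [lp.coeFn_add, Pi.add_apply, lp.coeFn_smul, Pi.smul_apply, cross, hvan s hs, hvan s hs]
    simp
  have horth : inner ℂ (prodMap (lin a b) (lin a b))
      ((2 : ℂ) • cross a b w + prodMap w w) = 0 := by
    rw [← (Coeff.hasSum_inner _ _).tsum_eq]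
    refine (tsum_congr fun s => ?_).trans tsum_zero
    rcases lt_or_ge s 3 with hs | hs
    · rw [hvan' s hs, mul_zero]
    · have : prodMap (lin a b) (lin a b) s = 0 := by
        rw [prodMap_apply]
        refine Finset.sum_eq_zero fun p hp => ?_
        have hp := Finset.HasAntidiagonal.mem_antidiagonal.1 hp
        have : 2 ≤ p.1 ∨ 2 ≤ p.2 := by omega
        have hl : ∀ n, 2 ≤ n → lin a b n = 0 := fun n hn => by
          simp [-lp.coeFn_add, -lp.coeFn_smul, Coeff.add_apply, Coeff.smul_apply, lin, hermite_apply,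
            show n ≠ 0 by omega, show n ≠ 1 by omega]
        rcases this with h | h <;> simp [hl _ h]
      rw [this, map_zero, zero_mul]
  rw [h, norm_add_sq (𝕜 := ℂ), horth, norm_prodMap_lin_sq]
  simp

/-- The densities of the quadratic part of the Lyapunov functional. -/
def density (s : ℕ) (X Y : ℂ) : ℝ :=
  (s - 4) * ‖X‖ ^ 2 + (1 - 4 / s) * ‖Y‖ ^ 2 - 2 * (X * conj Y).re + 8 / 2 ^ s * ‖X + Y‖ ^ 2

/-- The sum of `‖k s‖² / s` is `‖w‖²`. Writing the terms in `‖b‖² ‖w‖²` this way lets the quadratic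
form decouple over `s` in the variables `a * w s` and `b * k s`. At `s = 0` the quotient is zero by
convention, and `k 0 = 0` anyway. -/
theorem hasSum_density (h : Raise w k) :
    HasSum (fun s => density s (a * w s) (b * k s))
      (‖k‖ ^ 2 * (‖a‖ ^ 2 + ‖b‖ ^ 2) - 5 * ‖a‖ ^ 2 * ‖w‖ ^ 2 - 4 * ‖b‖ ^ 2 * ‖w‖ ^ 2
        - 2 * (a * conj b * conj (inner ℂ w k)).re + 8 * ‖cross a b w‖ ^ 2) := by
  have h1 := (h.hasSum.mul_left (‖a‖ ^ 2)).sub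
    ((Coeff.hasSum_norm_sq w).mul_left (5 * ‖a‖ ^ 2))
  have h2 : HasSum (fun s : ℕ => ‖k s‖ ^ 2 / s) (‖w‖ ^ 2) := by
    obtain ⟨h0, h1⟩ := raise_iff.1 h
    refine (hasSum_nat_add_iff' 1).1 ?_
    simp only [Finset.range_one, Finset.sum_singleton, h0, norm_zero, ne_eq, OfNat.ofNat_ne_zero,
      not_false_eq_true, zero_pow, zero_div, sub_zero]
    refine (Coeff.hasSum_norm_sq w).congr_fun fun n => ?_
    rw [h1, norm_mul, mul_pow, Complex.norm_real, Real.norm_eq_abs, sq_abs,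
      Real.sq_sqrt (by positivity)]
    push_cast
    rw [mul_div_cancel_left₀ _ (by positivity)]
  have h3 := ((Coeff.hasSum_norm_sq k).mul_left (‖b‖ ^ 2)).sub (h2.mul_left (4 * ‖b‖ ^ 2))
  have h4 : HasSum (fun s => (a * conj b * (w s * conj (k s))).re)
      (a * conj b * conj (inner ℂ w k)).re := by
    refine Complex.hasSum_re (HasSum.mul_left _ ?_)
    rw [inner_conj_symm]
    exact (Coeff.hasSum_inner k w).congr_fun fun n => mul_comm _ _
  have h5 := (Coeff.hasSum_norm_sq (cross a b w)).mul_left 8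
  have h6 := ((h1.add h3).sub (h4.mul_left 2)).add h5
  convert! h6 using 1
  · funext s
    rw [norm_cross_apply_sq h, density]
    have : a * w s * conj (b * k s) = a * conj b * (w s * conj (k s)) := by
      rw [map_mul]; ring
    rw [this]
    simp only [norm_mul, mul_pow]
    ring
  · ring

theorem re_mul_conj_le (X Y : ℂ) {p q : ℝ} (hp : 0 < p) (h : 1 ≤ p * q) :
    2 * (X * conj Y).re ≤ p * ‖X‖ ^ 2 + q * ‖Y‖ ^ 2 := by
  have h1 : (X * conj Y).re ≤ ‖X‖ * ‖Y‖ := by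
    refine (Complex.re_le_norm _).trans ?_
    rw [norm_mul, RCLike.norm_conj]
  have h2 : 0 ≤ p * (q * ‖Y‖ ^ 2 + p * ‖X‖ ^ 2 - 2 * (‖X‖ * ‖Y‖)) := by
    nlinarith [sq_nonneg (p * ‖X‖ - ‖Y‖), mul_nonneg (sub_nonneg.2 h) (sq_nonneg ‖Y‖)]
  have := nonneg_of_mul_nonneg_right h2 hp
  linarith

theorem norm_add_sq_complex (X Y : ℂ) :
    ‖X + Y‖ ^ 2 = ‖X‖ ^ 2 + ‖Y‖ ^ 2 + 2 * (X * conj Y).re := by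
  simp only [← Complex.normSq_eq_norm_sq]
  exact Complex.normSq_add X Y

/-- Level three is totally degenerate, as `k` vanishes there when `w` starts at mode three; levels
four and five are perfect squares. Positivity alone is therefore not coercive, and the relation
between `w` and `k` must be used. -/
theorem density_three (X : ℂ) : density 3 X 0 = 0 := by
  rw [density]; norm_num

theorem density_four (X Y : ℂ) : density 4 X Y = ‖X - Y‖ ^ 2 / 2 := by
  have := norm_add_sq_complex X (-Y)
  rw [map_neg, mul_neg, Complex.neg_re, norm_neg, ← sub_eq_add_neg] at this
  rw [density, norm_add_sq_complex, this]; norm_num; ring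

theorem density_five (X Y : ℂ) : density 5 X Y = ‖5 * X - 3 * Y‖ ^ 2 / 20 := by
  have := norm_add_sq_complex (5 * X) (-(3 * Y))
  rw [← sub_eq_add_neg] at this
  have h : 5 * X * conj (-(3 * Y)) = ((-15 : ℝ) : ℂ) * (X * conj Y) := by
    rw [map_neg, map_mul, map_ofNat]; push_cast; ring
  rw [h, Complex.re_ofReal_mul, norm_neg, norm_mul, norm_mul, Complex.norm_ofNat,
    Complex.norm_ofNat] at this
  rw [density, norm_add_sq_complex, this]; norm_num; ring

theorem le_density {s : ℕ} (hs : 6 ≤ s) (X Y : ℂ) : ‖Y‖ ^ 2 ≤ 12 * density s X Y := by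
  rcases hs.eq_or_lt with rfl | hs
  · rw [density, norm_add_sq_complex]
    -- At level six the coupling term is still needed; the weight `17 / 7` makes the `‖X‖²` terms
    -- cancel. From level seven on the coupling term can be dropped.
    have := re_mul_conj_le X Y (p := 17 / 7) (q := 7 / 17) (by norm_num) (by norm_num)
    have h2 : (2 : ℝ) ^ 6 = 64 := by norm_num
    rw [h2]
    push_cast
    linarith [sq_nonneg ‖X‖, sq_nonneg ‖Y‖]
  · have hs' : (7 : ℝ) ≤ s := by exact_mod_cast hs
    have h1 := re_mul_conj_le X Y (p := s - 4) (q := 1 / (s - 4)) (by linarith)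
      (by rw [mul_one_div_cancel (by linarith : (s : ℝ) - 4 ≠ 0)])
    have h2 : (4 : ℝ) / s ≤ 4 / 7 := by gcongr
    have h3 : 1 / ((s : ℝ) - 4) ≤ 1 / 3 := by gcongr; linarith
    have h4 : 0 ≤ 8 / 2 ^ s * ‖X + Y‖ ^ 2 := by positivity
    rw [density]
    nlinarith [sq_nonneg ‖Y‖]

theorem density_nonneg {s : ℕ} (hs : 4 ≤ s) (X Y : ℂ) : 0 ≤ density s X Y := by
  rcases lt_or_ge s 6 with h | h
  · interval_cases s
    · rw [density_four]; positivity
    · rw [density_five]; positivity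
  · have := le_density h X Y
    nlinarith [sq_nonneg ‖Y‖]

end Remainder


/-! ### Coercivity of the quadratic part. -/

section Coercive

variable {a b : ℂ} {w k : Coeff}

theorem Raise.norm_sq_mul_le (h : Raise w k) {J : ℕ} (hw : ∀ n < J, w n = 0) :
    (J + 1) * ‖w‖ ^ 2 ≤ ‖k‖ ^ 2 := by
  refine hasSum_le (fun n => ?_) ((Coeff.hasSum_norm_sq w).mul_left (J + 1 : ℝ)) h.hasSum
  rcases lt_or_ge n J with hn | hn
  · simp [hw n hn]
  · gcongr

theorem Raise.norm_apply_sq (h : Raise w k) (n : ℕ) : ‖k (n + 1)‖ ^ 2 = (n + 1) * ‖w n‖ ^ 2 := by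
  rw [(raise_iff.1 h).2, norm_mul, mul_pow, Complex.norm_real, Real.norm_eq_abs, sq_abs,
    Real.sq_sqrt (by positivity)]

/-- Coercivity of the quadratic part of the Lyapunov functional. -/
theorem norm_sq_le_sum_density (h : Raise w k) (hw : ∀ n < 3, w n = 0) {q : ℝ}
    (hq : HasSum (fun s => density s (a * w s) (b * k s)) q) :
    ‖b‖ ^ 6 * ‖k‖ ^ 2 ≤ 14 * (‖a‖ ^ 2 + ‖b‖ ^ 2) ^ 2 * q := by
  have hk : ∀ n ≤ 3, k n = 0 := fun n hn => h.coeff_eq_zero hw hn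
  have hpos : ∀ s, 0 ≤ density s (a * w s) (b * k s) := by
    intro s
    rcases lt_or_ge s 4 with hs | hs
    · rw [hk s (by omega), mul_zero]
      rcases lt_or_ge s 3 with hs' | hs'
      · rw [hw s hs']; simp [density]
      · obtain rfl : s = 3 := by omega
        rw [density_three]
    · exact density_nonneg hs _ _
  have hle : ∀ s, density s (a * w s) (b * k s) ≤ q := fun s => le_hasSum hq s fun j _ => hpos j
  have h6 : ‖b‖ ^ 2 * ‖k 6‖ ^ 2 ≤ 12 * density 6 (a * w 6) (b * k 6) := by
    have := le_density (le_refl 6) (a * w 6) (b * k 6)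
    rwa [norm_mul, mul_pow] at this
  -- The degenerate levels are recovered downwards: up to the density at level five, `b * k 5` is a
  -- multiple of `a * w 5`, and `w 5` is proportional to `k 6`, already controlled. Level four
  -- follows in the same way from level five.
  have h5 : ‖b‖ ^ 2 * ‖k 5‖ ^ 2 ≤ 5 * density 5 (a * w 5) (b * k 5) + ‖a‖ ^ 2 * ‖k 6‖ ^ 2 := by
    have e := h.norm_apply_sq 5
    have h1 : ‖3 * (b * k 5)‖ ≤ ‖5 * (a * w 5)‖ + ‖5 * (a * w 5) - 3 * (b * k 5)‖ := by
      have := norm_sub_le (5 * (a * w 5)) (5 * (a * w 5) - 3 * (b * k 5))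
      rwa [sub_sub_cancel] at this
    rw [density_five, e]
    set y := ‖5 * (a * w 5) - 3 * (b * k 5)‖
    rw [norm_mul, norm_mul, norm_mul, norm_mul, Complex.norm_ofNat, Complex.norm_ofNat] at h1
    have h2 : (3 * (‖b‖ * ‖k 5‖)) ^ 2 ≤ (5 * (‖a‖ * ‖w 5‖) + y) ^ 2 := by gcongr
    push_cast
    nlinarith [sq_nonneg (5 * (‖a‖ * ‖w 5‖) - y), sq_nonneg (‖a‖ * ‖w 5‖), sq_nonneg y]
  have h4 : ‖b‖ ^ 2 * ‖k 4‖ ^ 2 ≤ 4 * density 4 (a * w 4) (b * k 4)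
      + 2 / 5 * (‖a‖ ^ 2 * ‖k 5‖ ^ 2) := by
    have e := h.norm_apply_sq 4
    have h1 : ‖b * k 4‖ ≤ ‖a * w 4‖ + ‖a * w 4 - b * k 4‖ := by
      have := norm_sub_le (a * w 4) (a * w 4 - b * k 4)
      rwa [sub_sub_cancel] at this
    rw [density_four, e]
    set y := ‖a * w 4 - b * k 4‖
    rw [norm_mul, norm_mul] at h1
    have h2 : (‖b‖ * ‖k 4‖) ^ 2 ≤ (‖a‖ * ‖w 4‖ + y) ^ 2 := by gcongr
    push_cast
    nlinarith [sq_nonneg (‖a‖ * ‖w 4‖ - y)]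
  have h7 := hle 4
  have h8 := hle 5
  have h9 := hle 6
  have hA : 0 ≤ ‖a‖ ^ 2 := by positivity
  have hB : 0 ≤ ‖b‖ ^ 2 := by positivity
  set A := ‖a‖ ^ 2
  set B := ‖b‖ ^ 2 with hBdef
  have hB6 : ‖b‖ ^ 6 = B ^ 3 := by rw [hBdef]; ring
  rw [hB6]
  have hq0 : 0 ≤ q := (hpos 4).trans h7
  have h5' : B ^ 2 * ‖k 5‖ ^ 2 ≤ 5 * B * density 5 (a * w 5) (b * k 5) + 12 * A * q := by
    nlinarith [mul_le_mul_of_nonneg_left h5 hB, mul_le_mul_of_nonneg_left h6 hA,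
      mul_le_mul_of_nonneg_left h9 hA]
  have h4' : B ^ 3 * ‖k 4‖ ^ 2 ≤ 4 * B ^ 2 * density 4 (a * w 4) (b * k 4) +
      (2 * (A * B) + 5 * A ^ 2) * q := by
    have h10 := mul_le_mul_of_nonneg_left h4 (sq_nonneg B)
    have h11 := mul_le_mul_of_nonneg_left h5' hA
    have h12 := mul_le_mul_of_nonneg_left h8 (mul_nonneg hA hB)
    nlinarith [mul_nonneg (sq_nonneg A) hq0]
  -- Only levels four and five need the total `q` on the right; as single terms they add a finite
  -- amount to the sum over `s`.
  have key : ∀ s, B ^ 3 * ‖k s‖ ^ 2 ≤ 12 * B ^ 2 * density s (a * w s) (b * k s) +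
      ((if s = 5 then 12 * (A * B) * q else 0) +
        if s = 4 then (2 * (A * B) + 5 * A ^ 2) * q else 0) := by
    intro s
    rcases lt_or_ge s 4 with hs | hs
    · rw [hk s (by omega), if_neg (by omega), if_neg (by omega)]
      simp only [norm_zero]
      have := mul_nonneg (sq_nonneg B) (hpos s)
      rw [hk s (by omega)] at this
      nlinarith
    rcases hs.eq_or_lt with rfl | hs
    · rw [if_neg (by norm_num), if_pos rfl]
      nlinarith [mul_nonneg (sq_nonneg B) (hpos 4)]
    rcases (show 5 ≤ s from hs).eq_or_lt with rfl | hs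
    · rw [if_pos rfl, if_neg (by norm_num)]
      nlinarith [mul_nonneg (sq_nonneg B) (hpos 5), mul_le_mul_of_nonneg_left h5' hB]
    · rw [if_neg (by omega), if_neg (by omega)]
      have := le_density (show 6 ≤ s from hs) (a * w s) (b * k s)
      rw [norm_mul, mul_pow] at this
      nlinarith [mul_le_mul_of_nonneg_left this (sq_nonneg B)]
  have hsum := hasSum_le key ((Coeff.hasSum_norm_sq k).mul_left (B ^ 3))
    ((hq.mul_left (12 * B ^ 2)).add
      ((hasSum_ite_eq 5 (12 * (A * B) * q)).add (hasSum_ite_eq 4 ((2 * (A * B) + 5 * A ^ 2) * q))))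
  nlinarith [mul_nonneg (mul_nonneg hA hB) hq0, mul_nonneg (sq_nonneg A) hq0,
    mul_nonneg (sq_nonneg B) hq0]

end Coercive

/-! ### The Lyapunov functional and its expansion. -/

/-- The Gram determinant of `c` and its image `e` under multiplication by `z`, reduced by the mass.
It is invariant under magnetic translations. -/
def gram (c e : Coeff) : ℝ := ‖e‖ ^ 2 * ‖c‖ ^ 2 - ‖c‖ ^ 4 - ‖inner ℂ c e‖ ^ 2

/-- The Lyapunov functional; it vanishes on the functions `lin a b`. -/
def lyap (c e : Coeff) : ℝ := gram c e - 2 * ‖c‖ ^ 4 + 2 * ‖prodMap c c‖ ^ 2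

/-- Subtracting a multiple of `c` from `e` does not change a Gram determinant. A translation acts on
the pair by an isometry followed by such a subtraction. -/
theorem gram_sub_smul (c e : Coeff) (β : ℂ) : gram c (e - β • c) = gram c e := by
  have h1 : ‖e - β • c‖ ^ 2 = ‖e‖ ^ 2 - 2 * (β * conj (inner ℂ c e)).re + ‖β‖ ^ 2 * ‖c‖ ^ 2 := by
    rw [norm_sub_sq (𝕜 := ℂ), inner_smul_right, inner_conj_symm, norm_smul, mul_pow]
    rfl
  have h2 : ‖(inner ℂ c e : ℂ) - β * (‖c‖ ^ 2 : ℝ)‖ ^ 2 = ‖(inner ℂ c e : ℂ)‖ ^ 2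
      - 2 * (β * conj (inner ℂ c e)).re * ‖c‖ ^ 2 + ‖β‖ ^ 2 * ‖c‖ ^ 4 := by
    rw [sub_eq_add_neg, add_comm, norm_add_sq_complex, norm_neg, norm_mul, Complex.norm_real,
      Real.norm_of_nonneg (by positivity)]
    have : -(β * ((‖c‖ ^ 2 : ℝ) : ℂ)) * conj (inner ℂ c e) =
        ((-‖c‖ ^ 2 : ℝ) : ℂ) * (β * conj (inner ℂ c e)) := by push_cast; ring
    rw [this, Complex.re_ofReal_mul]
    ring
  rw [gram, gram, inner_sub_right, inner_smul_right, inner_self_eq_norm_sq_to_K, h1]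
  have h3 := h2
  push_cast at h3
  erw [h3]
  ring

theorem gram_trans (c e : Coeff) (β : ℂ) :
    gram (trans β c) (trans β e - β • trans β c) = gram c e := by
  rw [gram_sub_smul, gram, gram, LinearIsometry.norm_map, LinearIsometry.norm_map,
    LinearIsometry.inner_map_map]

theorem lyap_trans (c e : Coeff) (β : ℂ) :
    lyap (trans β c) (trans β e - β • trans β c) = lyap c e := by
  rw [lyap, lyap, gram_trans, LinearIsometry.norm_map, norm_prodMap_trans]

section Remainder

variable {a b : ℂ} {w k : Coeff}

theorem gram_eq (h : Raise w k) (hw : ∀ n < 3, w n = 0) :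
    gram (lin a b + w) (linRaise a b + k) = ‖b‖ ^ 4 + ‖b‖ ^ 2 * ‖w‖ ^ 2 +
      (‖k‖ ^ 2 - ‖w‖ ^ 2) * (‖a‖ ^ 2 + ‖b‖ ^ 2 + ‖w‖ ^ 2) -
      2 * (a * conj b * conj (inner ℂ w k)).re - ‖(inner ℂ w k : ℂ)‖ ^ 2 := by
  rw [gram, inner_lin_add h hw, norm_linRaise_add_sq h hw, norm_add_sq_complex,
    show ‖lin a b + w‖ ^ 4 = (‖lin a b + w‖ ^ 2) ^ 2 by ring, norm_lin_add_sq hw, norm_mul,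
    RCLike.norm_conj, mul_comm (conj b)]
  ring

/-- Serves to read `‖b‖` off the conserved quantity `gram`. -/
theorem abs_gram_sub_le (h : Raise w k) (hw : ∀ n < 3, w n = 0) :
    |gram (lin a b + w) (linRaise a b + k) - ‖b‖ ^ 4| ≤ 3 * ‖lin a b + w‖ ^ 2 * ‖k‖ ^ 2 := by
  have h1 : ‖(inner ℂ w k : ℂ)‖ ≤ ‖w‖ * ‖k‖ := norm_inner_le_norm w k
  have h2 := h.norm_sq_mul_le hw
  have h3 : |(a * conj b * conj (inner ℂ w k)).re| ≤ ‖a‖ * ‖b‖ * ‖(inner ℂ w k : ℂ)‖ := by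
    refine (Complex.abs_re_le_norm _).trans ?_
    rw [norm_mul, norm_mul, RCLike.norm_conj, RCLike.norm_conj]
  rw [gram_eq h hw, norm_lin_add_sq hw]
  set x := ‖(inner ℂ w k : ℂ)‖
  set y := (a * conj b * conj (inner ℂ w k)).re
  have hx : 0 ≤ x := norm_nonneg _
  have ha := norm_nonneg a
  have hb := norm_nonneg b
  have hw0 := norm_nonneg w
  have hk0 := norm_nonneg k
  have h4 : ‖w‖ ≤ ‖k‖ := by
    push_cast at h2
    nlinarith
  have h5 : x ^ 2 ≤ ‖w‖ ^ 2 * ‖k‖ ^ 2 := by rw [← mul_pow]; gcongr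
  have h6 : x ≤ ‖k‖ ^ 2 := h1.trans (by nlinarith)
  have h7 : |y| ≤ (‖a‖ ^ 2 + ‖b‖ ^ 2) / 2 * ‖k‖ ^ 2 := by
    refine h3.trans ?_
    gcongr
    nlinarith [sq_nonneg (‖a‖ - ‖b‖)]
  have h8 : ‖w‖ ^ 2 ≤ ‖k‖ ^ 2 := by gcongr
  have h9 := abs_le.1 h7
  have h10 : 0 ≤ x ^ 2 := by positivity
  have hA : 0 ≤ ‖a‖ ^ 2 := by positivity
  have hB : 0 ≤ ‖b‖ ^ 2 := by positivity
  have hW : 0 ≤ ‖w‖ ^ 2 := by positivity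
  have hK : 0 ≤ ‖k‖ ^ 2 := by positivity
  rw [abs_le]
  constructor <;> nlinarith [mul_nonneg hA hW, mul_nonneg hB hW, mul_nonneg hA hK, mul_nonneg hB hK,
    mul_nonneg hW hK, mul_le_mul_of_nonneg_left h8 hA, mul_le_mul_of_nonneg_left h8 hB,
    mul_le_mul_of_nonneg_left h8 hW]

/-- By Cauchy-Schwarz the quartic term `‖w‖² ‖k‖²` absorbs the squared scalar product of `w` and
`k`. The errors thus involve `w` only, and no smallness of `k` has to be known in advance. -/
theorem sub_le_lyap (h : Raise w k) (hw : ∀ n < 3, w n = 0) {q : ℝ}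
    (hq : HasSum (fun s => density s (a * w s) (b * k s)) q) :
    q - 3 * ‖w‖ ^ 4 - 8 * ‖lin a b‖ * ‖w‖ ^ 3 ≤ lyap (lin a b + w) (linRaise a b + k) := by
  have h1 : ‖(inner ℂ w k : ℂ)‖ ≤ ‖w‖ * ‖k‖ := norm_inner_le_norm w k
  have h5 : ‖(inner ℂ w k : ℂ)‖ ^ 2 ≤ ‖w‖ ^ 2 * ‖k‖ ^ 2 := by rw [← mul_pow]; gcongr
  have h2 : 4 * ‖cross a b w‖ ^ 2 - 4 * (‖lin a b‖ * ‖w‖) * ‖w‖ ^ 2 ≤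
      ‖(2 : ℂ) • cross a b w + prodMap w w‖ ^ 2 := by
    have h3 : ‖(2 : ℂ) • cross a b w‖ = 2 * ‖cross a b w‖ := by
      rw [norm_smul, Complex.norm_ofNat]
    have h4 : ‖(2 : ℂ) • cross a b w‖ - ‖prodMap w w‖ ≤ ‖(2 : ℂ) • cross a b w + prodMap w w‖ := by
      have := norm_sub_norm_le ((2 : ℂ) • cross a b w) (-prodMap w w)
      rwa [norm_neg, sub_neg_eq_add] at this
    rw [h3] at h4
    have h6 := norm_prodMap_le w w
    have h7 := norm_cross_le (a := a) (b := b) (w := w)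
    have h8 := norm_nonneg (cross a b w)
    have h9 := norm_nonneg (prodMap w w)
    have h10 := norm_nonneg ((2 : ℂ) • cross a b w + prodMap w w)
    rcases le_total (2 * ‖cross a b w‖) ‖prodMap w w‖ with hle | hle
    · nlinarith [mul_nonneg h8 (sub_nonneg.2 hle), mul_nonneg (norm_nonneg w) (norm_nonneg w),
        mul_le_mul h7 h6 h9 (by positivity)]
    · have : (2 * ‖cross a b w‖ - ‖prodMap w w‖) ^ 2 ≤
          ‖(2 : ℂ) • cross a b w + prodMap w w‖ ^ 2 := by
        gcongr
      nlinarith [mul_le_mul h7 h6 h9 (by positivity)]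
  rw [hq.unique (hasSum_density h), lyap, gram_eq h hw, norm_prodMap_lin_add_sq hw,
    show ‖lin a b + w‖ ^ 4 = (‖lin a b + w‖ ^ 2) ^ 2 by ring, norm_lin_add_sq hw]
  nlinarith

end Remainder


/-! ### Control of the remainder in the optimal frame. -/

theorem exists_norm_sq_le_lyap {R ρ : ℝ} (hR : 0 < R) (hρ : 0 < ρ) :
    ∃ ε > (0 : ℝ), ∃ C > (0 : ℝ), ∀ (a b : ℂ) (w k : Coeff), Raise w k → (∀ n < 3, w n = 0) →
      ‖lin a b + w‖ ≤ R → ρ ≤ ‖b‖ ^ 4 → ‖w‖ ≤ ε →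
      ‖k‖ ^ 2 ≤ C * lyap (lin a b + w) (linRaise a b + k) := by
  -- This is the coercivity constant in `κ ‖k‖² ≤ q`, obtained from `ρ ≤ ‖b‖⁴` and the bound `R²` on
  -- the mass. The smallness of `w` keeps the errors of higher order below `κ ‖w‖²`, and `4 ‖w‖² ≤
  -- ‖k‖²`.
  set κ := ρ ^ 2 / (14 * R ^ 6) with hκ
  have hκ0 : 0 < κ := by positivity
  refine ⟨min 1 (κ / (3 + 8 * R)), by positivity, 2 / κ, by positivity, ?_⟩
  intro a b w k h hw hn hb hwε
  have hw1 : ‖w‖ ≤ 1 := hwε.trans (min_le_left _ _)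
  have hw2 : (3 + 8 * R) * ‖w‖ ≤ κ := by
    have := hwε.trans (min_le_right _ _)
    rwa [le_div_iff₀ (by positivity), mul_comm] at this
  have hq := hasSum_density (a := a) (b := b) h
  have hle := sub_le_lyap h hw hq
  have hco := norm_sq_le_sum_density h hw hq
  set q := ‖k‖ ^ 2 * (‖a‖ ^ 2 + ‖b‖ ^ 2) - 5 * ‖a‖ ^ 2 * ‖w‖ ^ 2 - 4 * ‖b‖ ^ 2 * ‖w‖ ^ 2
        - 2 * (a * conj b * conj (inner ℂ w k)).re + 8 * ‖cross a b w‖ ^ 2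
  have hn2 := norm_lin_add_sq (a := a) (b := b) hw
  have hnR : ‖lin a b + w‖ ^ 2 ≤ R ^ 2 := by gcongr
  have hAB : ‖a‖ ^ 2 + ‖b‖ ^ 2 ≤ R ^ 2 := by nlinarith [sq_nonneg ‖w‖]
  have hB : ‖b‖ ^ 2 ≤ R ^ 2 := by nlinarith [sq_nonneg ‖a‖]
  have hv : ‖lin a b‖ ≤ R := by
    refine (abs_le_of_sq_le_sq' ?_ hR.le).2
    rw [norm_lin_sq]; exact hAB
  have hb0 : 0 < ‖b‖ := by
    rcases (norm_nonneg b).eq_or_lt with h0 | h0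
    · rw [← h0] at hb; norm_num at hb; linarith
    · exact h0
  have hq0 : 0 ≤ q := by
    have : 0 ≤ 14 * (‖a‖ ^ 2 + ‖b‖ ^ 2) ^ 2 * q := le_trans (by positivity) hco
    exact nonneg_of_mul_nonneg_right this (by positivity)
  have h1 : κ * ‖k‖ ^ 2 ≤ q := by
    have e : ρ ^ 2 * ‖k‖ ^ 2 ≤ 14 * R ^ 6 * q := by
      calc ρ ^ 2 * ‖k‖ ^ 2 ≤ (‖b‖ ^ 4) ^ 2 * ‖k‖ ^ 2 := by gcongr
        _ = ‖b‖ ^ 2 * (‖b‖ ^ 6 * ‖k‖ ^ 2) := by ring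
        _ ≤ ‖b‖ ^ 2 * (14 * (‖a‖ ^ 2 + ‖b‖ ^ 2) ^ 2 * q) := by gcongr
        _ ≤ R ^ 2 * (14 * (R ^ 2) ^ 2 * q) := by gcongr
        _ = 14 * R ^ 6 * q := by ring
    rw [hκ, div_mul_eq_mul_div, div_le_iff₀ (by positivity)]
    linarith
  have h2 := h.norm_sq_mul_le hw
  have h3 : 3 * ‖w‖ ^ 4 + 8 * ‖lin a b‖ * ‖w‖ ^ 3 ≤ κ * ‖w‖ ^ 2 := by
    calc 3 * ‖w‖ ^ 4 + 8 * ‖lin a b‖ * ‖w‖ ^ 3 = (3 * ‖w‖ + 8 * ‖lin a b‖) * ‖w‖ * ‖w‖ ^ 2 := by ring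
      _ ≤ (3 * 1 + 8 * R) * ‖w‖ * ‖w‖ ^ 2 := by gcongr
      _ ≤ κ * ‖w‖ ^ 2 := by gcongr; linarith
  rw [div_mul_eq_mul_div, le_div_iff₀ hκ0]
  push_cast at h2
  nlinarith [mul_le_mul_of_nonneg_left h2 hκ0.le, mul_nonneg hκ0.le (sq_nonneg ‖k‖),
    mul_nonneg hκ0.le (sq_nonneg ‖w‖)]

theorem tail_two (d : Coeff) : d = lin (d 0) (d 1) + tail 2 d := by
  rw [tail, lin, Finset.sum_range_succ, Finset.sum_range_one]
  abel

theorem low_two (d : Coeff) : low 2 d = ‖d 0‖ ^ 2 + ‖d 1‖ ^ 2 := by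
  rw [low, Finset.sum_range_succ, Finset.sum_range_one]

/-- Twice the energy deficit of the degree one part is `‖d 1‖⁴`, and the tail perturbs this
slightly. A deficit bounded below thus keeps `d 1` away from zero. -/
theorem le_norm_coeff_one {d : Coeff} {R : ℝ} (hd : ‖d‖ ≤ R) :
    2 * (‖d‖ ^ 4 - ‖prodMap d d‖ ^ 2) - 4 * R ^ 2 * ‖tail 2 d‖ ^ 2 - 8 * R ^ 3 * ‖tail 2 d‖ ≤
      ‖d 1‖ ^ 4 := by
  have hR : 0 ≤ R := (norm_nonneg _).trans hd
  have h1 := norm_tail_sq 2 d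
  have h2 := norm_prodMap_lin_sq (d 0) (d 1)
  have h3 : ‖lin (d 0) (d 1)‖ ^ 2 = ‖d‖ ^ 2 - ‖tail 2 d‖ ^ 2 := by
    rw [norm_lin_sq, h1, low_two]; ring
  have hv : ‖lin (d 0) (d 1)‖ ≤ R := by
    refine (abs_le_of_sq_le_sq' ?_ hR).2
    nlinarith [sq_nonneg ‖tail 2 d‖, norm_nonneg d]
  have h4 := norm_prodMap_sub_le (lin (d 0) (d 1)) d
  have h5 : ‖lin (d 0) (d 1) - d‖ = ‖tail 2 d‖ := by
    nth_rw 3 [tail_two d]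
    rw [sub_add_cancel_left, norm_neg]
  rw [h5] at h4
  have h6 : ‖prodMap (lin (d 0) (d 1)) (lin (d 0) (d 1))‖ - ‖prodMap d d‖ ≤ 2 * R * ‖tail 2 d‖ := by
    refine (norm_sub_norm_le _ _).trans (h4.trans ?_)
    nlinarith [norm_nonneg (tail 2 d)]
  have h7 : ‖prodMap (lin (d 0) (d 1)) (lin (d 0) (d 1))‖ ≤ R ^ 2 :=
    (norm_prodMap_le _ _).trans (by nlinarith [norm_nonneg (lin (d 0) (d 1))])
  have h8 : ‖prodMap d d‖ ≤ R ^ 2 :=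
    (norm_prodMap_le _ _).trans (by nlinarith [norm_nonneg d])
  rw [← low_two] at h2
  have h9 : low 2 d = ‖d‖ ^ 2 - ‖tail 2 d‖ ^ 2 := by rw [h1]; ring
  rw [h9] at h2
  set x := ‖prodMap (lin (d 0) (d 1)) (lin (d 0) (d 1))‖
  set y := ‖prodMap d d‖
  set ν := ‖tail 2 d‖
  have hx : 0 ≤ x := norm_nonneg _
  have hy : 0 ≤ y := norm_nonneg _
  have hν : 0 ≤ ν := norm_nonneg _
  have h10 : x ^ 2 - y ^ 2 ≤ 4 * R ^ 3 * ν := by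
    have e : x ^ 2 - y ^ 2 = (x - y) * (x + y) := by ring
    rw [e]
    have : (x - y) * (x + y) ≤ (2 * R * ν) * (x + y) := by gcongr
    have h11 : (2 * R * ν) * (x + y) ≤ (2 * R * ν) * (R ^ 2 + R ^ 2) := by gcongr
    linarith
  have h12 : ‖d‖ ^ 2 * ν ^ 2 ≤ R ^ 2 * ν ^ 2 := by gcongr
  nlinarith [sq_nonneg (ν ^ 2)]

/-- Near the family `lin a b`, with `b` bounded away from zero, the Lyapunov functional controls
the distance to the translates of that family. -/
theorem exists_frame {R r : ℝ} (hR : 0 < R) (hr : 0 < r) :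
    ∃ ε > (0 : ℝ), ∃ C > (0 : ℝ), ∀ c e : Coeff, Raise c e → ‖c‖ ≤ R →
      r ≤ 2 * (‖c‖ ^ 4 - ‖prodMap c c‖ ^ 2) → ‖c‖ ^ 2 - peak 2 c ≤ ε →
      ∃ (β a b : ℂ) (w k : Coeff), trans β c = lin a b + w ∧ Raise w k ∧ (∀ n < 3, w n = 0) ∧
        ‖w‖ ^ 2 = ‖c‖ ^ 2 - peak 2 c ∧ ‖k‖ ^ 2 ≤ C * lyap c e := by
  obtain ⟨ε, hε, C, hC, H⟩ := exists_norm_sq_le_lyap hR (half_pos hr)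
  set η := min ε (min 1 (r / (2 * (4 * R ^ 2 + 8 * R ^ 3)))) with hη
  have hη0 : 0 < η := by positivity
  refine ⟨η ^ 2, by positivity, C, hC, fun c e he hcR hcr hcε => ?_⟩
  obtain ⟨β, hβ⟩ := exists_peak (le_refl 2) c
  set d := trans β c with hd
  have hdn : ‖d‖ = ‖c‖ := LinearIsometry.norm_map _ _
  have ht : ‖tail 2 d‖ ^ 2 = ‖c‖ ^ 2 - peak 2 c := by rw [norm_tail_sq, hβ, hdn]
  have htη : ‖tail 2 d‖ ≤ η := (abs_le_of_sq_le_sq' (by rw [ht]; exact hcε) hη0.le).2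
  have hb : r / 2 ≤ ‖d 1‖ ^ 4 := by
    have h1 := le_norm_coeff_one (d := d) (R := R) (by rwa [hdn])
    rw [hdn, hd, norm_prodMap_trans, ← hd] at h1
    have h2 : ‖tail 2 d‖ ≤ 1 := htη.trans ((min_le_right _ _).trans (min_le_left _ _))
    have h3 : (2 * (4 * R ^ 2 + 8 * R ^ 3)) * ‖tail 2 d‖ ≤ r := by
      have := htη.trans ((min_le_right _ _).trans (min_le_right _ _))
      rwa [le_div_iff₀ (by positivity), mul_comm] at this
    have h4 : R ^ 2 * ‖tail 2 d‖ ^ 2 ≤ R ^ 2 * ‖tail 2 d‖ := by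
      gcongr
      nlinarith [norm_nonneg (tail 2 d)]
    linarith
  have hpk : low 2 d = peak 2 d := by
    refine le_antisymm (by simpa [trans_zero] using low_le_peak 2 d 0) (ciSup_le fun β' => ?_)
    rw [hd, low_trans_trans, ← hd, hβ]
    exact low_le_peak 2 c _
  -- Criticality of the frame leaves `d 1 = 0` as the only alternative, which the lower bound on the
  -- energy deficit excludes.
  have hd2 : d 2 = 0 := by
    refine (peak_two_critical hpk).resolve_left fun h => ?_
    rw [h, norm_zero] at hb
    norm_num at hb
    linarith
  have hw : ∀ n < 3, tail 2 d n = 0 := fun n hn => by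
    rw [tail_apply]
    split_ifs with h
    · rfl
    · obtain rfl : n = 2 := by omega
      exact hd2
  have hdec := tail_two d
  have hde : Raise d (trans β e - β • d) := he.trans β
  set k := trans β e - β • d - linRaise (d 0) (d 1) with hk
  have hwk : Raise (tail 2 d) k := by
    have := hde.sub (raise_lin (d 0) (d 1))
    rwa [← hk, show d - lin (d 0) (d 1) = tail 2 d by nth_rw 1 [hdec]; abel] at this
  refine ⟨β, d 0, d 1, tail 2 d, k, hdec, hwk, hw, ht, ?_⟩
  have h1 := H (d 0) (d 1) (tail 2 d) k hwk hw (by rw [← hdec, hdn]; exact hcR) hb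
    (htη.trans (min_le_left _ _))
  rw [← hdec, show linRaise (d 0) (d 1) + k = trans β e - β • d by rw [hk]; abel, hd,
    lyap_trans] at h1
  exact h1


/-! ### Perturbation estimates for the conserved quantities. -/

theorem abs_mul_sub_mul_le {x x' y y' A B p q : ℝ} (h1 : |x - x'| ≤ p) (h2 : |y - y'| ≤ q)
    (hy : |y| ≤ B) (hx : |x'| ≤ A) : |x * y - x' * y'| ≤ p * B + A * q := by
  have e : x * y - x' * y' = (x - x') * y + x' * (y - y') := by ring
  rw [e]
  refine (abs_add_le _ _).trans ?_
  rw [abs_mul, abs_mul]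
  have := (abs_nonneg _).trans h1
  have := (abs_nonneg _).trans hx
  gcongr

section Perturbation

variable {E : Type*} [SeminormedAddCommGroup E]

theorem abs_norm_sq_sub_le {x y : E} {R δ : ℝ} (hx : ‖x‖ ≤ R) (hy : ‖y‖ ≤ R) (h : ‖x - y‖ ≤ δ) :
    |‖x‖ ^ 2 - ‖y‖ ^ 2| ≤ 2 * R * δ := by
  have h0 := (abs_norm_sub_norm_le x y).trans h
  have := abs_mul_sub_mul_le h0 h0 (B := R) (by rwa [abs_norm]) (by rwa [abs_norm] : |‖y‖| ≤ R)
  rw [sq, sq]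
  linarith

variable {c e v f : Coeff} {R δ : ℝ}

theorem abs_norm_pow_four_sub_le (hc : ‖c‖ ≤ R) (hv : ‖v‖ ≤ R) (h : ‖c - v‖ ≤ δ) :
    |‖c‖ ^ 4 - ‖v‖ ^ 4| ≤ 4 * R ^ 3 * δ := by
  have h1 := abs_norm_sq_sub_le hc hv h
  have h2 := abs_mul_sub_mul_le h1 h1 (B := R ^ 2) (A := R ^ 2)
    (by rw [abs_of_nonneg (by positivity)]; gcongr) (by rw [abs_of_nonneg (by positivity)]; gcongr)
  rw [show ‖c‖ ^ 4 - ‖v‖ ^ 4 = ‖c‖ ^ 2 * ‖c‖ ^ 2 - ‖v‖ ^ 2 * ‖v‖ ^ 2 by ring]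
  linarith

theorem abs_norm_prodMap_sq_sub_le (hc : ‖c‖ ≤ R) (hv : ‖v‖ ≤ R) (h : ‖c - v‖ ≤ δ) :
    |‖prodMap c c‖ ^ 2 - ‖prodMap v v‖ ^ 2| ≤ 4 * R ^ 3 * δ := by
  have hR : 0 ≤ R := (norm_nonneg _).trans hc
  have h1 := norm_prodMap_sub_le c v
  have hδ : 0 ≤ δ := (norm_nonneg _).trans h
  have h2 : ‖c - v‖ * (‖c‖ + ‖v‖) ≤ δ * (R + R) := by gcongr
  have hb : ∀ d : Coeff, ‖d‖ ≤ R → ‖prodMap d d‖ ≤ R ^ 2 := fun d hd =>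
    (norm_prodMap_le _ _).trans (by nlinarith [norm_nonneg d])
  have := abs_norm_sq_sub_le (hb c hc) (hb v hv) (h1.trans h2)
  linarith

theorem norm_inner_sub_inner_le (hc : ‖c‖ ≤ R) (hf : ‖f‖ ≤ R) (h : ‖c - v‖ ≤ δ)
    (h' : ‖e - f‖ ≤ δ) : ‖(inner ℂ c e : ℂ) - inner ℂ v f‖ ≤ 2 * R * δ := by
  have hR : 0 ≤ R := (norm_nonneg _).trans hc
  have h0 : (inner ℂ c e : ℂ) - inner ℂ v f = inner ℂ c (e - f) + inner ℂ (c - v) f := by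
    rw [inner_sub_left c v f, inner_sub_right c e f]; ring
  have hδ : 0 ≤ δ := (norm_nonneg _).trans h
  have h1 : ‖(inner ℂ c (e - f) : ℂ)‖ ≤ R * δ :=
    (norm_inner_le_norm c (e - f)).trans (by gcongr)
  have h2 : ‖(inner ℂ (c - v) f : ℂ)‖ ≤ δ * R :=
    (norm_inner_le_norm (c - v) f).trans (by gcongr)
  rw [h0]
  refine (norm_add_le _ _).trans ?_
  linarith

theorem abs_gram_sub_gram_le (hc : ‖c‖ ≤ R) (hv : ‖v‖ ≤ R) (he : ‖e‖ ≤ R) (hf : ‖f‖ ≤ R)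
    (h : ‖c - v‖ ≤ δ) (h' : ‖e - f‖ ≤ δ) : |gram c e - gram v f| ≤ 12 * R ^ 3 * δ := by
  have hR : 0 ≤ R := (norm_nonneg _).trans hc
  have hi : ∀ c e : Coeff, ‖c‖ ≤ R → ‖e‖ ≤ R → ‖(inner ℂ c e : ℂ)‖ ≤ R ^ 2 := fun c e hc he =>
    (norm_inner_le_norm (𝕜 := ℂ) c e).trans
      ((mul_le_mul hc he (norm_nonneg _) hR).trans (by rw [sq]))
  have h1 := abs_mul_sub_mul_le (abs_norm_sq_sub_le he hf h') (abs_norm_sq_sub_le hc hv h)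
    (B := R ^ 2) (A := R ^ 2)
    (by rw [abs_of_nonneg (by positivity)]; gcongr) (by rw [abs_of_nonneg (by positivity)]; gcongr)
  have h2 := abs_norm_pow_four_sub_le hc hv h
  have h3 := abs_norm_sq_sub_le (hi c e hc he) (hi v f hv hf) (norm_inner_sub_inner_le hc hf h h')
  have e : gram c e - gram v f = (‖e‖ ^ 2 * ‖c‖ ^ 2 - ‖f‖ ^ 2 * ‖v‖ ^ 2) -
    (‖c‖ ^ 4 - ‖v‖ ^ 4) - (‖(inner ℂ c e : ℂ)‖ ^ 2 - ‖(inner ℂ v f : ℂ)‖ ^ 2) := by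
    rw [gram, gram]; ring
  rw [e]
  refine (abs_sub _ _).trans ((add_le_add_left (abs_sub _ _) _).trans ?_)
  linarith

theorem abs_lyap_sub_lyap_le (hc : ‖c‖ ≤ R) (hv : ‖v‖ ≤ R) (he : ‖e‖ ≤ R) (hf : ‖f‖ ≤ R)
    (h : ‖c - v‖ ≤ δ) (h' : ‖e - f‖ ≤ δ) : |lyap c e - lyap v f| ≤ 28 * R ^ 3 * δ := by
  have h1 := abs_le.1 (abs_gram_sub_gram_le hc hv he hf h h')
  have h2 := abs_le.1 (abs_norm_pow_four_sub_le hc hv h)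
  have h3 := abs_le.1 (abs_norm_prodMap_sq_sub_le hc hv h)
  rw [lyap, lyap, abs_le]
  constructor <;> linarith [h1.1, h1.2, h2.1, h2.2, h3.1, h3.2]

end Perturbation

/-! ### Modulation parameters along a solution. -/

theorem gram_lin (a b : ℂ) : gram (lin a b) (linRaise a b) = ‖b‖ ^ 4 := by
  have h : Raise (0 : Coeff) 0 := fun z => by simp [fock]
  have := gram_eq (a := a) (b := b) h (fun n _ => by simp)
  simpa using this

theorem lyap_lin (a b : ℂ) : lyap (lin a b) (linRaise a b) = 0 := by
  rw [lyap, gram_lin, norm_prodMap_lin_sq,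
    show ‖lin a b‖ ^ 4 = (‖lin a b‖ ^ 2) ^ 2 by ring, norm_lin_sq]
  ring

theorem abs_sub_le_div_of_abs_sq_sub_le {x y D : ℝ} (hx : 0 ≤ x) (hy : 0 < y)
    (h : |x ^ 2 - y ^ 2| ≤ D) : |x - y| ≤ D / y := by
  rw [le_div_iff₀ hy]
  calc |x - y| * y ≤ |x - y| * |x + y| := by
        gcongr
        exact le_trans (by linarith) (le_abs_self _)
    _ = |x ^ 2 - y ^ 2| := by rw [← abs_mul]; ring_nf
    _ ≤ D := h

set_option maxHeartbeats 1000000 in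
/-- Persistence of the decomposition along solutions, with the modulation parameters controlled
by the conserved quantities. -/
theorem Sol.exists_decomposition {a₀ b₀ : ℂ} (hb₀ : b₀ ≠ 0) :
    ∃ δ₀ > (0 : ℝ), ∃ C > (0 : ℝ), ∀ c : ℝ → Coeff, Sol c → ∀ e₀, Raise (c 0) e₀ →
      ∀ δ : ℝ, 0 ≤ δ → δ ≤ δ₀ → ‖c 0 - lin a₀ b₀‖ ≤ δ → ‖e₀ - linRaise a₀ b₀‖ ≤ δ → ∀ t,
      ∃ (β a b : ℂ) (w k : Coeff), LLL.trans β (c t) = lin a b + w ∧ Raise w k ∧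
        (∀ n < 3, w n = 0) ∧ ‖k‖ ^ 2 ≤ C * δ ∧ |‖a‖ ^ 2 - ‖a₀‖ ^ 2| ≤ C * δ ∧
        |‖b‖ ^ 2 - ‖b₀‖ ^ 2| ≤ C * δ ∧
        ‖-β - (a * conj b - a₀ * conj b₀) / (‖a₀‖ ^ 2 + ‖b₀‖ ^ 2 : ℝ)‖ ≤ C * δ := by
  have hb : 0 < ‖b₀‖ := norm_pos_iff.2 hb₀
  set v := lin a₀ b₀ with hv
  set f := linRaise a₀ b₀ with hf
  set R := ‖v‖ + ‖f‖ + 1 with hR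
  set m := ‖a₀‖ ^ 2 + ‖b₀‖ ^ 2 with hm
  have hR0 : 0 < R := by positivity
  have hm0 : 0 < m := by positivity
  have hvm : ‖v‖ ^ 2 = m := norm_lin_sq _ _
  obtain ⟨ε, hε, C₁, hC₁, H⟩ := exists_frame hR0 (r := ‖b₀‖ ^ 4 / 2) (by positivity)
  -- In units of `δ`, `Λ` bounds `‖k‖²`, `Γ` the variation of `‖b‖⁴`, `B` and `A` those of `‖b‖²`
  -- and `‖a‖²`, and `D` the error on the translation parameter.
  set Λ := 28 * R ^ 3 * C₁ with hΛ
  set Γ := 3 * R ^ 2 * Λ + 12 * R ^ 3 with hΓ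
  set B := Γ / ‖b₀‖ ^ 2 with hB
  set A := B + Λ + 2 * R with hA
  set D := (Λ + 2 * R) * (2 / m) + 2 * R ^ 2 * (4 * R / m ^ 2) with hD
  have hΛ0 : 0 < Λ := by positivity
  have hΓ0 : 0 < Γ := by positivity
  have hB0 : 0 < B := by positivity
  refine ⟨min 1 (min (‖b₀‖ ^ 4 / (32 * R ^ 3)) (min (m / (4 * R)) (ε / (2 * (6 * R + Λ))))),
    by positivity, Λ + A + B + D, by positivity, ?_⟩
  intro c hc e₀ he₀ δ hδ0 hδ h0 h0' t
  have hδ1 : δ ≤ 1 := hδ.trans (min_le_left _ _)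
  have hδ2 : 32 * R ^ 3 * δ ≤ ‖b₀‖ ^ 4 := by
    have := hδ.trans ((min_le_right _ _).trans (min_le_left _ _))
    rwa [le_div_iff₀ (by positivity), mul_comm] at this
  have hδ3 : 4 * R * δ ≤ m := by
    have := hδ.trans ((min_le_right _ _).trans ((min_le_right _ _).trans (min_le_left _ _)))
    rwa [le_div_iff₀ (by positivity), mul_comm] at this
  have hδ4 : 2 * (6 * R + Λ) * δ ≤ ε := by
    have := hδ.trans ((min_le_right _ _).trans ((min_le_right _ _).trans (min_le_right _ _)))
    rwa [le_div_iff₀ (by positivity), mul_comm] at this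
  have hvR : ‖v‖ ≤ R := by linarith [norm_nonneg f]
  have hfR : ‖f‖ ≤ R := by linarith [norm_nonneg v]
  have hcR : ‖c 0‖ ≤ R := by
    have := norm_sub_norm_le (c 0) v
    linarith [norm_nonneg f]
  have heR : ‖e₀‖ ≤ R := by
    have := norm_sub_norm_le e₀ f
    linarith [norm_nonneg v]
  have hM := abs_le.1 (abs_norm_sq_sub_le hcR hvR h0)
  have hM4 := abs_le.1 (abs_norm_pow_four_sub_le hcR hvR h0)
  have hh := abs_le.1 (abs_norm_prodMap_sq_sub_le hcR hvR h0)
  have hQ := norm_inner_sub_inner_le hcR hfR h0 h0'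
  have hK := abs_gram_sub_gram_le hcR hvR heR hfR h0 h0'
  have hG := abs_lyap_sub_lyap_le hcR hvR heR hfR h0 h0'
  rw [hv, hf, gram_lin] at hK
  rw [hv, hf, lyap_lin, sub_zero] at hG
  -- At `lin a₀ b₀` the right side would be `‖b₀‖⁴`; half of it survives the perturbation.
  have hr : ‖b₀‖ ^ 4 / 2 ≤ 2 * (‖c 0‖ ^ 4 - ‖prodMap (c 0) (c 0)‖ ^ 2) := by
    have h1 := norm_prodMap_lin_sq a₀ b₀
    have h2 : ‖v‖ ^ 4 = m ^ 2 := by rw [← hvm]; ring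
    rw [← hv, ← hm] at h1
    linarith [hM4.1, hh.2]
  have conserved : ∀ t e, Raise (c t) e → gram (c t) e = gram (c 0) e₀ ∧
      lyap (c t) e = lyap (c 0) e₀ := by
    intro t e he
    obtain ⟨e', he', hn⟩ := hc.exists_raise he₀ t
    obtain rfl := he.unique he'
    have : gram (c t) e = gram (c 0) e₀ := by
      rw [gram, gram, hn, hc.norm_eq t, hc.inner_raise_eq he₀ he]
    refine ⟨this, ?_⟩
    rw [lyap, lyap, this, hc.norm_eq t, hc.norm_prodMap_eq t]
  have frame : ∀ t, ‖c t‖ ^ 2 - peak 2 (c t) ≤ ε → ∃ (β a b : ℂ) (w k : Coeff),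
      LLL.trans β (c t) = lin a b + w ∧ Raise w k ∧ (∀ n < 3, w n = 0) ∧
        ‖w‖ ^ 2 = ‖c t‖ ^ 2 - peak 2 (c t) ∧ ‖k‖ ^ 2 ≤ Λ * δ := by
    intro t ht
    obtain ⟨e, he, -⟩ := hc.exists_raise he₀ t
    obtain ⟨β, a, b, w, k, h1, h2, h3, h4, h5⟩ := H (c t) e he (by rwa [hc.norm_eq t])
      (by rwa [hc.norm_eq t, hc.norm_prodMap_eq t]) ht
    refine ⟨β, a, b, w, k, h1, h2, h3, h4, h5.trans ?_⟩
    rw [(conserved t e he).2]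
    calc C₁ * lyap (c 0) e₀ ≤ C₁ * (28 * R ^ 3 * δ) := by
          gcongr; exact (le_abs_self _).trans hG
      _ = Λ * δ := by rw [hΛ]; ring
  -- The deficit equals `‖w‖² ≤ ‖k‖² ≤ Λ δ` wherever it is below `ε`, which closes the continuity
  -- argument; `6 R δ` covers the initial time.
  have hX : ∀ t, ‖c t‖ ^ 2 - peak 2 (c t) ≤ (6 * R + Λ) * δ := by
    refine bootstrap (ε := ε) ?_ ?_ ?_ fun t ht => ?_
    · exact (hc.continuous.norm.pow 2).sub ((continuous_peak 2).comp hc.continuous)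
    · have h1 := peak_deficit_sub_le (J := 2) (c := c 0) (d := v) (β := 0) (by
        rw [trans_zero, low_two, hv, lin_zero_apply, lin_one_apply, norm_lin_sq])
      have h2 : ‖c 0 - v‖ * (‖c 0‖ + ‖v‖) ≤ δ * (R + R) := by gcongr
      push_cast at h1
      linarith [mul_nonneg hΛ0.le hδ0]
    · have : 0 ≤ (6 * R + Λ) * δ := by positivity
      linarith
    · obtain ⟨β, a, b, w, k, -, h2, h3, h4, h5⟩ := frame t ht
      rw [← h4]
      have := h2.norm_sq_mul_le h3
      push_cast at this
      linarith [sq_nonneg ‖w‖, mul_nonneg hR0.le hδ0]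
  obtain ⟨β, a, b, w, k, h1, h2, h3, h4, h5⟩ := frame t ((hX t).trans (by
    have : 0 ≤ (6 * R + Λ) * δ := by positivity
    linarith))
  obtain ⟨e, he, -⟩ := hc.exists_raise he₀ t
  have hde := he.trans β
  rw [h1] at hde
  have hke := hde.unique ((raise_lin a b).add h2)
  have hn : ‖lin a b + w‖ = ‖c 0‖ := by rw [← h1, LinearIsometry.norm_map, hc.norm_eq t]
  have hgram : gram (lin a b + w) (linRaise a b + k) = gram (c 0) e₀ := by
    rw [← hke, ← h1, gram_trans, (conserved t e he).1]
  have hw2 : ‖w‖ ^ 2 ≤ Λ * δ := by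
    have := h2.norm_sq_mul_le h3
    push_cast at this
    linarith [sq_nonneg ‖w‖]
  have hb4 : |(‖b‖ ^ 2) ^ 2 - (‖b₀‖ ^ 2) ^ 2| ≤ Γ * δ := by
    have h6 := abs_gram_sub_le (a := a) (b := b) h2 h3
    rw [hgram, hn] at h6
    have h7 : 3 * ‖c 0‖ ^ 2 * ‖k‖ ^ 2 ≤ 3 * R ^ 2 * (Λ * δ) := by gcongr
    have h8 := abs_le.1 (h6.trans h7)
    have h9 := abs_le.1 hK
    rw [abs_le, hΓ]
    constructor <;> linarith [h8.1, h8.2, h9.1, h9.2]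
  have hbB : |‖b‖ ^ 2 - ‖b₀‖ ^ 2| ≤ B * δ := by
    refine (abs_sub_le_div_of_abs_sq_sub_le (by positivity) (by positivity) hb4).trans
      (le_of_eq ?_)
    rw [hB]; ring
  have hM' : ‖a‖ ^ 2 + ‖b‖ ^ 2 + ‖w‖ ^ 2 = ‖c 0‖ ^ 2 := by rw [← norm_lin_add_sq h3, hn]
  have haA : |‖a‖ ^ 2 - ‖a₀‖ ^ 2| ≤ A * δ := by
    have h6 := abs_le.1 hbB
    rw [hvm] at hM
    rw [abs_le, hA]
    constructor <;> linarith [h6.1, h6.2, hM.1, hM.2, sq_nonneg ‖w‖]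
  have hmono : ∀ {x y : ℝ}, x ≤ y → x * δ ≤ y * δ := fun h => mul_le_mul_of_nonneg_right h hδ0
  have hA0 : 0 < A := by positivity
  have hD0 : 0 < D := by positivity
  refine ⟨β, a, b, w, k, h1, h2, h3, h5.trans (hmono (by linarith)),
    haA.trans (hmono (by linarith)), hbB.trans (hmono (by linarith)),
    le_trans ?_ (hmono (show D ≤ Λ + A + B + D by linarith))⟩
  -- the translation parameter
  set M := ‖c 0‖ ^ 2 with hMdef
  have hMm : |M - m| ≤ 2 * R * δ := by rw [← hvm]; exact abs_le.2 hM
  have hM2 : m / 2 ≤ M := by linarith [(abs_le.1 hMm).1]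
  have hMpos : 0 < M := by linarith
  -- Translation by `β` shifts the conserved magnetic momentum by `-β M`. Comparison with its
  -- expression in the frame determines `β`.
  have hQd : (inner ℂ (c 0) e₀ : ℂ) - β * (M : ℝ) = conj b * a + inner ℂ w k := by
    rw [← inner_lin_add (a := a) (b := b) h2 h3, ← hke, ← h1, inner_sub_right, inner_smul_right,
      LinearIsometry.inner_map_map, inner_self_eq_norm_sq_to_K, LinearIsometry.norm_map,
      hc.inner_raise_eq he₀ he, hc.norm_eq t, hMdef]
    push_cast
    rfl
  have hQv : (inner ℂ v f : ℂ) = a₀ * conj b₀ := by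
    rw [hv, hf, inner_lin]
    simp [-lp.coeFn_add, -lp.coeFn_smul, Coeff.add_apply, Coeff.smul_apply, linRaise,
      hermite_apply, mul_comm]
  rw [hQv] at hQ
  have hMne : (M : ℂ) ≠ 0 := by exact_mod_cast hMpos.ne'
  have hmne : (m : ℂ) ≠ 0 := by exact_mod_cast hm0.ne'
  have hid : -β - (a * conj b - a₀ * conj b₀) / (m : ℝ) =
      (inner ℂ w k - (inner ℂ (c 0) e₀ - a₀ * conj b₀)) * (1 / M : ℝ) -
        (a * conj b - a₀ * conj b₀) * ((M - m) / (M * m) : ℝ) := by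
    have : β = ((inner ℂ (c 0) e₀ : ℂ) - conj b * a - inner ℂ w k) / M := by
      rw [eq_div_iff hMne]; linear_combination -hQd
    rw [this]
    push_cast
    field_simp
    ring
  rw [hid]
  refine (norm_sub_le _ _).trans ?_
  have hwk : ‖(inner ℂ w k : ℂ)‖ ≤ Λ * δ := by
    refine (norm_inner_le_norm (𝕜 := ℂ) w k).trans ?_
    linarith [two_mul_le_add_sq ‖w‖ ‖k‖]
  have hX1 : ‖(inner ℂ w k : ℂ) - (inner ℂ (c 0) e₀ - a₀ * conj b₀)‖ ≤ (Λ + 2 * R) * δ := by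
    refine (norm_sub_le _ _).trans ?_
    linarith
  have hinv : 1 / M ≤ 2 / m := by
    rw [div_le_div_iff₀ hMpos hm0]; linarith
  have hX2 : ‖a * conj b - a₀ * conj b₀‖ ≤ 2 * R ^ 2 := by
    refine (norm_sub_le _ _).trans ?_
    rw [norm_mul, norm_mul, RCLike.norm_conj, RCLike.norm_conj]
    have e1 : ‖c 0‖ ^ 2 ≤ R ^ 2 := by gcongr
    have e2 : ‖v‖ ^ 2 ≤ R ^ 2 := by gcongr
    have e3 := two_mul_le_add_sq ‖a‖ ‖b‖
    have e4 := two_mul_le_add_sq ‖a₀‖ ‖b₀‖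
    linarith [sq_nonneg ‖w‖, sq_nonneg R]
  have hX3 : ‖(((M - m) / (M * m) : ℝ) : ℂ)‖ ≤ 4 * R / m ^ 2 * δ := by
    rw [Complex.norm_real, Real.norm_eq_abs, abs_div, abs_of_pos (mul_pos hMpos hm0)]
    calc |M - m| / (M * m) ≤ (2 * R * δ) / (m / 2 * m) := by gcongr
      _ = 4 * R / m ^ 2 * δ := by field_simp; ring
  rw [norm_mul, norm_mul]
  have hX4 : ‖((1 / M : ℝ) : ℂ)‖ ≤ 2 / m := by
    rw [Complex.norm_real, Real.norm_of_nonneg (by positivity)]; exact hinv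
  calc _ ≤ ((Λ + 2 * R) * δ) * (2 / m) + (2 * R ^ 2) * (4 * R / m ^ 2 * δ) := by gcongr
    _ = D * δ := by rw [hD]; ring


/-! ### Coordinates of translated Hermite functions and small translations. -/

/-- Cauchy product of the series of `exp (-conj β * z)` with the binomial expansion of `(z + β) ^
n`. -/
theorem trans_hermite_coeff (β : ℂ) (n m : ℕ) : trans β (hermite n) m =
    (√(Real.pi * m.factorial) / √(Real.pi * n.factorial) * Real.exp (-‖β‖ ^ 2 / 2) : ℝ) *
      ∑ p ∈ Finset.HasAntidiagonal.antidiagonal m,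
        ((-conj β) ^ p.1 / p.1.factorial) * (n.choose p.2 * β ^ (n - p.2)) := by
  have hP : √(Real.pi * n.factorial) ≠ 0 := (Real.sqrt_pos.2 (by positivity)).ne'
  have hQ : √(Real.pi * m.factorial) ≠ 0 := (Real.sqrt_pos.2 (by positivity)).ne'
  set K : ℂ := ((1 / √(Real.pi * n.factorial) * Real.exp (-‖β‖ ^ 2 / 2) : ℝ) : ℂ) with hK
  set a : ℕ → ℂ := fun s => K * ∑ p ∈ Finset.HasAntidiagonal.antidiagonal s,
        ((-conj β) ^ p.1 / p.1.factorial) * (n.choose p.2 * β ^ (n - p.2)) with ha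
  have hsum : ∀ z, HasSum (fun s => a s * z ^ s) (entire (trans β (hermite n)) z) := by
    intro z
    have h1 : HasSum (fun j : ℕ => (-conj β * z) ^ j / (j.factorial : ℂ))
        (Complex.exp (-conj β * z)) := by
      rw [Complex.exp_eq_exp_ℂ]
      exact NormedSpace.expSeries_div_hasSum_exp _
    have h1' : Summable fun j : ℕ => ‖(-conj β * z) ^ j / (j.factorial : ℂ)‖ :=
      NormedSpace.norm_expSeries_div_summable _
    have h2 : HasSum (fun j : ℕ => z ^ j * β ^ (n - j) * (n.choose j : ℂ)) ((z + β) ^ n) := by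
      rw [add_pow]
      refine hasSum_sum_of_ne_finset_zero fun j hj => ?_
      rw [Finset.mem_range, not_lt] at hj
      rw [Nat.choose_eq_zero_of_lt (by omega)]; simp
    have h2' : Summable fun j : ℕ => ‖z ^ j * β ^ (n - j) * (n.choose j : ℂ)‖ := by
      refine summable_of_ne_finset_zero (s := Finset.range (n + 1)) fun j hj => ?_
      rw [Finset.mem_range, not_lt] at hj
      rw [Nat.choose_eq_zero_of_lt (by omega)]; simp
    have h3 := summable_norm_sum_mul_antidiagonal_of_summable_norm h1' h2'
    have h4 := tsum_mul_tsum_eq_tsum_sum_antidiagonal_of_summable_norm h1' h2'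
    rw [h1.tsum_eq, h2.tsum_eq] at h4
    have h5 := (h3.of_norm.hasSum).mul_left K
    rw [← h4] at h5
    convert! h5 using 1
    · funext s
      rw [ha]
      simp only
      rw [mul_assoc, Finset.sum_mul]
      congr 1
      refine Finset.sum_congr rfl fun p hp => ?_
      rw [← Finset.HasAntidiagonal.mem_antidiagonal.1 hp, mul_pow, pow_add]
      ring
    · rw [entire_trans, entire_hermite, sub_eq_add_neg, Complex.exp_add, hK]
      push_cast
      rw [neg_mul]
      ring
  have h := powerSeries_unique hsum (hasSum_entire (trans β (hermite n))) m
  rw [taylorCoeff, eq_div_iff (by exact_mod_cast hQ)] at h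
  rw [← h, ha, hK]
  push_cast
  ring

/-- The sum is the Laguerre polynomial `L_n` at `‖β‖²`. The diagonal coefficient is thus real and
depends on `‖β‖` only. -/
theorem trans_hermite_coeff_self (β : ℂ) (n : ℕ) : trans β (hermite n) n =
    ((Real.exp (-‖β‖ ^ 2 / 2) *
      ∑ j ∈ Finset.range (n + 1), n.choose j * (-‖β‖ ^ 2) ^ j / j.factorial : ℝ) : ℂ) := by
  have hP : √(Real.pi * n.factorial) ≠ 0 := (Real.sqrt_pos.2 (by positivity)).ne'
  rw [trans_hermite_coeff, div_self hP, one_mul, Complex.ofReal_mul]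
  congr 1
  rw [Finset.Nat.sum_antidiagonal_eq_sum_range_succ
    (fun i j => ((-conj β) ^ i / (i.factorial : ℂ)) * (n.choose j * β ^ (n - j))), Complex.ofReal_sum]
  refine Finset.sum_congr rfl fun j hj => ?_
  have hj : j ≤ n := by have := Finset.mem_range.1 hj; omega
  have hb : -((‖β‖ : ℂ) ^ 2) = -conj β * β := by rw [neg_mul, Complex.conj_mul']
  push_cast
  rw [hb, Nat.choose_symm hj, Nat.sub_sub_self hj, mul_pow]
  ring

/-- With `x = ‖β‖²` the left side is `2 - 2 exp (-x / 2) L_n(x)`. The exponential costs at most `x`,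
and the nonconstant terms of `L_n` sum to at least `-2 ^ n x`. -/
theorem norm_trans_hermite_sub_sq_le {β : ℂ} (hβ : ‖β‖ ≤ 1) (n : ℕ) :
    ‖trans β (hermite n) - hermite n‖ ^ 2 ≤ (1 + 2 * 2 ^ n) * ‖β‖ ^ 2 := by
  have h1 : ‖trans β (hermite n) - hermite n‖ ^ 2 = 2 - 2 * (trans β (hermite n) n).re := by
    rw [norm_sub_sq (𝕜 := ℂ), LinearIsometry.norm_map, norm_hermite, ← inner_conj_symm,
      inner_hermite]
    simp
    ring
  rw [h1, trans_hermite_coeff_self, Complex.ofReal_re]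
  set x := ‖β‖ ^ 2 with hx
  have hx0 : 0 ≤ x := by positivity
  have hx1 : x ≤ 1 := by rw [hx]; nlinarith [norm_nonneg β]
  rw [Finset.sum_range_succ']
  set S := ∑ j ∈ Finset.range n, n.choose (j + 1) * (-x) ^ (j + 1) / ((j + 1).factorial : ℝ)
  have hS : -(2 ^ n * x) ≤ S := by
    have h2 : ∀ j ∈ Finset.range n, -(n.choose (j + 1) * x) ≤
        n.choose (j + 1) * (-x) ^ (j + 1) / ((j + 1).factorial : ℝ) := by
      intro j _
      rw [mul_div_assoc, ← mul_neg]
      gcongr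
      refine (abs_le.1 ?_).1
      rw [abs_div, abs_pow, abs_neg, abs_of_nonneg hx0, Nat.abs_cast]
      refine (div_le_self (by positivity)
        (by exact_mod_cast Nat.succ_le_of_lt (Nat.factorial_pos (j + 1)))).trans ?_
      rw [pow_succ]
      exact mul_le_of_le_one_left hx0 (pow_le_one₀ hx0 hx1)
    refine le_trans ?_ (Finset.sum_le_sum h2)
    rw [Finset.sum_neg_distrib, ← Finset.sum_mul, neg_le_neg_iff]
    gcongr
    have h3 := Nat.sum_range_choose n
    rw [Finset.sum_range_succ'] at h3
    have : ∑ j ∈ Finset.range n, n.choose (j + 1) ≤ 2 ^ n := by omega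
    exact_mod_cast this
  have he1 : 1 - x / 2 ≤ Real.exp (-x / 2) := by
    have := Real.add_one_le_exp (-x / 2); linarith
  have he2 : Real.exp (-x / 2) ≤ 1 := Real.exp_le_one_iff.2 (by linarith)
  have he0 := Real.exp_pos (-x / 2)
  simp only [Nat.choose_zero_right, pow_zero, Nat.factorial_zero, Nat.cast_one, mul_one, div_one]
  have h4 : Real.exp (-x / 2) * (-(2 ^ n * x)) ≤ Real.exp (-x / 2) * S := by gcongr
  have h5 : Real.exp (-x / 2) * (2 ^ n * x) ≤ 1 * (2 ^ n * x) := by gcongr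
  linarith

theorem norm_trans_hermite_sub_le {β : ℂ} (hβ : ‖β‖ ≤ 1) {n : ℕ} (hn : n ≤ 2) :
    ‖trans β (hermite n) - hermite n‖ ≤ 3 * ‖β‖ := by
  refine (abs_le_of_sq_le_sq' ((norm_trans_hermite_sub_sq_le hβ n).trans ?_) (by positivity)).2
  rw [mul_pow]
  gcongr
  interval_cases n <;> norm_num

theorem norm_trans_lin_sub_le {β : ℂ} (hβ : ‖β‖ ≤ 1) (a b : ℂ) :
    ‖trans β (lin a b) - lin a b‖ ≤ 3 * (‖a‖ + ‖b‖) * ‖β‖ := by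
  have e : trans β (lin a b) - lin a b = a • (trans β (hermite 0) - hermite 0) +
      b • (trans β (hermite 1) - hermite 1) := by
    rw [lin, map_add, map_smul, map_smul]; module
  rw [e]
  refine (norm_add_le _ _).trans ?_
  rw [norm_smul, norm_smul]
  have h0 := mul_le_mul_of_nonneg_left (norm_trans_hermite_sub_le hβ (n := 0) (by norm_num))
    (norm_nonneg a)
  have h1 := mul_le_mul_of_nonneg_left (norm_trans_hermite_sub_le hβ (n := 1) (by norm_num))
    (norm_nonneg b)
  linarith

theorem norm_trans_linRaise_sub_le {β : ℂ} (hβ : ‖β‖ ≤ 1) (a b : ℂ) :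
    ‖trans β (linRaise a b) - linRaise a b‖ ≤ 6 * (‖a‖ + ‖b‖) * ‖β‖ := by
  have e : trans β (linRaise a b) - linRaise a b = a • (trans β (hermite 1) - hermite 1) +
      (((√2 : ℝ) : ℂ) * b) • (trans β (hermite 2) - hermite 2) := by
    rw [linRaise, map_add, map_smul, map_smul]; module
  rw [e]
  refine (norm_add_le _ _).trans ?_
  rw [norm_smul, norm_smul, norm_mul, Complex.norm_real, Real.norm_of_nonneg (Real.sqrt_nonneg _)]
  have h0 := mul_le_mul_of_nonneg_left (norm_trans_hermite_sub_le hβ (n := 1) (by norm_num))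
    (norm_nonneg a)
  have h1 := mul_le_mul_of_nonneg_left (norm_trans_hermite_sub_le hβ (n := 2) (by norm_num))
    (by positivity : 0 ≤ √2 * ‖b‖)
  have h2 : √2 ≤ 2 := by rw [Real.sqrt_le_iff]; norm_num
  have h3 : √2 * (‖b‖ * ‖β‖) ≤ 2 * (‖b‖ * ‖β‖) := by gcongr
  have h4 : 0 ≤ ‖a‖ * ‖β‖ := by positivity
  linarith

theorem Raise.normL21_le {c e : Coeff} (h : Raise c e) {x y : ℝ} (hx : ‖c‖ ≤ x) (hy : ‖e‖ ≤ y) :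
    LLL.normL21 (fock c) ≤ ENNReal.ofReal (x + y) := by
  rw [h.normL21]
  have := norm_nonneg c
  have := norm_nonneg e
  refine ENNReal.ofReal_le_ofReal (Real.sqrt_le_iff.2 ⟨by linarith, ?_⟩)
  have h1 : ‖c‖ ^ 2 ≤ x ^ 2 := by gcongr
  have h2 : ‖e‖ ^ 2 ≤ y ^ 2 := by gcongr
  have h3 : 0 ≤ x * y := mul_nonneg (by linarith) (by linarith)
  linarith [add_sq x y]

theorem Raise.normL21_trans_le {c e : Coeff} (h : Raise c e) (β : ℂ) {x y : ℝ} (hx : ‖c‖ ≤ x)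
    (hy : ‖e‖ ≤ y) : LLL.normL21 (fock (LLL.trans β c)) ≤ ENNReal.ofReal ((1 + ‖β‖) * x + y) := by
  have h1 : ‖LLL.trans β e - β • LLL.trans β c‖ ≤ y + ‖β‖ * x := by
    refine (norm_sub_le _ _).trans ?_
    rw [norm_smul, LinearIsometry.norm_map, LinearIsometry.norm_map]
    gcongr
  have := (h.trans β).normL21_le (le_of_eq_of_le (LinearIsometry.norm_map _ _) hx) h1
  refine this.trans (le_of_eq ?_)
  congr 1
  ring

theorem fock_sub_fun (c d : Coeff) : fock c - fock d = fock (c - d) :=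
  funext fun z => (fock_sub c d z).symm


/-! ### Stability of the degree one profiles. -/

/-- From `|x - y|² ≤ |x - y| (x + y)`. Taking a square root avoids division by `y`, which may
vanish, as `‖a₀‖` does for `φ_1`. -/
theorem abs_sub_le_of_abs_sq_sub_le {x y C δ : ℝ} (hx : 0 ≤ x) (hy : 0 ≤ y) (hC : 0 ≤ C)
    (h : |x ^ 2 - y ^ 2| ≤ C * δ) : |x - y| ≤ √C * √δ := by
  rw [← Real.sqrt_mul hC]
  refine Real.abs_le_sqrt (le_trans ?_ h)
  rw [← sq_abs, sq, show x ^ 2 - y ^ 2 = (x - y) * (x + y) by ring, abs_mul]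
  refine mul_le_mul_of_nonneg_left ?_ (abs_nonneg _)
  rw [abs_le, abs_of_nonneg (by linarith : 0 ≤ x + y)]
  constructor <;> linarith

theorem exists_norm_eq_near (a : ℂ) {r : ℝ} (hr : 0 ≤ r) :
    ∃ a' : ℂ, ‖a'‖ = r ∧ ‖a - a'‖ = |‖a‖ - r| := by
  obtain ⟨θ, hθ⟩ := exists_phase a
  refine ⟨r * Complex.exp (Complex.I * θ), ?_, ?_⟩
  · rw [norm_mul, norm_exp_I_mul, Complex.norm_real, Real.norm_of_nonneg hr, mul_one]
  · have : a - r * Complex.exp (Complex.I * θ) =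
        ((‖a‖ - r : ℝ) : ℂ) * Complex.exp (Complex.I * θ) := by
      push_cast
      rw [sub_mul, ← hθ]
    rw [this, norm_mul, norm_exp_I_mul, Complex.norm_real, Real.norm_eq_abs, mul_one]

theorem norm_exp_twist (α β : ℂ) : ‖Complex.exp ((conj α * β - α * conj β) / 2)‖ = 1 := by
  rw [Complex.norm_exp]
  simp

theorem norm_mul_conj_sub_le (a b a' b' : ℂ) :
    ‖a * conj b - a' * conj b'‖ ≤ ‖a - a'‖ * ‖b'‖ + ‖a‖ * ‖b - b'‖ := by
  have : a * conj b - a' * conj b' = (a - a') * conj b' + a * conj (b - b') := by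
    rw [map_sub]; ring
  rw [this]
  refine (norm_add_le _ _).trans ?_
  rw [norm_mul, norm_mul, RCLike.norm_conj, RCLike.norm_conj]

set_option maxHeartbeats 1000000 in
/-- Orbital stability of the functions `lin a₀ b₀`, with explicit modulation parameters. -/
theorem Sol.stability_lin {a₀ b₀ : ℂ} (hb₀ : b₀ ≠ 0) :
    ∃ δ₀ > (0 : ℝ), ∃ C > (0 : ℝ), ∀ c : ℝ → Coeff, Sol c → ∀ e₀, Raise (c 0) e₀ →
      ∀ δ : ℝ, 0 ≤ δ → δ ≤ δ₀ → ‖c 0 - lin a₀ b₀‖ ≤ δ → ‖e₀ - linRaise a₀ b₀‖ ≤ δ → ∀ t,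
      ∃ a b : ℂ, ‖a‖ = ‖a₀‖ ∧ ‖b‖ = ‖b₀‖ ∧
        normL21 (fock (c t) - fock (LLL.trans
          ((a * conj b - a₀ * conj b₀) / (‖a₀‖ ^ 2 + ‖b₀‖ ^ 2 : ℝ)) (lin a b))) ≤
          ENNReal.ofReal (C * √δ) := by
  obtain ⟨δ₁, hδ₁, C₁, hC₁, H⟩ := Sol.exists_decomposition (a₀ := a₀) hb₀
  have hb : 0 < ‖b₀‖ := norm_pos_iff.2 hb₀
  set m := ‖a₀‖ ^ 2 + ‖b₀‖ ^ 2 with hm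
  have hm0 : 0 < m := by positivity
  set L := ‖a₀‖ + ‖b₀‖ with hL
  have hL0 : 0 < L := by positivity
  set K := √C₁ with hK
  have hK0 : 0 < K := Real.sqrt_pos.2 hC₁
  set E := C₁ + K * (L + K) / m with hE
  have hE0 : 0 < E := by positivity
  refine ⟨min δ₁ (min 1 (1 / E ^ 2)), by positivity, 13 * K + 16 * (L * E), by positivity, ?_⟩
  intro c hc e₀ he₀ δ hδ0 hδ h0 h0' t
  obtain ⟨β, a, b, w, k, h1, h2, h3, h4, h5, h6, h7⟩ :=
    H c hc e₀ he₀ δ hδ0 (hδ.trans (min_le_left _ _)) h0 h0' t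
  have hδ1 : δ ≤ 1 := hδ.trans ((min_le_right _ _).trans (min_le_left _ _))
  set s := √δ with hs
  have hs0 : 0 ≤ s := Real.sqrt_nonneg δ
  have hs2 : s ^ 2 = δ := Real.sq_sqrt hδ0
  have hs1 : s ≤ 1 := by exact Real.sqrt_le_one.2 hδ1
  have hEs : E * s ≤ 1 := by
    have h := hδ.trans ((min_le_right _ _).trans (min_le_right _ _))
    rw [← hs2, le_div_iff₀ (by positivity), ← mul_pow, mul_comm] at h
    exact (abs_le_of_sq_le_sq' (by rwa [one_pow]) zero_le_one).2
  have hδs : δ ≤ s := by rw [← hs2, sq]; exact mul_le_of_le_one_left hs0 hs1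
  -- The modulus of `a` is reset to that of `a₀` while the phase is kept; likewise for `b`.
  obtain ⟨a', ha', haa⟩ := exists_norm_eq_near a (norm_nonneg a₀)
  obtain ⟨b', hb', hbb⟩ := exists_norm_eq_near b (norm_nonneg b₀)
  have hda : ‖a - a'‖ ≤ K * s := by
    rw [haa]; exact abs_sub_le_of_abs_sq_sub_le (norm_nonneg _) (norm_nonneg _) hC₁.le h5
  have hdb : ‖b - b'‖ ≤ K * s := by
    rw [hbb]; exact abs_sub_le_of_abs_sq_sub_le (norm_nonneg _) (norm_nonneg _) hC₁.le h6
  have hk : ‖k‖ ≤ K * s := by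
    rw [hK, hs, ← Real.sqrt_mul hC₁.le]
    exact Real.le_sqrt_of_sq_le h4
  have hw : ‖w‖ ≤ K * s := by
    have h8 := h2.norm_sq_mul_le h3
    push_cast at h8
    have h9 : ‖w‖ ^ 2 ≤ ‖k‖ ^ 2 := by linarith [sq_nonneg ‖w‖]
    exact ((abs_le_of_sq_le_sq' h9 (norm_nonneg _)).2).trans hk
  set γ := (a' * conj b' - a₀ * conj b₀) / (m : ℝ) with hγ
  set η := β + γ with hη
  have hmne : (m : ℂ) ≠ 0 := by exact_mod_cast hm0.ne'
  have hηE : ‖η‖ ≤ E * s := by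
    have e : η = -(-β - (a * conj b - a₀ * conj b₀) / (m : ℝ)) -
        (a * conj b - a' * conj b') / (m : ℝ) := by
      rw [hη, hγ]; ring
    have h8 : ‖a * conj b - a' * conj b'‖ ≤ K * (L + K) * s := by
      refine (norm_mul_conj_sub_le a b a' b').trans ?_
      have h9 : ‖a‖ ≤ ‖a₀‖ + K := by
        have h10 := norm_sub_norm_le a a'
        have h11 : K * s ≤ K * 1 := by gcongr
        linarith
      calc ‖a - a'‖ * ‖b'‖ + ‖a‖ * ‖b - b'‖ ≤ K * s * ‖b₀‖ + (‖a₀‖ + K) * (K * s) := by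
            rw [hb']; gcongr
        _ = K * (L + K) * s := by rw [hL]; ring
    rw [e]
    refine (norm_sub_le _ _).trans ?_
    rw [norm_neg, norm_div, Complex.norm_real, Real.norm_of_nonneg hm0.le]
    calc _ ≤ C₁ * s + K * (L + K) * s / m := by
          gcongr
          exact h7.trans (by gcongr)
      _ = E * s := by rw [hE]; ring
  have hη1 : ‖η‖ ≤ 1 := hηE.trans hEs
  -- Since `2 ‖a₀‖ ‖b₀‖ ≤ ‖a₀‖² + ‖b₀‖²`. The frames therefore stay bounded, so the weighted norm is
  -- transported with a fixed constant.
  have hγ1 : ‖γ‖ ≤ 1 := by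
    rw [hγ, norm_div, Complex.norm_real, Real.norm_of_nonneg hm0.le, div_le_one hm0]
    refine (norm_sub_le _ _).trans ?_
    rw [norm_mul, norm_mul, RCLike.norm_conj, RCLike.norm_conj, ha', hb', hm]
    linarith [two_mul_le_add_sq ‖a₀‖ ‖b₀‖]
  have hβ : ‖-β‖ ≤ 2 := by
    have e : -β = γ - η := by rw [hη]; ring
    rw [e]
    linarith [norm_sub_le γ η]
  -- Composing translations produces this phase. It is absorbed into both coefficients, which leaves
  -- `a' * conj b'`, and hence `γ`, unchanged.
  set ω := Complex.exp ((conj β * γ - β * conj γ) / 2) with hω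
  have hω1 : ‖ω‖ = 1 := norm_exp_twist β γ
  have hω0 : ω ≠ 0 := Complex.exp_ne_zero _
  have htt : LLL.trans γ (lin a' b') = ω • LLL.trans (-β) (LLL.trans η (lin a' b')) := by
    rw [← map_smul, hη, hω, ← trans_trans β γ, trans_neg_trans]
  refine ⟨ω⁻¹ * a', ω⁻¹ * b', ?_, ?_, ?_⟩
  · rw [norm_mul, norm_inv, hω1, ha', inv_one, one_mul]
  · rw [norm_mul, norm_inv, hω1, hb', inv_one, one_mul]
  have hγ' : (ω⁻¹ * a' * conj (ω⁻¹ * b') - a₀ * conj b₀) / (m : ℝ) = γ := by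
    have h8 : ω⁻¹ * conj ω⁻¹ = 1 := by
      rw [Complex.mul_conj', norm_inv, hω1]; simp
    rw [hγ, map_mul]
    congr 2
    linear_combination (a' * conj b') * h8
  have hlin : lin (ω⁻¹ * a') (ω⁻¹ * b') = ω⁻¹ • lin a' b' := by
    rw [lin, lin, smul_add, smul_smul, smul_smul]
  have hct : c t = LLL.trans (-β) (lin a b + w) := by rw [← h1, trans_neg_trans]
  rw [hγ', hlin, map_smul, htt, smul_smul, inv_mul_cancel₀ hω0, one_smul, hct, fock_sub_fun,
    ← map_sub]
  have hraise := ((raise_lin a b).add h2).sub ((raise_lin a' b').trans η)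
  have hη3 : 3 * (‖a'‖ + ‖b'‖) * ‖η‖ ≤ 3 * (L * E) * s := by
    rw [ha', hb', ← hL]
    calc 3 * L * ‖η‖ ≤ 3 * L * (E * s) := by gcongr
      _ = 3 * (L * E) * s := by ring
  have hx : ‖lin a b + w - LLL.trans η (lin a' b')‖ ≤ (3 * K + 3 * (L * E)) * s := by
    have e : lin a b + w - LLL.trans η (lin a' b') = (a - a') • hermite 0 + (b - b') • hermite 1 +
        w - (LLL.trans η (lin a' b') - lin a' b') := by
      simp only [lin]; module
    rw [e]
    have h8 := norm_trans_lin_sub_le hη1 a' b'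
    have h9 := norm_sub_le ((a - a') • hermite 0 + (b - b') • hermite 1 + w)
      (LLL.trans η (lin a' b') - lin a' b')
    have h10 := norm_add₃_le (a := (a - a') • hermite 0) (b := (b - b') • hermite 1) (c := w)
    rw [norm_smul, norm_smul, norm_hermite, norm_hermite] at h10
    linarith
  have hy : ‖linRaise a b + k - (LLL.trans η (linRaise a' b') - η • LLL.trans η (lin a' b'))‖ ≤
      (4 * K + 7 * (L * E)) * s := by
    have e : linRaise a b + k - (LLL.trans η (linRaise a' b') - η • LLL.trans η (lin a' b')) =
        (a - a') • hermite 1 + (((√2 : ℝ) : ℂ) * (b - b')) • hermite 2 + k -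
        (LLL.trans η (linRaise a' b') - linRaise a' b') + η • LLL.trans η (lin a' b') := by
      simp only [linRaise]; module
    rw [e]
    have h8 := norm_trans_linRaise_sub_le hη1 a' b'
    have h9 := norm_sub_le
      ((a - a') • hermite 1 + (((√2 : ℝ) : ℂ) * (b - b')) • hermite 2 + k)
      (LLL.trans η (linRaise a' b') - linRaise a' b')
    have h10 := norm_add₃_le (a := (a - a') • hermite 1)
      (b := (((√2 : ℝ) : ℂ) * (b - b')) • hermite 2) (c := k)
    have h11 := norm_add_le ((a - a') • hermite 1 + (((√2 : ℝ) : ℂ) * (b - b')) • hermite 2 + k -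
        (LLL.trans η (linRaise a' b') - linRaise a' b')) (η • LLL.trans η (lin a' b'))
    have h12 : ‖lin a' b'‖ ≤ L := by
      rw [lin, hL, ← ha', ← hb']
      refine (norm_add_le _ _).trans ?_
      rw [norm_smul, norm_smul, norm_hermite, norm_hermite, mul_one, mul_one]
    have h13 : ‖η • LLL.trans η (lin a' b')‖ ≤ L * E * s := by
      rw [norm_smul, LinearIsometry.norm_map]
      calc ‖η‖ * ‖lin a' b'‖ ≤ (E * s) * L := by gcongr
        _ = L * E * s := by ring
    have h14 : √2 * ‖b - b'‖ ≤ 2 * ‖b - b'‖ := by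
      gcongr
      rw [Real.sqrt_le_iff]; norm_num
    rw [norm_smul, norm_smul, norm_hermite, norm_hermite, norm_mul, Complex.norm_real,
      Real.norm_of_nonneg (Real.sqrt_nonneg _)] at h10
    linarith
  refine (hraise.normL21_trans_le (-β) hx hy).trans (ENNReal.ofReal_le_ofReal ?_)
  have h8 : (1 + ‖-β‖) * ((3 * K + 3 * (L * E)) * s) ≤ (1 + 2) * ((3 * K + 3 * (L * E)) * s) := by
    gcongr
  linarith


/-! ### Weighted stability in translated frames. -/

theorem exists_raise_of_normL21_le {c : Coeff} {r : ℝ} (hr : 0 ≤ r)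
    (h : normL21 (fock c) ≤ ENNReal.ofReal r) : ∃ e, Raise c e ∧ ‖c‖ ≤ r ∧ ‖e‖ ≤ r := by
  obtain ⟨e, he⟩ := exists_raise_of_normL21 (h.trans_lt ENNReal.ofReal_lt_top)
  rw [he.normL21, ENNReal.ofReal_le_ofReal_iff hr, Real.sqrt_le_left hr] at h
  refine ⟨e, he, (abs_le_of_sq_le_sq' ?_ hr).2, (abs_le_of_sq_le_sq' ?_ hr).2⟩
  · linarith [sq_nonneg ‖e‖]
  · linarith [sq_nonneg ‖c‖]

theorem normL21_fock_trans_le {c : Coeff} {r : ℝ} (hr : 0 ≤ r)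
    (h : normL21 (fock c) ≤ ENNReal.ofReal r) (β : ℂ) :
    normL21 (fock (trans β c)) ≤ ENNReal.ofReal ((2 + ‖β‖) * r) := by
  obtain ⟨e, he, h1, h2⟩ := exists_raise_of_normL21_le hr h
  refine (he.normL21_trans_le β h1 h2).trans (le_of_eq ?_)
  congr 1
  ring

/-- Stability of the functions `lin a₀ b₀` and their translates. -/
theorem Sol.stability_trans_lin {a₀ b₀ : ℂ} (hb₀ : b₀ ≠ 0) (γ₀ : ℂ) :
    ∃ δ₀ > (0 : ℝ), ∃ C > (0 : ℝ), ∀ c : ℝ → Coeff, Sol c →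
      ∀ δ : ℝ, 0 ≤ δ → δ ≤ δ₀ →
      normL21 (fock (c 0) - fock (LLL.trans γ₀ (lin a₀ b₀))) ≤ ENNReal.ofReal δ → ∀ t,
      ∃ a b : ℂ, ‖a‖ = ‖a₀‖ ∧ ‖b‖ = ‖b₀‖ ∧
        normL21 (fock (c t) - fock (LLL.trans γ₀ (LLL.trans
          ((a * conj b - a₀ * conj b₀) / (‖a₀‖ ^ 2 + ‖b₀‖ ^ 2 : ℝ)) (lin a b)))) ≤
          ENNReal.ofReal (C * √δ) := by
  obtain ⟨δ₁, hδ₁, C, hC, H⟩ := Sol.stability_lin (a₀ := a₀) hb₀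
  set κ := 1 + ‖γ₀‖ with hκ
  have hκ0 : 0 < κ := by positivity
  refine ⟨δ₁ / κ, by positivity, (2 + ‖γ₀‖) * (C * √κ), by positivity, ?_⟩
  intro c hc δ hδ0 hδ h0 t
  have hδκ : κ * δ ≤ δ₁ := by rwa [le_div_iff₀ hκ0, mul_comm] at hδ
  rw [fock_sub_fun] at h0
  obtain ⟨y, hy, hx1, hy1⟩ := exists_raise_of_normL21_le hδ0 h0
  set x := c 0 - LLL.trans γ₀ (lin a₀ b₀) with hx
  -- The solution is pulled back to the centred frame; the weighted norm of the perturbation grows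
  -- by at most `κ`.
  have hc0 : LLL.trans (-γ₀) (c 0) = lin a₀ b₀ + LLL.trans (-γ₀) x := by
    rw [hx, map_sub, trans_neg_trans]; abel
  have hraise := (raise_lin a₀ b₀).add (hy.trans (-γ₀))
  rw [← hc0] at hraise
  have hy2 : ‖LLL.trans (-γ₀) y - (-γ₀) • LLL.trans (-γ₀) x‖ ≤ κ * δ := by
    refine (norm_sub_le _ _).trans ?_
    rw [norm_smul, LinearIsometry.norm_map, LinearIsometry.norm_map, norm_neg]
    have : ‖γ₀‖ * ‖x‖ ≤ ‖γ₀‖ * δ := by gcongr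
    rw [hκ]; linarith
  have hx2 : ‖LLL.trans (-γ₀) x‖ ≤ κ * δ := by
    rw [LinearIsometry.norm_map]
    exact hx1.trans (le_mul_of_one_le_left hδ0 (by rw [hκ]; linarith [norm_nonneg γ₀]))
  obtain ⟨a, b, ha, hb, hab⟩ := H _ (hc.trans (-γ₀)) _ hraise (κ * δ) (by positivity) hδκ
    (by rw [hc0, add_sub_cancel_left]; exact hx2) (by rw [add_sub_cancel_left]; exact hy2) t
  refine ⟨a, b, ha, hb, ?_⟩
  rw [fock_sub_fun] at hab ⊢
  have := normL21_fock_trans_le (by positivity) hab γ₀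
  rw [map_sub, trans_trans_neg] at this
  refine this.trans (le_of_eq ?_)
  rw [Real.sqrt_mul hκ0.le]
  ring_nf

/-- Stability of the centered Gaussian in the weighted norm. -/
theorem Sol.stability_gaussian_weighted {c : ℝ → Coeff} (hc : Sol c) {e₀ : Coeff}
    (he₀ : Raise (c 0) e₀) {δ : ℝ} (hδ0 : 0 ≤ δ) (hδ : δ ≤ 1) (h0 : ‖c 0 - hermite 0‖ ≤ δ)
    (h0' : ‖e₀ - hermite 1‖ ≤ δ) (t : ℝ) : ∃ θ : ℝ,
      normL21 (fock (c t) - fock (Complex.exp (Complex.I * θ) • hermite 0)) ≤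
        ENNReal.ofReal (15 * √δ) := by
  have hcR : ‖c 0‖ ≤ 2 := by
    have := norm_sub_norm_le (c 0) (hermite 0); rw [norm_hermite] at this; linarith
  have heR : ‖e₀‖ ≤ 2 := by
    have := norm_sub_norm_le e₀ (hermite 1); rw [norm_hermite] at this; linarith
  have h1 := abs_le.1 (abs_norm_sq_sub_le hcR (by rw [norm_hermite]; norm_num) h0)
  have h2 := abs_le.1 (abs_norm_sq_sub_le heR (by rw [norm_hermite]; norm_num) h0')
  rw [norm_hermite] at h1 h2
  obtain ⟨e, he, hn⟩ := hc.exists_raise he₀ t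
  set x := tail 1 (c t) with hx
  have hx0 : ∀ n < 1, x n = 0 := fun n hn => by rw [hx, tail_apply, if_pos hn]
  have hcx : c t = c t 0 • hermite 0 + x := by rw [hx, tail, Finset.sum_range_one]; abel
  have h01 : Raise (hermite 0) (hermite 1) := by
    have := raise_hermite 0
    simpa using this
  set y := e - c t 0 • hermite 1 with hy
  have hxy : Raise x y := by
    have := he.sub (h01.smul (c t 0))
    rwa [show c t - c t 0 • hermite 0 = x by rw [hx, tail, Finset.sum_range_one]] at this
  have hM : ‖c 0‖ ^ 2 = ‖c t 0‖ ^ 2 + ‖x‖ ^ 2 := by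
    rw [← norm_smul_hermite_add_sq (hx0 0 (by norm_num)), ← hcx, hc.norm_eq t]
  -- The difference with the mass identity is the angular momentum `‖y‖² - ‖x‖²`, at most `8 δ`. As
  -- `x` starts at mode one, `2 ‖x‖² ≤ ‖y‖²`, whence `‖x‖² ≤ 8 δ` and `‖y‖² ≤ 16 δ`.
  have hN : ‖e₀‖ ^ 2 = ‖c t 0‖ ^ 2 + ‖y‖ ^ 2 := by
    rw [← norm_smul_hermite_add_sq (hxy.coeff_eq_zero hx0 le_rfl), hy, add_sub_cancel, hn]
  have hxy2 := hxy.norm_sq_mul_le hx0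
  push_cast at hxy2
  obtain ⟨θ, hθ⟩ := exists_phase (c t 0)
  have hs : √δ ^ 2 = δ := Real.sq_sqrt hδ0
  have hs0 := Real.sqrt_nonneg δ
  have hxs : ‖x‖ ≤ 3 * √δ :=
    (abs_le_of_sq_le_sq' (by rw [mul_pow, hs]; linarith [sq_nonneg ‖x‖]) (by positivity)).2
  have hys : ‖y‖ ≤ 4 * √δ :=
    (abs_le_of_sq_le_sq' (by rw [mul_pow, hs]; linarith [sq_nonneg ‖x‖]) (by positivity)).2
  have hzs : |‖c t 0‖ - 1| ≤ 4 * √δ := by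
    refine (abs_le_of_sq_le_sq' ?_ (by positivity)).2
    rw [mul_pow, hs, sq_abs]
    refine (sq_sub_one_le (norm_nonneg _)).trans ?_
    rw [abs_le]
    constructor <;> linarith [h1.1, h1.2, h2.1, h2.2, sq_nonneg ‖x‖]
  have hz : ‖c t 0 - Complex.exp (Complex.I * θ)‖ ≤ 4 * √δ := by
    have e : c t 0 - Complex.exp (Complex.I * θ) =
        ((‖c t 0‖ - 1 : ℝ) : ℂ) * Complex.exp (Complex.I * θ) := by
      push_cast
      rw [sub_mul, one_mul, ← hθ]
    rwa [e, norm_mul, norm_exp_I_mul, Complex.norm_real, Real.norm_eq_abs, mul_one]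
  refine ⟨θ, ?_⟩
  rw [fock_sub_fun]
  have hr := he.sub (h01.smul (Complex.exp (Complex.I * θ)))
  have hb : ∀ (n : ℕ) (u : Coeff), ‖c t 0 • hermite n + u -
      Complex.exp (Complex.I * θ) • hermite n‖ ≤ 4 * √δ + ‖u‖ := by
    intro n u
    have : c t 0 • hermite n + u - Complex.exp (Complex.I * θ) • hermite n =
        (c t 0 - Complex.exp (Complex.I * θ)) • hermite n + u := by module
    rw [this]
    refine (norm_add_le _ _).trans ?_
    rw [norm_smul, norm_hermite, mul_one]
    gcongr
  have hb0 := hb 0 x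
  have hb1 := hb 1 y
  rw [← hcx] at hb0
  rw [hy, add_sub_cancel, ← hy] at hb1
  exact (hr.normL21_le (hb0.trans (by gcongr)) (hb1.trans (by gcongr))).trans
    (ENNReal.ofReal_le_ofReal (by linarith))

theorem Sol.stability_trans_gaussian (γ₀ : ℂ) :
    ∃ δ₀ > (0 : ℝ), ∃ C > (0 : ℝ), ∀ c : ℝ → Coeff, Sol c →
      ∀ δ : ℝ, 0 ≤ δ → δ ≤ δ₀ →
      normL21 (fock (c 0) - fock (LLL.trans γ₀ (hermite 0))) ≤ ENNReal.ofReal δ → ∀ t,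
      ∃ θ : ℝ, normL21 (fock (c t) - fock (Complex.exp (Complex.I * θ) •
        LLL.trans γ₀ (hermite 0))) ≤ ENNReal.ofReal (C * √δ) := by
  set κ := 1 + ‖γ₀‖ with hκ
  have hκ0 : 0 < κ := by positivity
  refine ⟨1 / κ, by positivity, (2 + ‖γ₀‖) * (15 * √κ), by positivity, ?_⟩
  intro c hc δ hδ0 hδ h0 t
  have hδκ : κ * δ ≤ 1 := by rwa [le_div_iff₀ hκ0, mul_comm] at hδ
  rw [fock_sub_fun] at h0
  obtain ⟨y, hy, hx1, hy1⟩ := exists_raise_of_normL21_le hδ0 h0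
  set x := c 0 - LLL.trans γ₀ (hermite 0) with hx
  have hc0 : LLL.trans (-γ₀) (c 0) = hermite 0 + LLL.trans (-γ₀) x := by
    rw [hx, map_sub, trans_neg_trans]; abel
  have h01 : Raise (hermite 0) (hermite 1) := by
    have := raise_hermite 0
    simpa using this
  have hraise := h01.add (hy.trans (-γ₀))
  rw [← hc0] at hraise
  have hy2 : ‖LLL.trans (-γ₀) y - (-γ₀) • LLL.trans (-γ₀) x‖ ≤ κ * δ := by
    refine (norm_sub_le _ _).trans ?_
    rw [norm_smul, LinearIsometry.norm_map, LinearIsometry.norm_map, norm_neg]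
    have : ‖γ₀‖ * ‖x‖ ≤ ‖γ₀‖ * δ := by gcongr
    rw [hκ]; linarith
  have hx2 : ‖LLL.trans (-γ₀) x‖ ≤ κ * δ := by
    rw [LinearIsometry.norm_map]
    exact hx1.trans (le_mul_of_one_le_left hδ0 (by rw [hκ]; linarith [norm_nonneg γ₀]))
  obtain ⟨θ, hθ⟩ := (hc.trans (-γ₀)).stability_gaussian_weighted hraise (δ := κ * δ)
    (by positivity) hδκ
    (by rw [hc0, add_sub_cancel_left]; exact hx2) (by rw [add_sub_cancel_left]; exact hy2) t
  refine ⟨θ, ?_⟩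
  rw [fock_sub_fun] at hθ ⊢
  have := normL21_fock_trans_le (by positivity) hθ γ₀
  rw [map_sub, trans_trans_neg, map_smul] at this
  refine this.trans (le_of_eq ?_)
  rw [Real.sqrt_mul hκ0.le]
  ring_nf


/-! ### The profiles `ψ_b`, their orbits, and the four stability statements. -/

theorem entire_lin (a b z : ℂ) : entire (lin a b) z = (1 / √Real.pi : ℝ) * (a + b * z) := by
  have h : fock (lin a b) z = (Real.exp (-‖z‖ ^ 2 / 2) : ℂ) * ((1 / √Real.pi : ℝ) * (a + b * z)) := by
    rw [lin, fock_add, fock_smul, fock_smul, fock_eq, fock_eq, entire_hermite, entire_hermite]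
    simp
    ring
  rw [fock_eq] at h
  exact mul_left_cancel₀ (by exact_mod_cast (Real.exp_pos _).ne') h

theorem spaceRot_magTrans (s : ℝ) (β : ℂ) (u : ℂ → ℂ) : spaceRot s (magTrans β u) =
    magTrans (Complex.exp (-(Complex.I * s)) * β) (spaceRot s u) := by
  ext z
  have h1 : conj (Complex.exp (Complex.I * s)) = Complex.exp (-(Complex.I * s)) := by
    rw [← Complex.exp_conj, map_mul, Complex.conj_I, Complex.conj_ofReal, neg_mul]
  have h2 : conj (Complex.exp (-(Complex.I * s))) = Complex.exp (Complex.I * s) := by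
    rw [← h1, Complex.conj_conj]
  have h3 : Complex.exp (Complex.I * s) * Complex.exp (-(Complex.I * s)) = 1 := by
    rw [← Complex.exp_add, add_neg_cancel, Complex.exp_zero]
  simp only [spaceRot, magTrans, map_mul, h1, h2]
  congr 2
  · linear_combination (-β) * h3
  · ring

theorem norm_exp_I_mul_z (s : ℝ) (z : ℂ) : ‖Complex.exp (Complex.I * s) * z‖ = ‖z‖ := by
  rw [norm_mul, norm_exp_I_mul, one_mul]

theorem spaceRot_lin (s : ℝ) (a b : ℂ) : spaceRot s (fock (lin a b)) =
    fock (lin a (Complex.exp (Complex.I * s) * b)) := by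
  ext z
  rw [spaceRot, fock_eq, fock_eq, norm_exp_I_mul_z, entire_lin, entire_lin]
  ring

/-- The coordinates of `psi b` in its frame. -/
def psiCoeff (b : ℝ) : ℝ := 1 / √(1 + b ^ 2)

theorem psiCoeff_pos (b : ℝ) : 0 < psiCoeff b := by
  have : 0 < √(1 + b ^ 2) := Real.sqrt_pos.2 (by positivity)
  rw [psiCoeff]; positivity

theorem psiCoeff_sq (b : ℝ) : psiCoeff b ^ 2 = 1 / (1 + b ^ 2) := by
  rw [psiCoeff, div_pow, Real.sq_sqrt (by positivity), one_pow]

/-- The zero of `ψ_b` lies at `b (2 + b²) / (1 + b²) = b + b / (1 + b²)`; in the frame shifted by `b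
/ (1 + b²)` it lies at `b`. -/
theorem psi_eq (b : ℝ) : psi b = fock (trans (-(b / (1 + b ^ 2) : ℝ))
    (lin (-(b * psiCoeff b : ℝ)) (psiCoeff b : ℝ))) := by
  ext z
  have hb : (1 + (b : ℂ) ^ 2) ≠ 0 := by
    have : (1 + b ^ 2 : ℝ) ≠ 0 := by positivity
    exact_mod_cast this
  rw [fock_trans, magTrans_fock, entire_lin, psi, map_neg, Complex.conj_ofReal, norm_neg,
    Complex.norm_real, Real.norm_eq_abs, sq_abs]
  set κ : ℝ := b / (1 + b ^ 2) with hκ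
  have h1 : Complex.exp (-(‖z‖ ^ 2 : ℝ) / 2 + κ * z) = (Real.exp (-‖z‖ ^ 2 / 2) : ℂ) *
      Complex.exp (κ * z) := by
    push_cast
    rw [← Complex.exp_add]
  have h2 : Complex.exp (-(κ ^ 2 : ℝ) / 2 - -κ * z) = (Real.exp (-κ ^ 2 / 2) : ℂ) *
      Complex.exp (κ * z) := by
    push_cast
    rw [← Complex.exp_add]
    congr 1
    ring
  have h3 : √(Real.pi * (1 + b ^ 2)) = √Real.pi * √(1 + b ^ 2) := Real.sqrt_mul Real.pi_pos.le _
  have h4 : ((b * (2 + b ^ 2) / (1 + b ^ 2) : ℝ) : ℂ) = b + κ := by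
    rw [hκ]
    push_cast
    field_simp
    ring
  rw [h1, h2, h3, h4, psiCoeff]
  push_cast
  ring

/-- The group orbit of `psi b` in coordinates. -/
theorem orbit_psi (b θ s : ℝ) (β : ℂ) :
    phaseRot θ (spaceRot s (magTrans β (psi b))) =
      fock ((Complex.exp (Complex.I * θ) * Complex.exp ((conj β * (-(b / (1 + b ^ 2) : ℝ) : ℂ) -
        β * conj (-(b / (1 + b ^ 2) : ℝ) : ℂ)) / 2)) •
        trans (Complex.exp (-(Complex.I * s)) * (β - (b / (1 + b ^ 2) : ℝ)))
          (lin (-(b * psiCoeff b : ℝ)) (Complex.exp (Complex.I * s) * (psiCoeff b : ℝ)))) := by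
  have hsm : ∀ (ω : ℂ) (c : Coeff), spaceRot s (fock (ω • c)) = ω • spaceRot s (fock c) := by
    intro ω c
    ext z
    simp only [spaceRot, fock_smul, Pi.smul_apply, smul_eq_mul]
  rw [psi_eq, ← fock_trans, trans_trans, hsm, fock_trans, spaceRot_magTrans, spaceRot_lin,
    ← fock_trans, ← sub_eq_add_neg]
  ext z
  simp only [phaseRot, Pi.smul_apply, smul_eq_mul, fock_smul]
  ring

/-- Given the moduli, the relative phase of the two coefficients is a space rotation and their
common phase a phase rotation, which also absorbs `ω`. The formula for `a₁ * conj b₁` is kept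
because it fixes the translation parameter. -/
theorem exists_orbit_psi {b c : ℝ} {a₁ b₁ : ℂ} (ha : ‖a₁‖ = c * |b| * psiCoeff b)
    (hb0 : 0 ≤ b) (hb : ‖b₁‖ = c * psiCoeff b) : ∃ s : ℝ,
      a₁ * conj b₁ = -(c ^ 2 * (b / (1 + b ^ 2)) : ℝ) * Complex.exp (-(Complex.I * s)) ∧
      ∀ (ω β : ℂ), ‖ω‖ = 1 → ∃ θ : ℝ,
        fock (ω • trans (Complex.exp (-(Complex.I * s)) * (β - (b / (1 + b ^ 2) : ℝ))) (lin a₁ b₁)) =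
          (c : ℂ) • phaseRot θ (spaceRot s (magTrans β (psi b))) := by
  obtain ⟨θ₁, h1⟩ := exists_phase (-a₁)
  obtain ⟨θ₂, h2⟩ := exists_phase b₁
  rw [norm_neg, ha, abs_of_nonneg hb0] at h1
  rw [hb] at h2
  have ha1 : a₁ = -((c * b * psiCoeff b : ℝ) * Complex.exp (Complex.I * θ₁)) := by
    rw [← h1, neg_neg]
  have hexp : Complex.exp (Complex.I * θ₁) * Complex.exp (Complex.I * ((θ₂ - θ₁ : ℝ) : ℂ)) =
      Complex.exp (Complex.I * θ₂) := by
    rw [← Complex.exp_add]; congr 1; push_cast; ring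
  refine ⟨θ₂ - θ₁, ?_, fun ω β hω => ?_⟩
  · have hconj : conj (Complex.exp (Complex.I * θ₂)) = Complex.exp (-(Complex.I * θ₂)) := by
      rw [← Complex.exp_conj, map_mul, Complex.conj_I, Complex.conj_ofReal, neg_mul]
    have he : Complex.exp (Complex.I * θ₁) * Complex.exp (-(Complex.I * θ₂)) =
        Complex.exp (-(Complex.I * ((θ₂ - θ₁ : ℝ) : ℂ))) := by
      rw [← Complex.exp_add]; congr 1; push_cast; ring
    rw [h2, ha1, map_mul, Complex.conj_ofReal, hconj, ← he]
    have hp : (c ^ 2 * (b / (1 + b ^ 2)) : ℝ) = (c * b * psiCoeff b) * (c * psiCoeff b) := by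
      have := psiCoeff_sq b
      rw [show (c * b * psiCoeff b) * (c * psiCoeff b) = c ^ 2 * b * psiCoeff b ^ 2 by ring, this]
      ring
    rw [hp]
    push_cast
    ring
  · obtain ⟨θ, hθ⟩ := exists_phase (ω * Complex.exp (Complex.I * θ₁) *
      (Complex.exp ((conj β * (-(b / (1 + b ^ 2) : ℝ) : ℂ) -
        β * conj (-(b / (1 + b ^ 2) : ℝ) : ℂ)) / 2))⁻¹)
    rw [norm_mul, norm_mul, hω, norm_exp_I_mul, norm_inv, norm_exp_twist, inv_one, one_mul, one_mul,
      Complex.ofReal_one, one_mul] at hθ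
    refine ⟨θ, ?_⟩
    rw [orbit_psi, ← hθ, inv_mul_cancel_right₀ (Complex.exp_ne_zero _)]
    have hl : lin a₁ b₁ = ((c : ℂ) * Complex.exp (Complex.I * θ₁)) • lin (-(b * psiCoeff b : ℝ))
        (Complex.exp (Complex.I * ((θ₂ - θ₁ : ℝ) : ℂ)) * (psiCoeff b : ℝ)) := by
      rw [lin, lin, smul_add, smul_smul, smul_smul]
      congr 2
      · rw [ha1]; push_cast; ring
      · rw [h2, ← hexp]; push_cast; ring
    rw [hl, map_smul]
    ext z
    simp only [fock_smul, Pi.smul_apply, smul_eq_mul]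
    ring

theorem stability_one :
    ∃ C > (0 : ℝ), ∃ δ₀ > (0 : ℝ), ∀ α : ℂ,
      ∀ u₀ u, IsSolution u₀ u → ∀ δ : ℝ, 0 ≤ δ → δ ≤ δ₀ →
        normL2 (u₀ - phi 0 α) = ENNReal.ofReal δ →
        (⨆ t : ℝ, ⨅ (θ : ℝ) (β : ℂ), normL2 (u t - phaseRot θ (phi 0 β)))
          ≤ ENNReal.ofReal (C * √δ) := by
  refine ⟨21, by norm_num, 1 / 10000, by norm_num, fun α u₀ u hu δ hδ0 hδ h0 => iSup_le fun t => ?_⟩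
  obtain ⟨c, hc, hut, rfl⟩ := hu.exists_sol
  rw [phi_eq, fock_sub_fun, normL2_fock,
    ENNReal.ofReal_eq_ofReal_iff (norm_nonneg _) hδ0] at h0
  obtain ⟨θ, β, h⟩ := hc.stability_gaussian hδ0 hδ h0 t
  refine (iInf₂_le θ (-conj β)).trans ?_
  rw [phi_eq, map_neg, Complex.conj_conj, neg_neg, hut, phaseRot_fock, fock_sub_fun, normL2_fock]
  exact ENNReal.ofReal_le_ofReal h

theorem stability_two (α : ℂ) : ∃ C > (0 : ℝ), ∃ δ₀ > (0 : ℝ), ∀ j : ℕ, (j = 0 ∨ j = 1) →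
      ∀ u₀ u, IsSolution u₀ u → ∀ δ : ℝ, 0 ≤ δ → δ ≤ δ₀ →
        normL21 (u₀ - phi j α) = ENNReal.ofReal δ →
        (⨆ t : ℝ, ⨅ θ : ℝ, normL21 (u t - phaseRot θ (phi j α)))
          ≤ ENNReal.ofReal (C * √δ) := by
  obtain ⟨δ₁, hδ₁, C₁, hC₁, H₁⟩ := Sol.stability_trans_gaussian (-conj α)
  -- The profile `φ_1` is `lin 0 1`. With `a₀ = 0` the modulated translation is zero, and the phase
  -- of `b` is the only freedom.
  obtain ⟨δ₂, hδ₂, C₂, hC₂, H₂⟩ := Sol.stability_trans_lin (a₀ := 0) one_ne_zero (-conj α)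
  have hl : ∀ b : ℂ, lin 0 b = b • hermite 1 := fun b => by rw [lin, zero_smul, zero_add]
  refine ⟨max C₁ C₂, lt_max_of_lt_left hC₁, min δ₁ δ₂, lt_min hδ₁ hδ₂, ?_⟩
  rintro j hj u₀ u hu δ hδ0 hδ h0
  refine iSup_le fun t => ?_
  obtain ⟨c, hc, hut, rfl⟩ := hu.exists_sol
  have hs := Real.sqrt_nonneg δ
  rcases hj with rfl | rfl
  · rw [phi_eq] at h0
    obtain ⟨θ, h⟩ := H₁ c hc δ hδ0 (hδ.trans (min_le_left _ _)) h0.le t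
    refine (iInf_le _ θ).trans ?_
    rw [phi_eq, phaseRot_fock, hut]
    exact h.trans (ENNReal.ofReal_le_ofReal (by gcongr; exact le_max_left _ _))
  · rw [phi_eq, show hermite 1 = lin 0 1 by rw [hl, one_smul]] at h0
    obtain ⟨a, b, ha, hb, h⟩ := H₂ c hc δ hδ0 (hδ.trans (min_le_right _ _)) h0.le t
    rw [norm_zero, norm_eq_zero] at ha
    rw [norm_one] at hb
    obtain ⟨θ, hθ⟩ := exists_phase b
    rw [hb, Complex.ofReal_one, one_mul] at hθ
    refine (iInf_le _ θ).trans ?_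
    rw [ha, zero_mul, zero_mul, sub_zero, zero_div, trans_zero, hl, map_smul, hθ] at h
    rw [phi_eq, phaseRot_fock, hut]
    exact h.trans (ENNReal.ofReal_le_ofReal (by gcongr; exact le_max_right _ _))

theorem magTrans_zero (u : ℂ → ℂ) : magTrans 0 u = u := by
  ext z; simp [magTrans]

theorem stability_three (b : ℝ) (hb : 0 ≤ b) : ∃ C > (0 : ℝ), ∃ δ₀ > (0 : ℝ),
      ∀ u₀ u, IsSolution u₀ u → ∀ δ : ℝ, 0 ≤ δ → δ ≤ δ₀ →
        normL21 (u₀ - psi b) = ENNReal.ofReal δ →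
        (⨆ t : ℝ, ⨅ (θ : ℝ) (s : ℝ), normL21 (u t - phaseRot θ (spaceRot s (psi b))))
          ≤ ENNReal.ofReal (C * √δ) := by
  have hp := psiCoeff_pos b
  obtain ⟨δ₀, hδ₀, C, hC, H⟩ := Sol.stability_trans_lin (a₀ := (-(b * psiCoeff b : ℝ) : ℂ))
    (b₀ := (psiCoeff b : ℝ)) (by exact_mod_cast hp.ne') (-(b / (1 + b ^ 2) : ℝ))
  refine ⟨C, hC, δ₀, hδ₀, fun u₀ u hu δ hδ0 hδ h0 => iSup_le fun t => ?_⟩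
  obtain ⟨c, hc, hut, rfl⟩ := hu.exists_sol
  rw [psi_eq] at h0
  obtain ⟨a₁, b₁, ha, hb₁, h⟩ := H c hc δ hδ0 hδ h0.le t
  rw [norm_neg, Complex.norm_real, Complex.norm_real, Real.norm_of_nonneg (by positivity),
    Real.norm_of_nonneg hp.le] at h
  rw [norm_neg, Complex.norm_real, Real.norm_of_nonneg (by positivity)] at ha
  rw [Complex.norm_real, Real.norm_of_nonneg hp.le] at hb₁
  have hm : (b * psiCoeff b) ^ 2 + psiCoeff b ^ 2 = 1 := by
    rw [mul_pow, psiCoeff_sq]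
    field_simp
    ring
  have hk : (-(b * psiCoeff b : ℝ) : ℂ) * conj ((psiCoeff b : ℝ) : ℂ) = -(b / (1 + b ^ 2) : ℝ) := by
    have h1 : b / (1 + b ^ 2) = b * psiCoeff b * psiCoeff b := by
      rw [mul_assoc, ← sq, psiCoeff_sq]; ring
    rw [Complex.conj_ofReal, h1]
    push_cast
    ring
  obtain ⟨s, hs, hω⟩ := exists_orbit_psi (b := b) (c := 1) (a₁ := a₁) (b₁ := b₁)
    (by rw [ha, abs_of_nonneg hb]; ring) hb (by rw [hb₁, one_mul])
  -- The two translations add up to `-exp (-I s) b / (1 + b²)`, which is the frame of the rotated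
  -- `ψ_b`. No magnetic translation is left in the orbit.
  rw [hm, hk, hs, Complex.ofReal_one, div_one, trans_trans] at h
  obtain ⟨θ, hθ⟩ := hω _ 0 (norm_exp_twist (-(b / (1 + b ^ 2) : ℝ) : ℂ)
    (-(1 ^ 2 * (b / (1 + b ^ 2)) : ℝ) * Complex.exp (-(Complex.I * s)) - -(b / (1 + b ^ 2) : ℝ)))
  refine (iInf₂_le θ s).trans ?_
  rw [magTrans_zero, Complex.ofReal_one, one_smul] at hθ
  rw [← hθ, hut]
  convert! h using 7
  push_cast
  ring

theorem stability_four (lam mu al : ℂ) (hlam : lam ≠ 0) (v₀ : ℂ → ℂ)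
    (hv₀ : ∀ z, v₀ z = (lam * z + mu) * Complex.exp (al * z - (‖z‖ ^ 2 : ℝ) / 2)) :
      ∃ b : ℝ, 0 ≤ b ∧ ∃ c : ℝ, 0 < c ∧
        (∃ w ∈ fullOrbit (psi b), v₀ = (c : ℂ) • w) ∧
        ∃ C > (0 : ℝ), ∃ δ₀ > (0 : ℝ),
          ∀ u₀ u, IsSolution u₀ u → ∀ δ : ℝ, 0 ≤ δ → δ ≤ δ₀ →
            normL21 (u₀ - v₀) = ENNReal.ofReal δ →
            (⨆ t : ℝ, ⨅ (θ : ℝ) (s : ℝ) (β : ℂ),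
                normL21 (u t -
                  (c : ℂ) • phaseRot θ (spaceRot s (magTrans β (psi b)))))
              ≤ ENNReal.ofReal (C * √δ) := by
  set K : ℝ := √Real.pi * Real.exp (‖al‖ ^ 2 / 2) with hK
  have hpi : √Real.pi ≠ 0 := (Real.sqrt_pos.2 Real.pi_pos).ne'
  have hK0 : 0 < K := by have := Real.sqrt_pos.2 Real.pi_pos; positivity
  have hKne : (K : ℂ) ≠ 0 := by exact_mod_cast hK0.ne'
  -- Up to the normalization `K` this is the value of the linear factor at the centre `conj al` of
  -- the frame.
  set a₀ : ℂ := K * (mu + lam * conj al) with ha₀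
  set b₀ : ℂ := K * lam with hb₀
  have hb₀' : b₀ ≠ 0 := mul_ne_zero hKne hlam
  have hbpos : 0 < ‖b₀‖ := norm_pos_iff.2 hb₀'
  have hv : v₀ = fock (trans (-conj al) (lin a₀ b₀)) := by
    ext z
    rw [hv₀, fock_trans, magTrans_fock, entire_lin, map_neg, Complex.conj_conj, norm_neg,
      RCLike.norm_conj, ha₀, hb₀, hK]
    have h1 : Complex.exp (al * z - (‖z‖ ^ 2 : ℝ) / 2) = (Real.exp (-‖z‖ ^ 2 / 2) : ℂ) *
        (Complex.exp (-(‖al‖ ^ 2 : ℝ) / 2 - -al * z) * (Real.exp (‖al‖ ^ 2 / 2) : ℂ)) := by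
      push_cast
      rw [← Complex.exp_add, ← Complex.exp_add]
      congr 1
      ring
    have hpi' : ((√Real.pi : ℝ) : ℂ) ≠ 0 := by exact_mod_cast hpi
    rw [h1]
    push_cast
    field_simp
    ring
  -- In its frame `ψ_b` has coefficients with ratio of moduli `b`, so the ratio determines `b` and
  -- the size then determines `c`.
  set b : ℝ := ‖a₀‖ / ‖b₀‖ with hb
  set c : ℝ := ‖b₀‖ / psiCoeff b with hc
  have hb0 : 0 ≤ b := by positivity
  have hp := psiCoeff_pos b
  have hc0 : 0 < c := by positivity
  have hcb : c * psiCoeff b = ‖b₀‖ := by rw [hc, div_mul_cancel₀ _ hp.ne']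
  have hca : c * |b| * psiCoeff b = ‖a₀‖ := by
    rw [abs_of_nonneg hb0, mul_right_comm, hcb, hb, mul_div_cancel₀ _ hbpos.ne']
  have orbit : ∀ (a₁ b₁ γ ω : ℂ), ‖a₁‖ = ‖a₀‖ → ‖b₁‖ = ‖b₀‖ → ‖ω‖ = 1 → ∃ (θ s : ℝ) (β : ℂ),
      fock (ω • trans γ (lin a₁ b₁)) =
        (c : ℂ) • phaseRot θ (spaceRot s (magTrans β (psi b))) := by
    intro a₁ b₁ γ ω h1 h2 hω
    obtain ⟨s, -, h⟩ := exists_orbit_psi (h1.trans hca.symm) hb0 (h2.trans hcb.symm)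
    obtain ⟨θ, hθ⟩ := h ω (Complex.exp (Complex.I * s) * γ + (b / (1 + b ^ 2) : ℝ)) hω
    rw [add_sub_cancel_right, ← mul_assoc, ← Complex.exp_add, neg_add_cancel, Complex.exp_zero,
      one_mul] at hθ
    exact ⟨θ, s, _, hθ⟩
  refine ⟨b, hb0, c, hc0, ?_, ?_⟩
  · obtain ⟨θ, s, β, h⟩ := orbit a₀ b₀ (-conj al) 1 rfl rfl norm_one
    rw [one_smul, ← hv] at h
    exact ⟨_, ⟨θ, s, β, rfl⟩, h⟩
  · obtain ⟨δ₀, hδ₀, C, hC, H⟩ := Sol.stability_trans_lin (a₀ := a₀) hb₀' (-conj al)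
    refine ⟨C, hC, δ₀, hδ₀, fun u₀ u hu δ hδ0 hδ h0 => iSup_le fun t => ?_⟩
    obtain ⟨c', hc', hut, rfl⟩ := hu.exists_sol
    rw [hv] at h0
    obtain ⟨a₁, b₁, ha₁, hb₁, h⟩ := H c' hc' δ hδ0 hδ h0.le t
    rw [trans_trans] at h
    obtain ⟨θ, s, β, hβ⟩ := orbit a₁ b₁ _ _ ha₁ hb₁ (norm_exp_twist _ _)
    rw [hβ, ← hut] at h
    refine (iInf_le _ θ).trans ?_
    refine (iInf_le _ s).trans ?_
    refine (iInf_le _ β).trans ?_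
    exact h


/-! ### Global existence and uniqueness. -/

theorem norm_adjoint_prodMap_le (c x : Coeff) :
    ‖ContinuousLinearMap.adjoint (prodMap c) x‖ ≤ ‖c‖ * ‖x‖ := by
  refine (ContinuousLinearMap.le_opNorm _ _).trans ?_
  rw [LinearIsometryEquiv.norm_map]
  gcongr
  exact ContinuousLinearMap.opNorm_le_bound _ (norm_nonneg _) fun y => norm_prodMap_le c y

theorem norm_inv_two_pi_le : ‖(1 / (2 * Real.pi) : ℂ)‖ ≤ 1 := by
  have h : (1 / (2 * Real.pi) : ℂ) = ((1 / (2 * Real.pi) : ℝ) : ℂ) := by push_cast; rfl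
  rw [h, Complex.norm_real, Real.norm_of_nonneg (by positivity)]
  rw [div_le_one (by positivity)]
  linarith [Real.pi_gt_three]

theorem norm_nonlin_le (c : Coeff) : ‖nonlin c‖ ≤ ‖c‖ ^ 3 := by
  rw [nonlin, norm_smul]
  have h1 := norm_adjoint_prodMap_le c (prodMap c c)
  have h2 := norm_prodMap_le c c
  calc _ ≤ 1 * (‖c‖ * (‖c‖ * ‖c‖)) := by
        gcongr
        · exact norm_inv_two_pi_le
        · exact h1.trans (by gcongr)
    _ = ‖c‖ ^ 3 := by ring

theorem norm_nonlin_sub_le {c d : Coeff} {R : ℝ} (hc : ‖c‖ ≤ R) (hd : ‖d‖ ≤ R) :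
    ‖nonlin c - nonlin d‖ ≤ 3 * R ^ 2 * ‖c - d‖ := by
  have hR : 0 ≤ R := (norm_nonneg _).trans hc
  have e : nonlin c - nonlin d = (1 / (2 * Real.pi) : ℂ) •
      (ContinuousLinearMap.adjoint (prodMap (c - d)) (prodMap c c) +
        ContinuousLinearMap.adjoint (prodMap d) (prodMap c c - prodMap d d)) := by
    rw [nonlin, nonlin, ← smul_sub]
    congr 1
    simp only [map_sub, sub_apply]
    abel
  rw [e, norm_smul]
  have h1 : ‖ContinuousLinearMap.adjoint (prodMap (c - d)) (prodMap c c)‖ ≤ ‖c - d‖ * (R * R) :=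
    (norm_adjoint_prodMap_le _ _).trans (by
      gcongr; exact (norm_prodMap_le _ _).trans (by gcongr))
  have h2 : ‖ContinuousLinearMap.adjoint (prodMap d) (prodMap c c - prodMap d d)‖ ≤
      R * (‖c - d‖ * (R + R)) :=
    (norm_adjoint_prodMap_le _ _).trans (by
      gcongr; exact (norm_prodMap_sub_le _ _).trans (by gcongr))
  calc _ ≤ 1 * (‖c - d‖ * (R * R) + R * (‖c - d‖ * (R + R))) := by
        gcongr
        · exact norm_inv_two_pi_le
        · exact (norm_add_le _ _).trans (add_le_add h1 h2)
    _ = 3 * R ^ 2 * ‖c - d‖ := by ring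

/-- A cutoff function equal to one on the ball of radius `R` and vanishing off that of radius
`R + 1`. -/
def cutoff (R : ℝ) (c : Coeff) : ℝ := max 0 (min 1 (R + 1 - ‖c‖))

theorem cutoff_nonneg (R : ℝ) (c : Coeff) : 0 ≤ cutoff R c := le_max_left _ _

theorem cutoff_le_one (R : ℝ) (c : Coeff) : cutoff R c ≤ 1 :=
  max_le zero_le_one (min_le_left _ _)

theorem cutoff_eq_one {R : ℝ} {c : Coeff} (h : ‖c‖ ≤ R) : cutoff R c = 1 := by
  rw [cutoff, min_eq_left (by linarith), max_eq_right zero_le_one]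

theorem cutoff_eq_zero {R : ℝ} {c : Coeff} (h : R + 1 ≤ ‖c‖) : cutoff R c = 0 := by
  rw [cutoff, min_eq_right (by linarith), max_eq_left (by linarith)]

theorem abs_cutoff_sub_le (R : ℝ) (c d : Coeff) : |cutoff R c - cutoff R d| ≤ ‖c - d‖ := by
  refine (abs_max_sub_max_le_max _ _ _ _).trans ?_
  rw [sub_self, abs_zero]
  refine max_le (norm_nonneg _) ((abs_min_sub_min_le_max _ _ _ _).trans ?_)
  rw [sub_self, abs_zero]
  refine max_le (norm_nonneg _) ?_
  rw [show R + 1 - ‖c‖ - (R + 1 - ‖d‖) = ‖d‖ - ‖c‖ by ring, abs_sub_comm]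
  exact abs_norm_sub_norm_le c d

/-- The vector field of the equation, multiplied by the cutoff. -/
def cutField (R : ℝ) (c : Coeff) : Coeff := (cutoff R c : ℂ) • (-Complex.I • nonlin c)

theorem norm_cutField_le {R : ℝ} (hR : 0 ≤ R) (c : Coeff) : ‖cutField R c‖ ≤ (R + 1) ^ 3 := by
  rw [cutField, norm_smul, norm_smul, norm_neg, Complex.norm_I, one_mul, Complex.norm_real,
    Real.norm_of_nonneg (cutoff_nonneg R c)]
  rcases le_total (R + 1) ‖c‖ with h | h
  · rw [cutoff_eq_zero h, zero_mul]; positivity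
  · calc _ ≤ 1 * ‖c‖ ^ 3 := by
          gcongr
          · exact cutoff_le_one R c
          · exact norm_nonlin_le c
      _ ≤ (R + 1) ^ 3 := by rw [one_mul]; gcongr

theorem norm_cutField_sub_le (R : ℝ) {A : ℝ} {c d : Coeff} (hc : ‖c‖ ≤ A) (hd : ‖d‖ ≤ A) :
    ‖cutField R c - cutField R d‖ ≤ (3 * A ^ 2 + A ^ 3) * ‖c - d‖ := by
  have e : cutField R c - cutField R d = (cutoff R c : ℂ) • (-Complex.I • (nonlin c - nonlin d)) +
      ((cutoff R c - cutoff R d : ℝ) : ℂ) • (-Complex.I • nonlin d) := by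
    rw [cutField, cutField]; push_cast; module
  have hA : 0 ≤ A := (norm_nonneg _).trans hc
  rw [e]
  refine (norm_add_le _ _).trans ?_
  simp only [norm_smul, norm_neg, Complex.norm_I, one_mul, Complex.norm_real,
    Real.norm_of_nonneg (cutoff_nonneg R c), Real.norm_eq_abs]
  have h1 : cutoff R c * ‖nonlin c - nonlin d‖ ≤ 1 * (3 * A ^ 2 * ‖c - d‖) := by
    gcongr
    · exact cutoff_le_one R c
    · exact norm_nonlin_sub_le hc hd
  have h2 : |cutoff R c - cutoff R d| * ‖nonlin d‖ ≤ ‖c - d‖ * A ^ 3 := by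
    gcongr
    · exact abs_cutoff_sub_le R c d
    · exact (norm_nonlin_le d).trans (by gcongr)
  linarith

/-- The cutoff is a real factor, so the truncated flow still conserves mass, and a solution starting
on the sphere of radius `R` never feels it. -/
theorem inner_cutField_re (R : ℝ) (c : Coeff) : (inner ℂ c (cutField R c)).re = 0 := by
  rw [cutField, inner_smul_right, inner_smul_right, inner_nonlin_self, Complex.re_ofReal_mul,
    neg_mul, Complex.neg_re, Complex.I_mul_re, Complex.ofReal_im]
  simp

/-- The truncated field is globally bounded and Lipschitz on bounded sets, so Picard-Lindelöf
applies on intervals of any length. -/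
theorem exists_sol_Ioo (c₀ : Coeff) {T : ℝ} (hT : 0 < T) : ∃ c : ℝ → Coeff, c 0 = c₀ ∧
    ∀ t ∈ Set.Ioo (-T) T, HasDerivAt c (-Complex.I • nonlin (c t)) t ∧ ‖c t‖ = ‖c₀‖ := by
  set R := ‖c₀‖ with hR
  have hR0 : 0 ≤ R := norm_nonneg _
  set L : ℝ := (R + 1) ^ 3 with hL
  have hL0 : 0 ≤ L := by positivity
  set A : ℝ := R + L * T with hA
  have hA0 : 0 ≤ A := by positivity
  have ht₀ : (0 : ℝ) ∈ Set.Icc (-T) T := ⟨by linarith, hT.le⟩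
  have hball : ∀ x ∈ Metric.closedBall c₀ (L * T), ‖x‖ ≤ A := by
    intro x hx
    rw [mem_closedBall_iff_norm] at hx
    have := norm_sub_norm_le x c₀
    rw [hA]; linarith
  have hpl : IsPicardLindelof (fun _ => cutField R) (⟨0, ht₀⟩ : Set.Icc (-T) T) c₀
      ⟨L * T, by positivity⟩ 0 ⟨L, hL0⟩ ⟨3 * A ^ 2 + A ^ 3, by positivity⟩ := by
    refine IsPicardLindelof.of_time_independent (fun x _ => norm_cutField_le hR0 x) ?_ ?_
    · refine LipschitzOnWith.of_dist_le_mul fun x hx y hy => ?_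
      rw [dist_eq_norm, dist_eq_norm]
      exact norm_cutField_sub_le R (hball x hx) (hball y hy)
    · simp only [sub_zero, zero_sub, neg_neg, max_self, NNReal.coe_zero]
      exact le_rfl
  obtain ⟨c, hc0, hc⟩ := hpl.exists_eq_forall_mem_Icc_hasDerivWithinAt₀
  have hder : ∀ t ∈ Set.Ioo (-T) T, HasDerivAt c (cutField R (c t)) t := fun t ht =>
    (hc t (Set.Ioo_subset_Icc_self ht)).hasDerivAt (Icc_mem_nhds ht.1 ht.2)
  have hnorm : ∀ t ∈ Set.Ioo (-T) T, ‖c t‖ = ‖c₀‖ := by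
    have hd : ∀ t ∈ Set.Ioo (-T) T, HasDerivAt (fun t => (inner ℂ (c t) (c t) : ℂ)) 0 t := by
      intro t ht
      have h := (hder t ht).inner ℂ (hder t ht)
      convert! h using 1
      rw [← inner_conj_symm (cutField R (c t)), Complex.add_conj, inner_cutField_re]
      simp
    intro t ht
    have h0 : (0 : ℝ) ∈ Set.Ioo (-T) T := ⟨by linarith, hT⟩
    have h := isOpen_Ioo.is_const_of_deriv_eq_zero isPreconnected_Ioo
      (fun t ht => (hd t ht).differentiableAt.differentiableWithinAt)
      (fun t ht => (hd t ht).deriv) ht h0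
    have hc0' : c 0 = c₀ := hc0
    rw [hc0', inner_self_eq_norm_sq_to_K, inner_self_eq_norm_sq_to_K] at h
    have h : ‖c t‖ ^ 2 = ‖c₀‖ ^ 2 := by exact_mod_cast h
    exact (sq_eq_sq₀ (norm_nonneg _) (norm_nonneg _)).1 h
  refine ⟨c, hc0, fun t ht => ⟨?_, hnorm t ht⟩⟩
  have h := hder t ht
  rwa [cutField, cutoff_eq_one (hnorm t ht).le, Complex.ofReal_one, one_smul] at h

theorem eqOn_of_hasDerivAt {c d : ℝ → Coeff} {T R : ℝ} (hT : 0 < T)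
    (hc : ∀ t ∈ Set.Ioo (-T) T, HasDerivAt c (-Complex.I • nonlin (c t)) t ∧ ‖c t‖ = R)
    (hd : ∀ t ∈ Set.Ioo (-T) T, HasDerivAt d (-Complex.I • nonlin (d t)) t ∧ ‖d t‖ = R)
    (h0 : c 0 = d 0) : Set.EqOn c d (Set.Ioo (-T) T) := by
  refine ODE_solution_unique_of_mem_Ioo (v := fun _ x => -Complex.I • nonlin x)
    (s := fun _ => Metric.closedBall 0 R) (K := ⟨3 * R ^ 2, by positivity⟩) (t₀ := 0)
    (fun t _ => ?_) ⟨by linarith, hT⟩ (fun t ht => ⟨(hc t ht).1, ?_⟩)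
    (fun t ht => ⟨(hd t ht).1, ?_⟩) h0
  · refine LipschitzOnWith.of_dist_le_mul fun x hx y hy => ?_
    rw [dist_eq_norm, dist_eq_norm, ← smul_sub, norm_smul, norm_neg, Complex.norm_I, one_mul]
    rw [mem_closedBall_zero_iff] at hx hy
    exact norm_nonlin_sub_le hx hy
  · rw [mem_closedBall_zero_iff, (hc t ht).2]
  · rw [mem_closedBall_zero_iff, (hd t ht).2]

theorem Sol.eq_of_eq_zero {c d : ℝ → Coeff} (hc : Sol c) (hd : Sol d) (h0 : c 0 = d 0) (t : ℝ) :
    c t = d t := by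
  have hT : 0 < |t| + 1 := by positivity
  refine eqOn_of_hasDerivAt hT (fun t _ => ⟨hc t, hc.norm_eq t⟩)
    (fun t _ => ⟨hd t, by rw [hd.norm_eq t, h0]⟩) h0 ?_
  constructor <;> linarith [le_abs_self t, neg_abs_le t]

/-- Global existence. -/
theorem exists_sol_of_init (c₀ : Coeff) : ∃ c : ℝ → Coeff, Sol c ∧ c 0 = c₀ := by
  have hpos : ∀ N : ℕ, (0 : ℝ) < N + 1 := fun N => by positivity
  choose c hc0 hc using fun N : ℕ => exists_sol_Ioo c₀ (hpos N)
  have hagree : ∀ N M : ℕ, N ≤ M → ∀ t ∈ Set.Ioo (-(N + 1 : ℝ)) (N + 1), c N t = c M t := by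
    intro N M hNM
    have hle : (N : ℝ) ≤ M := by exact_mod_cast hNM
    exact eqOn_of_hasDerivAt (hpos N) (hc N)
      (fun t ht => hc M t ⟨by linarith [ht.1], by linarith [ht.2]⟩) ((hc0 N).trans (hc0 M).symm)
  set d : ℝ → Coeff := fun t => c ⌈|t|⌉₊ t with hd
  have hmem : ∀ (N : ℕ) (t : ℝ), |t| < N + 1 → d t = c N t := by
    intro N t ht
    have h1 : |t| < (⌈|t|⌉₊ : ℝ) + 1 := (Nat.le_ceil _).trans_lt (by linarith)
    rcases le_total ⌈|t|⌉₊ N with h | h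
    · exact hagree _ _ h t (abs_lt.1 h1)
    · exact (hagree _ _ h t (abs_lt.1 ht)).symm
  refine ⟨d, fun t => ?_, by rw [hmem 0 0 (by simp), hc0]⟩
  set N := ⌈|t|⌉₊ with hN
  have h1 : |t| < (N : ℝ) + 1 := (Nat.le_ceil _).trans_lt (by linarith)
  have h2 : d =ᶠ[𝓝 t] c N := by
    filter_upwards [(continuous_abs.isOpen_preimage _ isOpen_Iio).mem_nhds
      (show t ∈ abs ⁻¹' Set.Iio ((N : ℝ) + 1) from h1)] with s hs
    exact hmem N s hs
  have h3 := (hc N t (abs_lt.1 h1)).1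
  rw [← hmem N t h1] at h3
  exact h3.congr_of_eventuallyEq h2

/-! ### Parity -/

/-- The reflection `z ↦ -z`, normalized to fix `hermite n`. -/
def parity (n : ℕ) (c : Coeff) : Coeff :=
  Coeff.mk (fun m => (-1) ^ (n + m) * c m) (by
    simpa using (Coeff.hasSum_norm_sq c).summable)

theorem parity_apply (n : ℕ) (c : Coeff) (m : ℕ) : parity n c m = (-1) ^ (n + m) * c m := rfl

theorem prodMap_parity (n : ℕ) (c d : Coeff) (s : ℕ) :
    prodMap (parity n c) (parity n d) s = (-1) ^ s * prodMap c d s := by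
  rw [prodMap_apply, prodMap_apply, Finset.mul_sum]
  refine Finset.sum_congr rfl fun p hp => ?_
  have hp := Finset.HasAntidiagonal.mem_antidiagonal.1 hp
  rw [parity_apply, parity_apply, ← hp]
  have h : ((-1 : ℂ) ^ (n + p.1)) * (-1) ^ (n + p.2) = (-1) ^ (p.1 + p.2) := by
    rw [← pow_add, show n + p.1 + (n + p.2) = 2 * n + (p.1 + p.2) by ring, pow_add, pow_mul]
    simp
  linear_combination (tau p.1 p.2 * (c p.1 * d p.2)) * h

theorem inner_eq_of_sign {x y x' y' : Coeff} {ε : ℕ → ℕ} (hx : ∀ s, x' s = (-1) ^ ε s * x s)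
    (hy : ∀ s, y' s = (-1) ^ ε s * y s) : (inner ℂ x' y' : ℂ) = inner ℂ x y := by
  refine (Coeff.hasSum_inner x' y').unique ((Coeff.hasSum_inner x y).congr_fun fun s => ?_)
  have h : ((-1 : ℂ) ^ ε s) * (-1) ^ ε s = 1 := by
    rw [← pow_add, ← two_mul, pow_mul]; simp
  rw [hx, hy, map_mul, map_pow, map_neg, map_one]
  linear_combination (conj (x s) * y s) * h

theorem parity_parity (n : ℕ) (c : Coeff) : parity n (parity n c) = c := by
  ext m
  rw [parity_apply, parity_apply, ← mul_assoc, ← pow_add, ← two_mul, pow_mul]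
  simp

theorem norm_parity_sub (n : ℕ) (c d : Coeff) : ‖parity n c - parity n d‖ = ‖c - d‖ := by
  rw [← sq_eq_sq₀ (norm_nonneg _) (norm_nonneg _)]
  refine (Coeff.hasSum_norm_sq _).unique ((Coeff.hasSum_norm_sq (c - d)).congr_fun fun m => ?_)
  rw [lp.coeFn_sub, lp.coeFn_sub, Pi.sub_apply, Pi.sub_apply, parity_apply, parity_apply, ← mul_sub,
    norm_mul, norm_pow, norm_neg, norm_one, one_pow, one_mul]

theorem nonlin_parity (n : ℕ) (c : Coeff) : nonlin (parity n c) = parity n (nonlin c) := by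
  refine ext_inner_left ℂ fun d => ?_
  rw [← parity_parity n d, inner_nonlin]
  rw [inner_eq_of_sign (ε := fun s => s) (prodMap_parity n (parity n d) c)
    (prodMap_parity n c c), inner_eq_of_sign (ε := fun s => n + s) (parity_apply n (parity n d))
    (parity_apply n (nonlin c)), inner_nonlin]


/-! ### The linearized dynamics of a pair of opposite modes -/

/-- The quadratic form used to detect the growth of a pair of opposite modes `x`, `y` near the
mode `z`. -/
def pairForm (A B : ℝ) (x y z : ℂ) : ℝ :=
  A * (‖x‖ ^ 2 + ‖y‖ ^ 2) + B * (conj (x * y) * z ^ 2).re + (conj (x * y) * z ^ 2).im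

/-- The differential of `pairForm`. -/
def pairFormDeriv (A B : ℝ) (x y z x' y' z' : ℂ) : ℝ :=
  A * (2 * (conj x * x' + conj y * y').re) +
    B * (conj (x' * y + x * y') * z ^ 2 + 2 * conj (x * y) * z * z').re +
    (conj (x' * y + x * y') * z ^ 2 + 2 * conj (x * y) * z * z').im

theorem hasDerivAt_norm_sq_complex {x : ℝ → ℂ} {x' : ℂ} {t : ℝ} (hx : HasDerivAt x x' t) :
    HasDerivAt (fun t => ‖x t‖ ^ 2) (2 * (conj (x t) * x').re) t := by
  have h := hx.norm_sq
  convert! h using 1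
  rw [Complex.inner, mul_comm x']

theorem hasDerivAt_pairForm (A B : ℝ) {x y z : ℝ → ℂ} {x' y' z' : ℂ} {t : ℝ}
    (hx : HasDerivAt x x' t) (hy : HasDerivAt y y' t) (hz : HasDerivAt z z' t) :
    HasDerivAt (fun t => pairForm A B (x t) (y t) (z t))
      (pairFormDeriv A B (x t) (y t) (z t) x' y' z') t := by
  have hN : HasDerivAt (fun t => conj (x t * y t) * z t ^ 2)
      (conj (x' * y t + x t * y') * z t ^ 2 + 2 * conj (x t * y t) * z t * z') t := by
    have h1 := (hx.mul hy).star
    have h2 := hz.pow 2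
    convert! h1.mul h2 using 1
    simp only [Complex.star_def]
    push_cast
    simp
    ring
  have hre : HasDerivAt (fun t => (conj (x t * y t) * z t ^ 2).re) _ t :=
    Complex.reCLM.hasFDerivAt.comp_hasDerivAt t hN
  have him : HasDerivAt (fun t => (conj (x t * y t) * z t ^ 2).im) _ t :=
    Complex.imCLM.hasFDerivAt.comp_hasDerivAt t hN
  have h := (((hasDerivAt_norm_sq_complex hx).add (hasDerivAt_norm_sq_complex hy)).const_mul A).add
    (hre.const_mul B) |>.add him
  convert! h using 1
  rw [pairFormDeriv, Complex.add_re (conj (x t) * x')]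
  simp only [Complex.reCLM_apply, Complex.imCLM_apply]
  ring

theorem pairFormDeriv_smul (A B l : ℝ) (x y z x' y' z' : ℂ) :
    pairFormDeriv A B x y z (l * x') (l * y') (l * z') = l * pairFormDeriv A B x y z x' y' z' := by
  rw [pairFormDeriv, pairFormDeriv]
  have h1 : conj x * (l * x') + conj y * (l * y') = l * (conj x * x' + conj y * y') := by ring
  have h2 : conj (l * x' * y + x * (l * y')) * z ^ 2 + 2 * conj (x * y) * z * (l * z') =
      l * (conj (x' * y + x * y') * z ^ 2 + 2 * conj (x * y) * z * z') := by
    simp only [map_add, map_mul, Complex.conj_ofReal]; ring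
  rw [h1, h2, Complex.re_ofReal_mul, Complex.re_ofReal_mul, Complex.im_ofReal_mul]
  ring

section Algebra

variable {a b g r : ℝ} {x y z Ex Ey Ez : ℂ}

/-- The diagonal terms only rotate `x` and `y` and drop out; the moduli change through the coupling
`r` and the errors alone. -/
theorem re_pair_deriv (a b r : ℝ) (x y z Ex Ey : ℂ) :
    2 * (conj x * (-Complex.I * (2 * ‖z‖ ^ 2 * a * x + z ^ 2 * r * conj y + Ex)) +
      conj y * (-Complex.I * (2 * ‖z‖ ^ 2 * b * y + z ^ 2 * r * conj x + Ey))).re =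
    4 * r * (conj (x * y) * z ^ 2).im + 2 * (-Complex.I * (conj x * Ex + conj y * Ey)).re := by
  have e : conj x * (-Complex.I * (2 * ‖z‖ ^ 2 * a * x + z ^ 2 * r * conj y + Ex)) +
      conj y * (-Complex.I * (2 * ‖z‖ ^ 2 * b * y + z ^ 2 * r * conj x + Ey)) =
      ((2 * ‖z‖ ^ 2 * a * ‖x‖ ^ 2 + 2 * ‖z‖ ^ 2 * b * ‖y‖ ^ 2 : ℝ) : ℂ) * (-Complex.I) +
      ((2 * r : ℝ) : ℂ) * (-Complex.I * (conj (x * y) * z ^ 2)) +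
      (-Complex.I * (conj x * Ex + conj y * Ey)) := by
    push_cast
    rw [← Complex.conj_mul' x, ← Complex.conj_mul' y, map_mul]
    ring
  rw [e, Complex.add_re, Complex.add_re, Complex.re_ofReal_mul, Complex.re_ofReal_mul]
  simp only [neg_mul, Complex.neg_re, Complex.I_re, Complex.I_mul_re, neg_zero, mul_zero]
  ring

theorem pair_deriv (a b g r : ℝ) (x y z Ex Ey Ez : ℂ) :
    conj (-Complex.I * (2 * ‖z‖ ^ 2 * a * x + z ^ 2 * r * conj y + Ex) * y +
      x * (-Complex.I * (2 * ‖z‖ ^ 2 * b * y + z ^ 2 * r * conj x + Ey))) * z ^ 2 +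
      2 * conj (x * y) * z * (-Complex.I * (‖z‖ ^ 2 * g * z + Ez)) =
    Complex.I * (((2 * (a + b - g) * ‖z‖ ^ 2 : ℝ) : ℂ) * (conj (x * y) * z ^ 2) +
      ((r * ‖z‖ ^ 4 * (‖x‖ ^ 2 + ‖y‖ ^ 2) : ℝ) : ℂ)) +
      (Complex.I * (conj (Ex * y + x * Ey) * z ^ 2) - Complex.I * (2 * conj (x * y) * z * Ez)) := by
  simp only [map_add, map_mul, map_neg, Complex.conj_I, Complex.conj_ofReal, map_pow, map_ofNat,
    Complex.conj_conj]
  push_cast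
  rw [show (‖z‖ : ℂ) ^ 4 = (‖z‖ ^ 2) ^ 2 by ring, ← Complex.conj_mul' x, ← Complex.conj_mul' y,
    ← Complex.conj_mul' z]
  ring

/-- Put `N = conj (x y) z²`, `S = ‖x‖² + ‖y‖²` and `s = 2 (a + b - g)`. To leading order `S' = 4 r
Im N` and `N' = I (s N + r S)`. The values of `A` and `B` are exactly those for which `V = A S + B
Re N + Im N` satisfies `V' = μ V + (4 r² - s² - μ²) / (4 r) S`. -/
theorem pairFormDeriv_estimate {μ ν : ℝ} (hμ : μ ≠ 0) (hr : r ≠ 0) (hr1 : |r| ≤ 1)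
    (hs : |2 * (a + b - g)| ≤ 6) (hν0 : 0 ≤ ν) (hν1 : ν ≤ 1) (hz : ‖z‖ ^ 2 = 1 - ν ^ 2)
    (hx : ‖x‖ ≤ ν) (hy : ‖y‖ ≤ ν) (hEx : ‖Ex‖ ≤ 4 * ν ^ 2) (hEy : ‖Ey‖ ≤ 4 * ν ^ 2)
    (hEz : ‖Ez‖ ≤ 4 * ν ^ 2) {A B : ℝ}
    (hA : A = ((2 * (a + b - g)) ^ 2 + μ ^ 2) / (4 * r * μ)) (hB : B = 2 * (a + b - g) / μ) :
    |pairFormDeriv A B x y z (-Complex.I * (2 * ‖z‖ ^ 2 * a * x + z ^ 2 * r * conj y + Ex))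
        (-Complex.I * (2 * ‖z‖ ^ 2 * b * y + z ^ 2 * r * conj x + Ey))
        (-Complex.I * (‖z‖ ^ 2 * g * z + Ez)) - μ * pairForm A B x y z -
      (4 * r ^ 2 - (2 * (a + b - g)) ^ 2 - μ ^ 2) / (4 * r) * (‖x‖ ^ 2 + ‖y‖ ^ 2)| ≤
      (16 * |A| + 26 * |B| + 26) * ν ^ 3 := by
  rw [pairFormDeriv, pairForm, re_pair_deriv, pair_deriv]
  set s := 2 * (a + b - g) with hsdef
  set N := conj (x * y) * z ^ 2 with hN
  set S := ‖x‖ ^ 2 + ‖y‖ ^ 2 with hS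
  set ρ := ‖z‖ ^ 2 with hρ
  have hz1 : ‖z‖ ≤ 1 := by
    have := norm_nonneg z
    nlinarith [sq_nonneg ν]
  have hSn : S ≤ 2 * ν ^ 2 := by
    have h1 : ‖x‖ ^ 2 ≤ ν ^ 2 := by gcongr
    have h2 : ‖y‖ ^ 2 ≤ ν ^ 2 := by gcongr
    linarith
  have hS0 : 0 ≤ S := by positivity
  have hNn : ‖N‖ ≤ ν ^ 2 := by
    rw [hN, norm_mul, RCLike.norm_conj, norm_mul, norm_pow]
    calc ‖x‖ * ‖y‖ * ‖z‖ ^ 2 ≤ ν * ν * 1 ^ 2 := by gcongr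
      _ = ν ^ 2 := by ring
  set F := -Complex.I * (conj x * Ex + conj y * Ey) with hF
  have hFn : ‖F‖ ≤ 8 * ν ^ 3 := by
    rw [hF, norm_mul, norm_neg, Complex.norm_I, one_mul]
    refine (norm_add_le _ _).trans ?_
    rw [norm_mul, norm_mul, RCLike.norm_conj, RCLike.norm_conj]
    calc _ ≤ ν * (4 * ν ^ 2) + ν * (4 * ν ^ 2) := by gcongr
      _ = 8 * ν ^ 3 := by ring
  set G := Complex.I * (conj (Ex * y + x * Ey) * z ^ 2) - Complex.I * (2 * conj (x * y) * z * Ez)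
    with hG
  have hν32 : ν ^ 4 ≤ ν ^ 3 := pow_le_pow_of_le_one hν0 hν1 (by norm_num)
  have hGn : ‖G‖ ≤ 16 * ν ^ 3 := by
    rw [hG]
    refine (norm_sub_le _ _).trans ?_
    simp only [norm_mul, norm_pow, Complex.norm_I, one_mul, RCLike.norm_conj, Complex.norm_ofNat]
    have h1 : ‖Ex * y + x * Ey‖ ≤ 8 * ν ^ 3 := by
      refine (norm_add_le _ _).trans ?_
      rw [norm_mul, norm_mul]
      calc _ ≤ (4 * ν ^ 2) * ν + ν * (4 * ν ^ 2) := by gcongr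
        _ = 8 * ν ^ 3 := by ring
    calc _ ≤ (8 * ν ^ 3) * 1 ^ 2 + 2 * (ν * ν) * 1 * (4 * ν ^ 2) := by gcongr
      _ = 8 * ν ^ 3 + 8 * ν ^ 4 := by ring
      _ ≤ 16 * ν ^ 3 := by linarith
  -- Besides `G`, this collects the cost of replacing `‖z‖` by one, hence `26 = 16 + 6 + 4`.
  set H : ℂ := Complex.I * (((s * ρ : ℝ) : ℂ) * N + ((r * ‖z‖ ^ 4 * S : ℝ) : ℂ)) + G -
    Complex.I * ((s : ℂ) * N + ((r * S : ℝ) : ℂ)) with hH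
  have hHn : ‖H‖ ≤ 26 * ν ^ 3 := by
    have e : H = G + Complex.I * (((s * (ρ - 1) : ℝ) : ℂ) * N +
        ((r * (‖z‖ ^ 4 - 1) * S : ℝ) : ℂ)) := by
      rw [hH]; push_cast; ring
    have h4 : ‖z‖ ^ 4 - 1 = -(2 * ν ^ 2) + ν ^ 4 := by
      rw [show ‖z‖ ^ 4 = ρ ^ 2 by rw [hρ]; ring, hz]; ring
    have h5 : |‖z‖ ^ 4 - 1| ≤ 2 * ν ^ 2 := by
      rw [h4, abs_le]
      have : ν ^ 4 ≤ ν ^ 2 := pow_le_pow_of_le_one hν0 hν1 (by norm_num)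
      constructor <;> linarith [sq_nonneg ν, pow_nonneg hν0 4]
    have h6 : |ρ - 1| ≤ ν ^ 2 := by
      rw [hz, sub_sub_cancel_left, abs_neg, abs_of_nonneg (sq_nonneg ν)]
    rw [e]
    refine (norm_add_le _ _).trans ?_
    rw [norm_mul, Complex.norm_I, one_mul]
    have h7 := norm_add_le (((s * (ρ - 1) : ℝ) : ℂ) * N) ((r * (‖z‖ ^ 4 - 1) * S : ℝ) : ℂ)
    rw [norm_mul, Complex.norm_real, Complex.norm_real, Real.norm_eq_abs, Real.norm_eq_abs,
      abs_mul s (ρ - 1), abs_mul (r * (‖z‖ ^ 4 - 1)) S, abs_mul r (‖z‖ ^ 4 - 1),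
      abs_of_nonneg hS0] at h7
    have h8 : |s| * |ρ - 1| * ‖N‖ ≤ 6 * ν ^ 2 * ν ^ 2 := by gcongr
    have h9 : |r| * |‖z‖ ^ 4 - 1| * S ≤ 1 * (2 * ν ^ 2) * (2 * ν ^ 2) := by gcongr
    linarith
  have e1 : Complex.I * (((s * ρ : ℝ) : ℂ) * N + ((r * ‖z‖ ^ 4 * S : ℝ) : ℂ)) + G =
      Complex.I * ((s : ℂ) * N + ((r * S : ℝ) : ℂ)) + H := by rw [hH]; ring
  have e2 : (Complex.I * ((s : ℂ) * N + ((r * S : ℝ) : ℂ))).re = -(s * N.im) := by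
    rw [Complex.I_mul_re, Complex.add_im, Complex.im_ofReal_mul, Complex.ofReal_im, add_zero]
  have e3 : (Complex.I * ((s : ℂ) * N + ((r * S : ℝ) : ℂ))).im = s * N.re + r * S := by
    rw [Complex.I_mul_im, Complex.add_re, Complex.re_ofReal_mul, Complex.ofReal_re]
  rw [e1, Complex.add_re, Complex.add_im, e2, e3]
  have e4 : A * (4 * r * N.im + 2 * F.re) + B * (-(s * N.im) + H.re) + (s * N.re + r * S + H.im) -
      μ * (A * S + B * N.re + N.im) - (4 * r ^ 2 - s ^ 2 - μ ^ 2) / (4 * r) * S =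
      A * (2 * F.re) + B * H.re + H.im := by
    rw [hA, hB]
    field_simp
    ring
  rw [e4]
  refine (abs_add_three _ _ _).trans ?_
  rw [abs_mul, abs_mul, abs_mul, abs_two]
  have h1 := (Complex.abs_re_le_norm F).trans hFn
  have h2 := (Complex.abs_re_le_norm H).trans hHn
  have h3 := (Complex.abs_im_le_norm H).trans hHn
  calc _ ≤ |A| * (2 * (8 * ν ^ 3)) + |B| * (26 * ν ^ 3) + 26 * ν ^ 3 := by gcongr
    _ = _ := by ring

theorem abs_pairForm_le {ν A B : ℝ} (hz : ‖z‖ ≤ 1) (hx : ‖x‖ ≤ ν) (hy : ‖y‖ ≤ ν) :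
    |pairForm A B x y z| ≤ (2 * |A| + |B| + 1) * ν ^ 2 := by
  have hν0 : 0 ≤ ν := (norm_nonneg _).trans hx
  have hN : ‖conj (x * y) * z ^ 2‖ ≤ ν ^ 2 := by
    rw [norm_mul, RCLike.norm_conj, norm_mul, norm_pow]
    calc ‖x‖ * ‖y‖ * ‖z‖ ^ 2 ≤ ν * ν * 1 ^ 2 := by gcongr
      _ = ν ^ 2 := by ring
  have h1 := (Complex.abs_re_le_norm _).trans hN
  have h2 := (Complex.abs_im_le_norm _).trans hN
  rw [pairForm]
  refine (abs_add_three _ _ _).trans ?_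
  rw [abs_mul, abs_mul, abs_of_nonneg (by positivity : 0 ≤ ‖x‖ ^ 2 + ‖y‖ ^ 2)]
  calc _ ≤ |A| * (ν ^ 2 + ν ^ 2) + |B| * ν ^ 2 + ν ^ 2 := by gcongr
    _ = _ := by ring

end Algebra

/-! ### The linearization at `hermite n` -/

/-- Expansion of the cubic term around `z • hermite n`, tested against `p`. The terms of order at
least two in `w` contribute `1 + 2 + 1 = 4`. -/
theorem norm_inner_prodMap_sub_le (n : ℕ) (p w : Coeff) (z : ℂ) (hz : ‖z‖ ≤ 1) (hw : ‖w‖ ≤ 1) :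
    ‖(inner ℂ (prodMap p (z • hermite n + w))
        (prodMap (z • hermite n + w) (z • hermite n + w)) : ℂ) -
      (conj z * z ^ 2 * inner ℂ (prodMap p (hermite n)) (prodMap (hermite n) (hermite n)) +
        2 * (conj z * z) * inner ℂ (prodMap p (hermite n)) (prodMap (hermite n) w) +
        z ^ 2 * inner ℂ (prodMap p w) (prodMap (hermite n) (hermite n)))‖ ≤
      4 * ‖p‖ * ‖w‖ ^ 2 := by
  have hb : ∀ c d e f : Coeff, ‖(inner ℂ (prodMap c d) (prodMap e f) : ℂ)‖ ≤
      ‖c‖ * ‖d‖ * (‖e‖ * ‖f‖) := fun c d e f =>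
    (norm_inner_le_norm _ _).trans (mul_le_mul (norm_prodMap_le _ _) (norm_prodMap_le _ _)
      (norm_nonneg _) (by positivity))
  have e : (inner ℂ (prodMap p (z • hermite n + w))
        (prodMap (z • hermite n + w) (z • hermite n + w)) : ℂ) -
      (conj z * z ^ 2 * inner ℂ (prodMap p (hermite n)) (prodMap (hermite n) (hermite n)) +
        2 * (conj z * z) * inner ℂ (prodMap p (hermite n)) (prodMap (hermite n) w) +
        z ^ 2 * inner ℂ (prodMap p w) (prodMap (hermite n) (hermite n))) =
      conj z * inner ℂ (prodMap p (hermite n)) (prodMap w w) +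
      2 * z * inner ℂ (prodMap p w) (prodMap (hermite n) w) +
      inner ℂ (prodMap p w) (prodMap w w) := by
    simp only [map_add, map_smul, add_apply, smul_apply, prodMap_comm w (hermite n),
      inner_add_left, inner_add_right, inner_smul_left, inner_smul_right, smul_add]
    ring
  rw [e]
  refine (norm_add₃_le).trans ?_
  simp only [norm_mul, RCLike.norm_conj, Complex.norm_ofNat]
  have h1 := hb p (hermite n) w w
  have h2 := hb p w (hermite n) w
  have h3 := hb p w w w
  rw [norm_hermite] at h1 h2
  calc _ ≤ 1 * (‖p‖ * 1 * (‖w‖ * ‖w‖)) + 2 * 1 * (‖p‖ * ‖w‖ * (1 * ‖w‖)) +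
        ‖p‖ * ‖w‖ * (1 * ‖w‖) := by
        gcongr
        refine h3.trans ?_
        gcongr
    _ = 4 * ‖p‖ * ‖w‖ ^ 2 := by ring

theorem inner_prodMap_hermite (j n : ℕ) (x : Coeff) :
    inner ℂ (prodMap (hermite j) (hermite n)) x = tau j n * x (j + n) := by
  rw [prodMap_hermite_hermite, inner_smul_left, inner_hermite, Complex.conj_ofReal]

theorem nonlin_apply (c : Coeff) (j : ℕ) : (2 * Real.pi : ℂ) * nonlin c j =
    inner ℂ (prodMap (hermite j) c) (prodMap c c) := by
  rw [← inner_hermite, inner_nonlin]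
  field_simp

/-- The linearization at `hermite n`, in the direction of the mode `n` itself. -/
theorem norm_nonlin_apply_self_sub_le {n : ℕ} {w : Coeff} {z : ℂ} (hz : ‖z‖ ≤ 1) (hw : ‖w‖ ≤ 1)
    (hwn : w n = 0) :
    ‖(2 * Real.pi : ℂ) * nonlin (z • hermite n + w) n - ‖z‖ ^ 2 * (tau n n ^ 2 : ℝ) * z‖ ≤
      4 * ‖w‖ ^ 2 := by
  have h := norm_inner_prodMap_sub_le n (hermite n) w z hz hw
  have h1 : (inner ℂ (prodMap (hermite n) w) (prodMap (hermite n) (hermite n)) : ℂ) = 0 := by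
    rw [← inner_conj_symm, inner_prodMap_hermite, prodMap_hermite_apply, if_pos (by omega),
      Nat.add_sub_cancel, hwn]
    simp
  rw [norm_hermite, mul_one, h1, ← nonlin_apply, inner_prodMap_hermite, inner_prodMap_hermite,
    prodMap_hermite_apply, prodMap_hermite_apply, if_pos (by omega), if_pos (by omega),
    Nat.add_sub_cancel, hwn, hermite_self] at h
  refine le_of_eq_of_le ?_ h
  congr 2
  rw [← Complex.conj_mul' z]
  push_cast
  ring

/-- The linearization at `hermite n`, in the direction of the other modes. -/
theorem norm_nonlin_apply_sub_le {n j m : ℕ} (hjm : j + m = 2 * n) (hj : j ≠ n) {w : Coeff} {z : ℂ}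
    (hz : ‖z‖ ≤ 1) (hw : ‖w‖ ≤ 1) :
    ‖(2 * Real.pi : ℂ) * nonlin (z • hermite n + w) j - (2 * ‖z‖ ^ 2 * (tau j n ^ 2 : ℝ) * w j +
        z ^ 2 * (tau n n * tau j m : ℝ) * conj (w m))‖ ≤ 4 * ‖w‖ ^ 2 := by
  have h := norm_inner_prodMap_sub_le n (hermite j) w z hz hw
  have h1 : (inner ℂ (prodMap (hermite j) w) (prodMap (hermite n) (hermite n)) : ℂ) =
      tau n n * (tau j m * conj (w m)) := by
    rw [← inner_conj_symm, inner_prodMap_hermite, prodMap_hermite_apply, if_pos (by omega),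
      show n + n - j = m by omega, map_mul, map_mul, Complex.conj_ofReal, Complex.conj_ofReal]
  have h2 : (prodMap (hermite n) (hermite n)) (j + n) = 0 := by
    rw [prodMap_hermite_apply, if_pos (by omega), Nat.add_sub_cancel, hermite_ne hj, mul_zero]
  rw [norm_hermite, mul_one, h1, ← nonlin_apply, inner_prodMap_hermite, inner_prodMap_hermite,
    h2, prodMap_hermite_apply, if_pos (by omega), Nat.add_sub_cancel, tau_comm n j] at h
  refine le_of_eq_of_le ?_ h
  congr 2
  rw [← Complex.conj_mul' z]
  push_cast
  ring

/-- The linearization at `hermite n` conserves the mass of the high modes. -/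
theorem abs_inner_tail_nonlin_le {n : ℕ} {w : Coeff} {z : ℂ} (hz : ‖z‖ ≤ 1) (hw : ‖w‖ ≤ 1) :
    |2 * Real.pi * (inner ℂ (tail (2 * n + 1) w) (nonlin (z • hermite n + w)) : ℂ).im| ≤
      4 * ‖w‖ ^ 3 := by
  set p := tail (2 * n + 1) w with hp
  have h := norm_inner_prodMap_sub_le n p w z hz hw
  have hp0 : ∀ j, j ≤ 2 * n → p j = 0 := fun j hj => by rw [hp, tail_apply, if_pos (by omega)]
  have h1 : (inner ℂ (prodMap p (hermite n)) (prodMap (hermite n) (hermite n)) : ℂ) = 0 := by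
    rw [← inner_conj_symm, inner_prodMap_hermite, prodMap_comm, prodMap_hermite_apply,
      if_pos (by omega), Nat.add_sub_cancel, hp0 n (by omega)]
    simp
  -- Modes beyond `2 n` have no partner symmetric about `n`, so they are not coupled. Their diagonal
  -- term is real, and only quadratic errors in `w` can change their mass.
  have h2 : (inner ℂ (prodMap p w) (prodMap (hermite n) (hermite n)) : ℂ) = 0 := by
    rw [← inner_conj_symm, inner_prodMap_hermite, prodMap_apply, Finset.sum_eq_zero, mul_zero,
      map_zero]
    intro q hq
    have hq := Finset.HasAntidiagonal.mem_antidiagonal.1 hq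
    rw [hp0 q.1 (by omega), zero_mul, mul_zero]
  have h3 : (inner ℂ (prodMap p (hermite n)) (prodMap (hermite n) w) : ℂ) =
      ((‖prodMap (hermite n) p‖ ^ 2 : ℝ) : ℂ) := by
    have hself : ((‖prodMap (hermite n) p‖ ^ 2 : ℝ) : ℂ) =
        inner ℂ (prodMap (hermite n) p) (prodMap (hermite n) p) := by
      rw [inner_self_eq_norm_sq_to_K]; push_cast; rfl
    rw [prodMap_comm p (hermite n), hself]
    refine (Coeff.hasSum_inner _ _).unique ((Coeff.hasSum_inner _ _).congr_fun fun s => ?_)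
    rw [prodMap_hermite_apply, prodMap_hermite_apply]
    split_ifs with hs
    · by_cases hs' : s - n ≤ 2 * n
      · rw [hp0 _ hs']; simp
      · rw [hp, tail_apply, if_neg (by omega)]
    · simp
  have h4 : (inner ℂ (prodMap p (z • hermite n + w))
      (prodMap (z • hermite n + w) (z • hermite n + w)) : ℂ) =
      (2 * Real.pi : ℝ) * inner ℂ p (nonlin (z • hermite n + w)) := by
    rw [inner_nonlin]; push_cast; field_simp
  rw [h1, h2, h3, h4, mul_zero, mul_zero, zero_add, add_zero, Complex.conj_mul'] at h
  have h5 := (Complex.abs_im_le_norm _).trans h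
  have h6 : ((2 * (‖z‖ : ℂ) ^ 2 * ((‖prodMap (hermite n) p‖ ^ 2 : ℝ) : ℂ)) : ℂ).im = 0 := by
    have : (2 * (‖z‖ : ℂ) ^ 2 * ((‖prodMap (hermite n) p‖ ^ 2 : ℝ) : ℂ)) =
        ((2 * ‖z‖ ^ 2 * ‖prodMap (hermite n) p‖ ^ 2 : ℝ) : ℂ) := by push_cast; rfl
    rw [this, Complex.ofReal_im]
  rw [Complex.sub_im, h6, sub_zero, Complex.im_ofReal_mul] at h5
  refine h5.trans ?_
  have h7 : ‖p‖ ≤ ‖w‖ := by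
    refine (abs_le_of_sq_le_sq' ?_ (norm_nonneg _)).2
    rw [hp, norm_tail_sq]
    linarith [low_nonneg (2 * n + 1) w]
  calc 4 * ‖p‖ * ‖w‖ ^ 2 ≤ 4 * ‖w‖ * ‖w‖ ^ 2 := by gcongr
    _ = 4 * ‖w‖ ^ 3 := by ring


/-! ### The growing mode -/

/-- The detuning of the modes `n + k + 1` and `n - k - 1` near `hermite n`. -/
def detuning (n k : ℕ) : ℝ :=
  2 * (tau (n + k + 1) n ^ 2 + tau (n - (k + 1)) n ^ 2 - tau n n ^ 2)

/-- The coupling of the modes `n + k + 1` and `n - k - 1` near `hermite n`. -/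
def coupling (n k : ℕ) : ℝ := tau n n * tau (n + k + 1) (n - (k + 1))

theorem tau_sq_le_one (k l : ℕ) : tau k l ^ 2 ≤ 1 := by
  rw [tau_sq, div_le_one (by positivity)]
  exact_mod_cast Nat.choose_le_two_pow (k + l) k

theorem tau_le_one (k l : ℕ) : tau k l ≤ 1 := by
  have := tau_sq_le_one k l
  exact (sq_le_one_iff₀ (tau_nonneg k l)).1 this

theorem coupling_pos (n k : ℕ) : 0 < coupling n k := mul_pos (tau_pos _ _) (tau_pos _ _)

theorem abs_coupling_le (n k : ℕ) : |coupling n k| ≤ 1 := by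
  rw [abs_of_pos (coupling_pos n k)]
  exact mul_le_one₀ (tau_le_one _ _) (tau_nonneg _ _) (tau_le_one _ _)

theorem abs_detuning_le (n k : ℕ) : |detuning n k| ≤ 6 := by
  have h1 := tau_sq_le_one (n + k + 1) n
  have h2 := tau_sq_le_one (n - (k + 1)) n
  have h3 := tau_sq_le_one n n
  rw [detuning, abs_le]
  constructor <;>
    linarith [sq_nonneg (tau (n + k + 1) n), sq_nonneg (tau (n - (k + 1)) n), sq_nonneg (tau n n)]

theorem tau_sq_eq (k l : ℕ) : tau k l ^ 2 =
    ((k + l).factorial : ℝ) / (k.factorial * l.factorial) / 2 ^ (k + l) := by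
  rw [tau_sq, Nat.cast_add_choose]

/-- The modes `n + 2` and `n - 2` are linearly unstable near `hermite n`. -/
theorem detuning_sq_lt {n : ℕ} (hn : 2 ≤ n) : detuning n 1 ^ 2 < 4 * coupling n 1 ^ 2 := by
  obtain ⟨m, rfl⟩ := Nat.exists_eq_add_of_le' hn
  set g := tau (m + 2) (m + 2) ^ 2 with hg
  have hg0 : 0 < g := pow_pos (tau_pos _ _) 2
  have hf : (m.factorial : ℝ) ≠ 0 := by positivity
  have hf2 : ((2 * m + 2).factorial : ℝ) ≠ 0 := by positivity
  -- All the coefficients involved are rational multiples of `g`, with `n = m + 2`, so that the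
  -- claim becomes a polynomial inequality in `m`.
  have hgf : g = (2 * m + 4) * (2 * m + 3) * ((2 * m + 2).factorial : ℝ) /
      (((m + 2) * (m + 1) * m.factorial) ^ 2) / (2 ^ 4 * (2 ^ m) ^ 2) := by
    rw [hg, tau_sq_eq, show m + 2 + (m + 2) = 2 * m + 2 + 1 + 1 by ring,
      Nat.factorial_succ (2 * m + 2 + 1), Nat.factorial_succ (2 * m + 2), Nat.factorial_succ (m + 1),
      Nat.factorial_succ m]
    push_cast
    rw [show (2 : ℝ) ^ (2 * m + 2 + 1 + 1) = 2 ^ 4 * (2 ^ m) ^ 2 by ring]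
    congr 2 <;> ring
  have ha : tau (m + 2 + 1 + 1) (m + 2) ^ 2 = g * ((2 * m + 5) / (2 * (m + 4))) := by
    rw [hgf, tau_sq_eq, show m + 2 + 1 + 1 + (m + 2) = 2 * m + 2 + 1 + 1 + 1 + 1 by ring,
      Nat.factorial_succ (2 * m + 2 + 1 + 1 + 1), Nat.factorial_succ (2 * m + 2 + 1 + 1),
      Nat.factorial_succ (2 * m + 2 + 1), Nat.factorial_succ (2 * m + 2),
      Nat.factorial_succ (m + 2 + 1), Nat.factorial_succ (m + 2), Nat.factorial_succ (m + 1),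
      Nat.factorial_succ m]
    push_cast
    rw [show (2 : ℝ) ^ (2 * m + 2 + 1 + 1 + 1 + 1) = 2 ^ 6 * (2 ^ m) ^ 2 by ring]
    field_simp
    ring
  have hb : tau (m + 2 - (1 + 1)) (m + 2) ^ 2 = g * (2 * (m + 1) / (2 * m + 3)) := by
    rw [hgf, tau_sq_eq, show m + 2 - (1 + 1) = m by omega,
      show m + (m + 2) = 2 * m + 2 by ring, Nat.factorial_succ (m + 1), Nat.factorial_succ m]
    push_cast
    rw [show (2 : ℝ) ^ (2 * m + 2) = 2 ^ 2 * (2 ^ m) ^ 2 by ring]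
    field_simp
    ring
  have hq : tau (m + 2 + 1 + 1) (m + 2 - (1 + 1)) ^ 2 =
      g * ((m + 2) * (m + 1) / ((m + 4) * (m + 3))) := by
    rw [hgf, tau_sq_eq, show m + 2 - (1 + 1) = m by omega,
      show m + 2 + 1 + 1 + m = 2 * m + 2 + 1 + 1 by ring,
      Nat.factorial_succ (2 * m + 2 + 1), Nat.factorial_succ (2 * m + 2),
      Nat.factorial_succ (m + 2 + 1), Nat.factorial_succ (m + 2), Nat.factorial_succ (m + 1),
      Nat.factorial_succ m]
    push_cast
    rw [show (2 : ℝ) ^ (2 * m + 2 + 1 + 1) = 2 ^ 4 * (2 ^ m) ^ 2 by ring]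
    field_simp
    ring
  have hm : (0 : ℝ) ≤ m := Nat.cast_nonneg m
  have hs : detuning (m + 2) 1 =
      g * ((4 * m ^ 2 + 14 * m + 7) / ((m + 4) * (2 * m + 3))) := by
    rw [detuning, ha, hb, ← hg]
    field_simp
    ring
  rw [hs, coupling, mul_pow (tau (m + 2) (m + 2)), hq, ← hg]
  have key : ((4 * m ^ 2 + 14 * m + 7) / ((m + 4) * (2 * m + 3)) : ℝ) ^ 2 <
      4 * ((m + 2) * (m + 1) / ((m + 4) * (m + 3))) := by
    rw [div_pow, ← mul_div_assoc, div_lt_div_iff₀ (by positivity) (by positivity)]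
    -- After clearing denominators the difference has positive coefficients only.
    have e : 4 * ((m + 2 : ℝ) * (m + 1)) * ((m + 4) * (2 * m + 3)) ^ 2 -
        (4 * m ^ 2 + 14 * m + 7) ^ 2 * ((m + 4) * (m + 3)) =
        (m + 4) * (8 * m ^ 3 + 100 * m ^ 2 + 251 * m + 141) := by ring
    have : 0 < (m + 4 : ℝ) * (8 * m ^ 3 + 100 * m ^ 2 + 251 * m + 141) := by positivity
    linarith
  calc _ = g ^ 2 * ((4 * m ^ 2 + 14 * m + 7) / ((m + 4) * (2 * m + 3)) : ℝ) ^ 2 := by ring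
    _ < g ^ 2 * (4 * ((m + 2) * (m + 1) / ((m + 4) * (m + 3)))) := by gcongr
    _ = _ := by ring

/-- The rate at which `modeForm` grows beyond the rate `μ`. -/
def excess (n k : ℕ) (μ : ℝ) : ℝ :=
  (4 * coupling n k ^ 2 - detuning n k ^ 2 - μ ^ 2) / (4 * coupling n k)

/-- Any `μ² < 4 coupling² - detuning²` for the unstable pair gives it a positive excess. The
finitely many `μ` at which some excess vanishes can be avoided. -/
theorem exists_rate {n : ℕ} (hn : 2 ≤ n) :
    ∃ μ > 0, (∀ k ∈ Finset.range n, excess n k μ ≠ 0) ∧ 0 < excess n 1 μ := by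
  set q : ℕ → ℝ := fun k => 4 * coupling n k ^ 2 - detuning n k ^ 2 with hq
  have h1 : 0 < q 1 := sub_pos.2 (detuning_sq_lt hn)
  obtain ⟨μ, hμ, hμ'⟩ := (Set.Ioo_infinite (Real.sqrt_pos.2 h1)).exists_notMem_finset
    ((Finset.range n).image fun k => √(q k))
  have hlt : ∀ x : ℝ, ∀ k, x ≠ 0 → x / (4 * coupling n k) ≠ 0 := fun x k hx =>
    div_ne_zero hx (by have := coupling_pos n k; positivity)
  refine ⟨μ, hμ.1, fun k hk => hlt _ _ fun h => hμ' ?_, div_pos ?_ ?_⟩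
  · refine Finset.mem_image.2 ⟨k, hk, ?_⟩
    rw [show q k = μ ^ 2 by rw [hq]; linarith, Real.sqrt_sq hμ.1.le]
  · exact sub_pos.2 ((Real.lt_sqrt hμ.1.le).1 hμ.2)
  · exact mul_pos four_pos (coupling_pos n 1)

/-- The form `pairForm` for the modes `n + k + 1` and `n - k - 1`. -/
def modeForm (n k : ℕ) (μ : ℝ) (c : Coeff) : ℝ :=
  pairForm ((detuning n k ^ 2 + μ ^ 2) / (4 * coupling n k * μ)) (detuning n k / μ)
    (c (n + k + 1)) (c (n - (k + 1))) (c n)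

/-- The part of `c` orthogonal to `hermite n`. -/
def offMode (n : ℕ) (c : Coeff) : Coeff := c - c n • hermite n

theorem offMode_apply_self (n : ℕ) (c : Coeff) : offMode n c n = 0 := by
  rw [offMode, lp.coeFn_sub, Pi.sub_apply, Coeff.smul_apply, hermite_self, mul_one, sub_self]

theorem offMode_apply {n j : ℕ} (h : j ≠ n) (c : Coeff) : offMode n c j = c j := by
  rw [offMode, lp.coeFn_sub, Pi.sub_apply, Coeff.smul_apply, hermite_ne h, mul_zero, sub_zero]

theorem smul_hermite_add_offMode (n : ℕ) (c : Coeff) : c n • hermite n + offMode n c = c := by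
  rw [offMode]; abel

theorem norm_offMode_sq (n : ℕ) (c : Coeff) : ‖offMode n c‖ ^ 2 = ‖c‖ ^ 2 - ‖c n‖ ^ 2 := by
  have h := norm_smul_hermite_add_sq (offMode_apply_self n c) (c n)
  rw [smul_hermite_add_offMode] at h
  linarith

theorem tail_offMode (n J : ℕ) (h : n < J) (c : Coeff) : tail J (offMode n c) = tail J c := by
  ext j
  rw [tail_apply, tail_apply]
  split_ifs with hj
  · rfl
  · exact offMode_apply (by omega) c

theorem Coeff.hasDerivAt_apply {c : ℝ → Coeff} {c' : Coeff} {t : ℝ} (h : HasDerivAt c c' t) (j : ℕ) :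
    HasDerivAt (fun t => c t j) (c' j) t := by
  have h1 := ((innerSL ℂ (hermite j)).restrictScalars ℝ).hasFDerivAt.comp_hasDerivAt t h
  convert! h1 using 1
  · ext t; simp [inner_hermite]
  · simp [inner_hermite]

/-- The indices up to `2 n` other than `n` come in pairs symmetric about `n`. -/
theorem norm_offMode_sq_eq_sum (n : ℕ) (c : Coeff) : ‖offMode n c‖ ^ 2 =
    ∑ k ∈ Finset.range n, (‖c (n + k + 1)‖ ^ 2 + ‖c (n - (k + 1))‖ ^ 2) +
      ‖tail (2 * n + 1) c‖ ^ 2 := by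
  rw [norm_offMode_sq, norm_tail_sq, low, show 2 * n + 1 = n + (n + 1) by ring,
    Finset.sum_range_add, Finset.sum_range_succ', Finset.sum_add_distrib,
    ← Finset.sum_range_reflect (fun j => ‖c j‖ ^ 2) n, add_zero]
  have h1 : ∑ j ∈ Finset.range n, ‖c (n - 1 - j)‖ ^ 2 =
      ∑ j ∈ Finset.range n, ‖c (n - (j + 1))‖ ^ 2 :=
    Finset.sum_congr rfl fun j _ => by rw [show n - 1 - j = n - (j + 1) by omega]
  rw [h1]
  simp only [← add_assoc]
  ring


/-- The constant bounding the nonlinear corrections to the growth of `modeForm`. -/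
def modeConst (n k : ℕ) (μ : ℝ) : ℝ :=
  16 * |(detuning n k ^ 2 + μ ^ 2) / (4 * coupling n k * μ)| + 26 * |detuning n k / μ| + 26

theorem modeConst_nonneg (n k : ℕ) (μ : ℝ) : 0 ≤ modeConst n k μ := by
  rw [modeConst]; positivity

section

variable {n k : ℕ} {μ : ℝ} {d : Coeff}

theorem norm_offMode_le_one (hd : ‖d‖ = 1) : ‖offMode n d‖ ≤ 1 := by
  refine (sq_le_one_iff₀ (norm_nonneg _)).1 ?_
  rw [norm_offMode_sq, hd]
  linarith [sq_nonneg ‖d n‖]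

theorem abs_modeForm_le (hd : ‖d‖ = 1) : |modeForm n k μ d| ≤ modeConst n k μ := by
  refine (abs_pairForm_le ((Coeff.norm_apply_le d n).trans hd.le)
    ((Coeff.norm_apply_le d _).trans hd.le) ((Coeff.norm_apply_le d _).trans hd.le)).trans ?_
  rw [modeConst, one_pow, mul_one]
  have h1 := abs_nonneg ((detuning n k ^ 2 + μ ^ 2) / (4 * coupling n k * μ))
  have h2 := abs_nonneg (detuning n k / μ)
  linarith

theorem Sol.exists_hasDerivAt_modeForm (hμ : μ ≠ 0) (hk : k < n) {c : ℝ → Coeff} (hc : Sol c)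
    {t : ℝ} (ht : ‖c t‖ = 1) : ∃ V' : ℝ, HasDerivAt (fun t => modeForm n k μ (c t)) V' t ∧
      |2 * Real.pi * V' - μ * modeForm n k μ (c t) -
        excess n k μ * (‖c t (n + k + 1)‖ ^ 2 + ‖c t (n - (k + 1))‖ ^ 2)| ≤
      modeConst n k μ * ‖offMode n (c t)‖ ^ 3 := by
  set w := offMode n (c t) with hw
  have hw1 : ‖w‖ ≤ 1 := norm_offMode_le_one ht
  have hz : ‖c t n‖ ≤ 1 := (Coeff.norm_apply_le _ n).trans ht.le
  have hzw : ‖c t n‖ ^ 2 = 1 - ‖w‖ ^ 2 := by rw [hw, norm_offMode_sq, ht]; ring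
  have hwx : w (n + k + 1) = c t (n + k + 1) := offMode_apply (by omega) _
  have hwy : w (n - (k + 1)) = c t (n - (k + 1)) := offMode_apply (by omega) _
  have hx := norm_nonlin_apply_sub_le (show n + k + 1 + (n - (k + 1)) = 2 * n by omega)
    (by omega) hz hw1
  have hy := norm_nonlin_apply_sub_le (show n - (k + 1) + (n + k + 1) = 2 * n by omega)
    (by omega) hz hw1
  have hn := norm_nonlin_apply_self_sub_le hz hw1 (offMode_apply_self n (c t))
  rw [hw, smul_hermite_add_offMode, ← hw] at hx hy hn
  rw [hwx, hwy] at hx hy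
  rw [tau_comm (n - (k + 1)) (n + k + 1)] at hy
  refine ⟨_, hasDerivAt_pairForm _ _ (Coeff.hasDerivAt_apply (hc t) _)
    (Coeff.hasDerivAt_apply (hc t) _) (Coeff.hasDerivAt_apply (hc t) _), ?_⟩
  have h := pairFormDeriv_estimate (a := tau (n + k + 1) n ^ 2) (b := tau (n - (k + 1)) n ^ 2)
    (g := tau n n ^ 2) (r := coupling n k) (x := c t (n + k + 1)) (y := c t (n - (k + 1)))
    (z := c t n) hμ (coupling_pos n k).ne' (abs_coupling_le n k) (abs_detuning_le n k)
    (norm_nonneg w) hw1 hzw (hwx ▸ Coeff.norm_apply_le w _) (hwy ▸ Coeff.norm_apply_le w _)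
    hx hy hn rfl rfl
  rw [← pairFormDeriv_smul]
  refine le_of_eq_of_le ?_ h
  rw [modeForm, excess, detuning]
  congr 4
  all_goals
    rw [Coeff.smul_apply]
    simp only [coupling]
    push_cast
    ring

/-- The high modes grow slowly. -/
theorem Sol.exists_hasDerivAt_tail {c : ℝ → Coeff} (hc : Sol c) {t : ℝ} (ht : ‖c t‖ = 1) :
    ∃ V' : ℝ, HasDerivAt (fun t => ‖tail (2 * n + 1) (c t)‖ ^ 2) V' t ∧
      |2 * Real.pi * V'| ≤ 8 * ‖offMode n (c t)‖ ^ 3 := by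
  have h := abs_inner_tail_nonlin_le (n := n) (w := offMode n (c t)) (z := c t n)
    ((Coeff.norm_apply_le _ n).trans ht.le) (norm_offMode_le_one ht)
  rw [tail_offMode _ _ (by omega), smul_hermite_add_offMode] at h
  refine ⟨2 * (inner ℂ (tail (2 * n + 1) (c t)) (nonlin (c t)) : ℂ).im, ?_, ?_⟩
  · have h1 : ∀ t, ‖tail (2 * n + 1) (c t)‖ ^ 2 =
        ‖c 0‖ ^ 2 - ∑ j ∈ Finset.range (2 * n + 1), ‖c t j‖ ^ 2 := fun t => by
      rw [norm_tail_sq, hc.norm_eq, low]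
    simp_rw [h1]
    have h2 := (HasDerivAt.fun_sum (u := Finset.range (2 * n + 1)) fun j _ =>
      hasDerivAt_norm_sq_complex (Coeff.hasDerivAt_apply (hc t) j)).const_sub (‖c 0‖ ^ 2)
    convert! h2 using 1
    have h3 : (inner ℂ (tail (2 * n + 1) (c t)) (nonlin (c t)) : ℂ) = inner ℂ (c t) (nonlin (c t)) -
        ∑ j ∈ Finset.range (2 * n + 1), conj (c t j) * nonlin (c t) j := by
      rw [tail, inner_sub_left, sum_inner]
      simp only [inner_smul_left, inner_hermite]
    rw [h3, inner_nonlin_self, Complex.sub_im, Complex.ofReal_im, Complex.im_sum, zero_sub,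
      mul_neg, Finset.mul_sum]
    congr 1
    refine Finset.sum_congr rfl fun j _ => ?_
    rw [Coeff.smul_apply, mul_left_comm, neg_mul, Complex.neg_re, Complex.I_mul_re, neg_neg]
  · rw [mul_left_comm, abs_mul, abs_two]
    linarith

/-- A quantity which grows along solutions close to `hermite n`. -/
def growthForm (n : ℕ) (μ : ℝ) (c : Coeff) : ℝ :=
  ∑ k ∈ Finset.range n, excess n k μ * modeForm n k μ c - ‖tail (2 * n + 1) c‖ ^ 2

theorem exists_abs_growthForm_le (n : ℕ) (μ : ℝ) :
    ∃ K : ℝ, ∀ d : Coeff, ‖d‖ = 1 → |growthForm n μ d| ≤ K := by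
  refine ⟨∑ k ∈ Finset.range n, |excess n k μ| * modeConst n k μ + 1, fun d hd => ?_⟩
  refine (abs_sub _ _).trans (add_le_add ((Finset.abs_sum_le_sum_abs _ _).trans
    (Finset.sum_le_sum fun k hk => ?_)) ?_)
  · rw [abs_mul]
    gcongr
    exact abs_modeForm_le hd
  · rw [abs_of_nonneg (sq_nonneg _), norm_tail_sq, hd]
    linarith [low_nonneg (2 * n + 1) d]

/-- Weighting each pair by its excess makes its surplus the excess squared, which is positive
whether or not the pair is unstable. The minus sign of the tail turns `-μ` times it into a further
gain. Together these control `‖offMode‖²` and beat the cubic errors for small `‖offMode‖`. -/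
theorem exists_growth {n : ℕ} {μ : ℝ} (hμ : 0 < μ) (hne : ∀ k ∈ Finset.range n, excess n k μ ≠ 0) :
    ∃ ε > 0, ∀ c : ℝ → Coeff, Sol c → ‖c 0‖ = 1 → ∀ t, ‖offMode n (c t)‖ ≤ ε →
      ∃ V' : ℝ, HasDerivAt (fun t => growthForm n μ (c t)) V' t ∧
        μ / (2 * Real.pi) * growthForm n μ (c t) ≤ V' := by
  obtain ⟨κ, hκ, hκμ, hκk⟩ : ∃ κ > 0, κ ≤ μ ∧ ∀ k ∈ Finset.range n, κ ≤ excess n k μ ^ 2 := by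
    rcases (Finset.range n).eq_empty_or_nonempty with h | h
    · exact ⟨μ, hμ, le_rfl, by simp [h]⟩
    · obtain ⟨k₀, hk₀, h₀⟩ := Finset.exists_min_image _ (fun k => excess n k μ ^ 2) h
      exact ⟨min μ (excess n k₀ μ ^ 2), lt_min hμ (sq_pos_of_ne_zero (hne k₀ hk₀)), min_le_left _ _,
        fun k hk => (min_le_right _ _).trans (h₀ k hk)⟩
  set K := ∑ k ∈ Finset.range n, |excess n k μ| * modeConst n k μ + 8 with hK
  have hK0 : 0 < K := by
    have : 0 ≤ ∑ k ∈ Finset.range n, |excess n k μ| * modeConst n k μ :=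
      Finset.sum_nonneg fun k _ => mul_nonneg (abs_nonneg _) (modeConst_nonneg n k μ)
    linarith
  refine ⟨κ / K, by positivity, fun c hc hc0 t ht => ?_⟩
  have hct : ‖c t‖ = 1 := (hc.norm_eq t).trans hc0
  choose! V' hV' hV'' using fun k (hk : k ∈ Finset.range n) =>
    hc.exists_hasDerivAt_modeForm hμ.ne' (Finset.mem_range.1 hk) hct
  obtain ⟨W', hW', hW''⟩ := hc.exists_hasDerivAt_tail (n := n) hct
  refine ⟨∑ k ∈ Finset.range n, excess n k μ * V' k - W',
    (HasDerivAt.fun_sum fun k hk => (hV' k hk).const_mul _).sub hW', ?_⟩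
  set ν := ‖offMode n (c t)‖ with hν
  set S : ℕ → ℝ := fun k => ‖c t (n + k + 1)‖ ^ 2 + ‖c t (n - (k + 1))‖ ^ 2 with hS
  have hsum : ∑ k ∈ Finset.range n, (μ * (excess n k μ * modeForm n k μ (c t)) + κ * S k -
      |excess n k μ| * modeConst n k μ * ν ^ 3) ≤
      ∑ k ∈ Finset.range n, 2 * Real.pi * (excess n k μ * V' k) := by
    refine Finset.sum_le_sum fun k hk => ?_
    have h1 : |excess n k μ * (2 * Real.pi * V' k - μ * modeForm n k μ (c t) -
        excess n k μ * S k)| ≤ |excess n k μ| * (modeConst n k μ * ν ^ 3) := by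
      rw [abs_mul]
      gcongr
      exact hV'' k hk
    have h2 := (abs_le.1 h1).1
    have h3 : κ * S k ≤ excess n k μ ^ 2 * S k := by
      have := hκk k hk
      have : 0 ≤ S k := by rw [hS]; positivity
      gcongr
    linarith
  rw [Finset.sum_sub_distrib, Finset.sum_add_distrib, ← Finset.mul_sum, ← Finset.mul_sum,
    ← Finset.mul_sum, ← Finset.sum_mul] at hsum
  have hνsum : ν ^ 2 = ∑ k ∈ Finset.range n, S k + ‖tail (2 * n + 1) (c t)‖ ^ 2 :=
    norm_offMode_sq_eq_sum n (c t)
  have hW := (abs_le.1 hW'').2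
  have hsmall : K * ν ^ 3 ≤ κ * ν ^ 2 := by
    have h1 : K * ν ≤ κ := by rwa [le_div_iff₀ hK0, mul_comm] at ht
    calc K * ν ^ 3 = K * ν * ν ^ 2 := by ring
      _ ≤ κ * ν ^ 2 := by gcongr
  have htail : κ * ‖tail (2 * n + 1) (c t)‖ ^ 2 ≤ μ * ‖tail (2 * n + 1) (c t)‖ ^ 2 := by gcongr
  have hKν : K * ν ^ 3 = (∑ k ∈ Finset.range n, |excess n k μ| * modeConst n k μ) * ν ^ 3 +
      8 * ν ^ 3 := by rw [hK]; ring
  rw [hνsum, mul_add] at hsmall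
  have hfin : μ * growthForm n μ (c t) ≤
      2 * Real.pi * (∑ k ∈ Finset.range n, excess n k μ * V' k - W') := by
    rw [growthForm]
    linarith
  rw [div_mul_eq_mul_div, div_le_iff₀ (by positivity)]
  linarith

/-- The instability of `hermite n` in the frame of `hermite n`. -/
theorem exists_escape {n : ℕ} (hn : 2 ≤ n) :
    ∃ ε > 0, ∀ c : ℝ → Coeff, Sol c → ‖c 0‖ = 1 →
      (∀ j, j ≠ n → j ≠ n + 2 → c 0 j = 0) → c 0 (n + 2) ≠ 0 → ∃ t, ε < ‖offMode n (c t)‖ := by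
  obtain ⟨μ, hμ, hne, h1⟩ := exists_rate hn
  obtain ⟨ε, hε, hV⟩ := exists_growth hμ hne
  obtain ⟨K, hK⟩ := exists_abs_growthForm_le n μ
  refine ⟨ε, hε, fun c hc hc0 hsupp h2 => ?_⟩
  by_contra! hle
  choose V' hV' hV'' using fun t => hV c hc hc0 t (hle t)
  set l := μ / (2 * Real.pi) with hl
  have hl0 : 0 < l := by positivity
  -- Initially only one mode of the pair `k = 1` is excited, so its form reduces to a positive
  -- multiple of `‖c 0 (n + 2)‖²`.
  have hpos : 0 < growthForm n μ (c 0) := by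
    have htail : ‖tail (2 * n + 1) (c 0)‖ ^ 2 = 0 := by
      have : tail (2 * n + 1) (c 0) = 0 := by
        ext j
        rw [tail_apply]
        split_ifs with hj
        · rfl
        · exact hsupp j (by omega) (by omega)
      rw [this, norm_zero, sq, zero_mul]
    rw [growthForm, htail, sub_zero, Finset.sum_eq_single 1]
    · rw [modeForm, pairForm, hsupp (n - (1 + 1)) (by omega) (by omega)]
      have := coupling_pos n 1
      have h3 : 0 < ‖c 0 (n + 1 + 1)‖ := norm_pos_iff.2 h2
      simp only [mul_zero, map_zero, zero_mul, Complex.zero_re, Complex.zero_im, norm_zero]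
      have : 0 < detuning n 1 ^ 2 + μ ^ 2 := by positivity
      positivity
    · intro k hk hk1
      rw [modeForm, pairForm, hsupp (n - (k + 1)) (by have := Finset.mem_range.1 hk; omega)
        (by omega), hsupp (n + k + 1) (by omega) (by omega)]
      simp
    · intro h
      exact absurd (Finset.mem_range.2 (by omega)) h
  -- The form would grow exponentially forever, although it is bounded on the unit sphere.
  have hmono : Monotone fun t => Real.exp (-(l * t)) * growthForm n μ (c t) := by
    have hd : ∀ t, HasDerivAt (fun t => Real.exp (-(l * t)) * growthForm n μ (c t))
        (Real.exp (-(l * t)) * -(l * 1) * growthForm n μ (c t) + Real.exp (-(l * t)) * V' t) t :=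
      fun t => (((hasDerivAt_id t).const_mul l).neg.exp).mul (hV' t)
    refine monotone_of_hasDerivAt_nonneg hd fun t => ?_
    have := mul_le_mul_of_nonneg_left (hV'' t) (Real.exp_pos (-(l * t))).le
    simp only [Pi.zero_apply]
    linarith
  have hbound : ∀ t ≥ 0, growthForm n μ (c 0) * (l * t) ≤ K := by
    intro t ht
    have h3 := hmono ht
    simp only [mul_zero, neg_zero, Real.exp_zero, one_mul] at h3
    have h4 := (le_abs_self _).trans (hK (c t) ((hc.norm_eq t).trans hc0))
    have h5 : growthForm n μ (c 0) * Real.exp (l * t) ≤ growthForm n μ (c t) := by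
      rw [Real.exp_neg, ← div_eq_inv_mul, le_div_iff₀ (Real.exp_pos _)] at h3
      exact h3
    have h6 : l * t ≤ Real.exp (l * t) := by linarith [Real.add_one_le_exp (l * t)]
    exact ((mul_le_mul_of_nonneg_left h6 hpos.le).trans h5).trans h4
  have hK0 : 0 ≤ K := (abs_nonneg _).trans (hK _ hc0)
  have h3 := hbound ((K + 1) / (growthForm n μ (c 0) * l)) (by positivity)
  have h4 : growthForm n μ (c 0) * (l * ((K + 1) / (growthForm n μ (c 0) * l))) = K + 1 := by
    field_simp
  linarith

end


/-! ### Instability -/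

theorem Sol.parity {c : ℝ → Coeff} (hc : Sol c) (n : ℕ) : Sol fun t => LLL.parity n (c t) := by
  let L : Coeff →ₗ[ℂ] Coeff :=
    { toFun := LLL.parity n
      map_add' := fun x y => by
        ext m
        rw [Coeff.add_apply, parity_apply, parity_apply, parity_apply, Coeff.add_apply, mul_add]
      map_smul' := fun a x => by
        ext m
        rw [RingHom.id_apply, Coeff.smul_apply, parity_apply, parity_apply, Coeff.smul_apply,
          mul_left_comm] }
  have hL : ∀ x, ‖L x‖ ≤ 1 * ‖x‖ := fun x => by
    have h := norm_parity_sub n x 0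
    have h0 : LLL.parity n 0 = 0 := L.map_zero
    rw [h0, sub_zero, sub_zero] at h
    rw [one_mul]
    exact h.le
  intro t
  have h := ((L.mkContinuous 1 hL).restrictScalars ℝ).hasFDerivAt.comp_hasDerivAt t (hc t)
  rw [nonlin_parity]
  convert! h using 1
  exact (L.map_smul _ _).symm

theorem parity_trans_hermite (n : ℕ) (β : ℂ) :
    parity n (trans β (hermite n)) = trans (-β) (hermite n) := by
  ext m
  rw [parity_apply, trans_hermite_coeff, trans_hermite_coeff, norm_neg, mul_left_comm,
    Finset.mul_sum]
  congr 1
  refine Finset.sum_congr rfl fun p hp => ?_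
  have hp := Finset.HasAntidiagonal.mem_antidiagonal.1 hp
  by_cases h : p.2 ≤ n
  · have h1 : ((-1 : ℂ) ^ (n + m)) = (-1) ^ p.1 * (-1) ^ (n - p.2) := by
      rw [← hp, ← pow_add, show n + (p.1 + p.2) = (p.1 + (n - p.2)) + 2 * p.2 by omega, pow_add,
        pow_mul (-1 : ℂ) 2]
      simp
    rw [h1, map_neg, neg_pow (-conj β), neg_pow β]
    ring
  · rw [Nat.choose_eq_zero_of_lt (by omega)]
    simp

theorem norm_trans_hermite_sub_sq (β : ℂ) (n : ℕ) : ‖trans β (hermite n) - hermite n‖ ^ 2 =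
    2 - 2 * (trans β (hermite n) n).re := by
  rw [norm_sub_sq (𝕜 := ℂ), LinearIsometry.norm_map, norm_hermite, ← inner_conj_symm, inner_hermite]
  simp
  ring

/-- For `n ≠ 0` the only zero of the Hermite function is the origin, and a translation moves it. -/
theorem eq_zero_of_trans_hermite_eq {n : ℕ} (hn : n ≠ 0) {β : ℂ}
    (h : trans β (hermite n) = hermite n) : β = 0 := by
  have h1 := entire_trans β (hermite n) 0
  rw [h, entire_hermite, entire_hermite, zero_pow hn, zero_add, mul_zero] at h1
  have h2 := (mul_eq_zero.1 h1.symm).resolve_left (Complex.exp_ne_zero _)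
  have h3 : (√(Real.pi * n.factorial) : ℝ) ≠ 0 := (Real.sqrt_pos.2 (by positivity)).ne'
  exact (pow_eq_zero_iff hn).1 ((mul_eq_zero.1 h2).resolve_left
    (Complex.ofReal_ne_zero.2 (one_div_ne_zero h3)))

/-- A translate of `hermite n` is close to `hermite n` only if the translation is small. -/
theorem exists_norm_lt_of_trans_hermite {n : ℕ} (hn : n ≠ 0) {η : ℝ} (hη : 0 < η) :
    ∃ κ > 0, ∀ β : ℂ, ‖trans β (hermite n) - hermite n‖ < κ → ‖β‖ < η := by
  set H : ℝ → ℝ := fun x => Real.exp (-x / 2) *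
    ∑ j ∈ Finset.range (n + 1), n.choose j * (-x) ^ j / j.factorial with hH
  have hHc : Continuous H := by rw [hH]; fun_prop
  have hsq : ∀ β : ℂ, ‖trans β (hermite n) - hermite n‖ ^ 2 = 2 - 2 * H (‖β‖ ^ 2) := fun β => by
    rw [norm_trans_hermite_sub_sq, trans_hermite_coeff_self, Complex.ofReal_re]
  have hlim : Tendsto H atTop (𝓝 0) := by
    have h1 : ∀ j : ℕ, Tendsto (fun x : ℝ => (n.choose j * (-1) ^ j / j.factorial : ℝ) *
        (x ^ j / Real.exp (1 / 2 * x))) atTop (𝓝 0) := fun j => by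
      simpa using ((isLittleO_pow_exp_pos_mul_atTop (b := 1 / 2) j
        (by norm_num)).tendsto_div_nhds_zero).const_mul (n.choose j * (-1) ^ j / j.factorial : ℝ)
    have h2 := tendsto_finsetSum (Finset.range (n + 1)) fun j _ => h1 j
    rw [Finset.sum_const_zero] at h2
    refine h2.congr fun x => ?_
    rw [hH]
    simp only [Finset.mul_sum]
    refine Finset.sum_congr rfl fun j _ => ?_
    rw [show -x / 2 = -(1 / 2 * x) by ring, Real.exp_neg, neg_pow]
    ring
  have hlt : ∀ x > 0, H x < 1 := fun x hx => by
    have h1 : ‖(√x : ℂ)‖ ^ 2 = x := by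
      rw [Complex.norm_real, Real.norm_eq_abs, sq_abs, Real.sq_sqrt hx.le]
    have h2 := hsq (√x : ℂ)
    rw [h1] at h2
    have h3 : 0 < ‖trans (√x : ℂ) (hermite n) - hermite n‖ := by
      rw [norm_pos_iff, sub_ne_zero]
      intro h
      have := eq_zero_of_trans_hermite_eq hn h
      exact (Real.sqrt_pos.2 hx).ne' (by exact_mod_cast this)
    have := pow_pos h3 2
    linarith
  obtain ⟨X, hX⟩ := eventually_atTop.1 (hlim.eventually (gt_mem_nhds (show (0 : ℝ) < 1 / 2 by norm_num)))
  -- Beyond `X` the overlap is below `1 / 2`; on the remaining compact range its maximum is below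
  -- one.
  obtain ⟨x₀, hx₀, hmax⟩ := isCompact_Icc.exists_isMaxOn
    (Set.nonempty_Icc.2 (le_max_left (η ^ 2) X)) hHc.continuousOn
  have hx₀' : H x₀ < 1 := hlt x₀ ((pow_pos hη 2).trans_le hx₀.1)
  have hM : ∀ x ≥ η ^ 2, H x ≤ max (1 / 2) (H x₀) := fun x hx => by
    rcases le_total x X with h | h
    · exact (hmax ⟨hx, h.trans (le_max_right _ _)⟩).trans (le_max_right _ _)
    · exact (hX x h).le.trans (le_max_left _ _)
  have hM1 : max (1 / 2) (H x₀) < 1 := max_lt (by norm_num) hx₀'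
  refine ⟨√(2 - 2 * max (1 / 2) (H x₀)), Real.sqrt_pos.2 (by linarith), fun β hβ => ?_⟩
  by_contra! h
  have h1 := hM (‖β‖ ^ 2) (by gcongr)
  rw [Real.lt_sqrt (norm_nonneg _), hsq] at hβ
  linarith

/-- Solutions close to `hermite n` and leaving its orbit. -/
theorem exists_unstable {n : ℕ} (hn : 2 ≤ n) : ∃ ε > 0, ∀ δ > 0, ∃ c : ℝ → Coeff, Sol c ∧
    normL21 (fock (c 0 - hermite n)) ≤ ENNReal.ofReal δ ∧
      ∃ t, ∀ (ω β : ℂ), ‖ω‖ = 1 → ε < ‖c t - ω • trans β (hermite n)‖ := by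
  obtain ⟨ε₀, hε₀, hesc⟩ := exists_escape hn
  set K : ℝ := 1 + 2 * 2 ^ n with hK
  have hK1 : 1 ≤ K := by have : (0 : ℝ) < 2 ^ n := by positivity
                         linarith
  obtain ⟨κ, hκ, htr⟩ := exists_norm_lt_of_trans_hermite (n := n) (by omega)
    (show 0 < min 1 (ε₀ / (4 * K)) by positivity)
  refine ⟨min (ε₀ / 4) (κ / 3), by positivity, fun δ hδ => ?_⟩
  set s : ℝ := √(n + 2 + 1) with hs
  have hs0 : 0 ≤ s := Real.sqrt_nonneg _
  set η : ℝ := min (1 / 2) (δ / (2 + 2 * s)) with hη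
  have hη0 : 0 < η := by positivity
  have hη1 : η ≤ 1 / 2 := min_le_left _ _
  have hηδ : η * (2 + 2 * s) ≤ δ := by
    rw [← le_div_iff₀ (by positivity)]; exact min_le_right _ _
  -- This puts the datum on the unit sphere, as `exists_escape` demands.
  set l : ℝ := √(1 - η ^ 2) with hl
  have hη2 : η ^ 2 ≤ η := by rw [sq]; exact mul_le_of_le_one_left hη0.le (by linarith)
  have hl2 : l ^ 2 = 1 - η ^ 2 := Real.sq_sqrt (by linarith)
  have hl0 : 0 ≤ l := Real.sqrt_nonneg _
  have hl1 : l ≤ 1 := (sq_le_one_iff₀ hl0).1 (by rw [hl2]; linarith [sq_nonneg η])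
  have hlη : 1 - l ≤ η := by
    have : l ^ 2 ≤ l := by rw [sq]; exact mul_le_of_le_one_left hl0 hl1
    linarith
  obtain ⟨c, hc, hc0⟩ := exists_sol_of_init ((l : ℂ) • hermite n + (η : ℂ) • hermite (n + 2))
  have hn2 : ((η : ℂ) • hermite (n + 2)) n = 0 := by
    rw [Coeff.smul_apply, hermite_ne (by omega), mul_zero]
  have hnorm : ‖c 0‖ = 1 := by
    rw [← sq_eq_sq₀ (norm_nonneg _) zero_le_one, hc0, norm_smul_hermite_add_sq hn2, norm_smul,
      norm_hermite, Complex.norm_real, Complex.norm_real, Real.norm_eq_abs, Real.norm_eq_abs, sq_abs,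
      mul_one, sq_abs, hl2]
    ring
  refine ⟨c, hc, ?_, ?_⟩
  · have e : c 0 - hermite n = ((l - 1 : ℝ) : ℂ) • hermite n + (η : ℂ) • hermite (n + 2) := by
      rw [hc0, Complex.ofReal_sub, Complex.ofReal_one, sub_smul, one_smul]; abel
    have hr := ((raise_hermite n).smul ((l - 1 : ℝ) : ℂ)).add ((raise_hermite (n + 2)).smul (η : ℂ))
    rw [e]
    have hl' : |l - 1| ≤ η := by rw [abs_of_nonpos (by linarith)]; linarith
    have hsn : √(n + 1 : ℝ) ≤ s := Real.sqrt_le_sqrt (by linarith)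
    have hs' : √(((n + 2 : ℕ) : ℝ) + 1) = s := by rw [hs]; push_cast; rfl
    refine (hr.normL21_le (x := 2 * η) (y := 2 * η * s) ?_ ?_).trans
      (ENNReal.ofReal_le_ofReal (by linarith))
    · refine (norm_add_le _ _).trans ?_
      rw [norm_smul, norm_smul, norm_hermite, norm_hermite, Complex.norm_real, Complex.norm_real,
        Real.norm_eq_abs, Real.norm_eq_abs, abs_of_pos hη0]
      linarith
    · refine (norm_add_le _ _).trans ?_
      rw [norm_smul, norm_smul, norm_smul, norm_smul, norm_hermite, norm_hermite, Complex.norm_real,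
        Complex.norm_real, Complex.norm_real, Complex.norm_real, Real.norm_eq_abs, Real.norm_eq_abs,
        Real.norm_eq_abs, Real.norm_eq_abs, abs_of_pos hη0, abs_of_nonneg (Real.sqrt_nonneg _),
        abs_of_nonneg (Real.sqrt_nonneg _), hs', mul_one, mul_one]
      have : |l - 1| * √(n + 1 : ℝ) ≤ η * s := by gcongr
      linarith
  · obtain ⟨t, ht⟩ := hesc c hc hnorm (fun j hj hj' => by
      rw [hc0, Coeff.add_apply, Coeff.smul_apply, Coeff.smul_apply, hermite_ne hj, hermite_ne hj',
        mul_zero, mul_zero, add_zero]) (by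
      rw [hc0, Coeff.add_apply, Coeff.smul_apply, Coeff.smul_apply, hermite_ne (by omega),
        hermite_self, mul_zero, mul_one, zero_add]
      exact Complex.ofReal_ne_zero.2 hη0.ne')
    refine ⟨t, fun ω β hω => ?_⟩
    by_contra! hle
    have hle1 := hle.trans (min_le_left _ _)
    have hle2 := hle.trans (min_le_right _ _)
    -- The two excited modes have the same parity, and uniqueness propagates the symmetry.
    have hpar : parity n (c t) = c t := by
      refine (hc.parity n).eq_of_eq_zero hc ?_ t
      ext m
      simp only [parity_apply, hc0]
      rw [Coeff.add_apply, Coeff.smul_apply, Coeff.smul_apply]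
      by_cases h1 : m = n
      · rw [h1, ← two_mul, pow_mul]; simp
      · by_cases h2 : m = n + 2
        · rw [h2, show n + (n + 2) = 2 * (n + 1) by ring, pow_mul]; simp
        · rw [hermite_ne h1, hermite_ne h2]; simp
    have hneg : ‖c t - ω • trans (-β) (hermite n)‖ ≤ κ / 3 := by
      have h1 := norm_parity_sub n (c t) (ω • trans β (hermite n))
      have h2 : parity n (ω • trans β (hermite n)) = ω • trans (-β) (hermite n) := by
        rw [← parity_trans_hermite]
        ext m
        rw [parity_apply, Coeff.smul_apply, Coeff.smul_apply, parity_apply, mul_left_comm]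
      rw [hpar, h2] at h1
      exact h1.le.trans hle2
    -- The solution is close to the translates by `β` and by `-β` with the same `ω`, so these are
    -- close to each other; this forces `β` to be small.
    have hdist : ‖trans (β + β) (hermite n) - hermite n‖ < κ := by
      have h1 : trans (β + β) (hermite n) - hermite n =
          trans β (trans β (hermite n) - trans (-β) (hermite n)) := by
        rw [map_sub, trans_trans_neg, trans_trans, mul_comm β, sub_self, zero_div, Complex.exp_zero,
          one_smul]
      have h2 : ‖ω • (trans β (hermite n) - trans (-β) (hermite n))‖ ≤ κ / 3 + κ / 3 := by
        have e : ω • (trans β (hermite n) - trans (-β) (hermite n)) =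
            (c t - ω • trans (-β) (hermite n)) - (c t - ω • trans β (hermite n)) := by
          rw [smul_sub]; abel
        rw [e]
        exact (norm_sub_le _ _).trans (add_le_add hneg hle2)
      rw [norm_smul, hω, one_mul] at h2
      rw [h1, LinearIsometry.norm_map]
      linarith
    have h2β := htr _ hdist
    rw [← two_mul, norm_mul, Complex.norm_ofNat] at h2β
    have hβ1 : ‖β‖ ≤ 1 := by linarith [norm_nonneg β, min_le_left 1 (ε₀ / (4 * K))]
    have hβ2 : K * ‖β‖ ≤ ε₀ / 4 := by
      have h1 : ‖β‖ ≤ ε₀ / (4 * K) := by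
        linarith [norm_nonneg β, min_le_right 1 (ε₀ / (4 * K))]
      calc K * ‖β‖ ≤ K * (ε₀ / (4 * K)) := by gcongr
        _ = ε₀ / 4 := by field_simp
    have hclose : ‖trans β (hermite n) - hermite n‖ ≤ ε₀ / 4 := by
      refine le_trans ?_ hβ2
      refine (abs_le_of_sq_le_sq' ?_ (by positivity)).2
      refine (norm_trans_hermite_sub_sq_le hβ1 n).trans ?_
      rw [mul_pow, ← hK]
      have : K ≤ K ^ 2 := by rw [sq]; exact le_mul_of_one_le_left (by linarith) hK1
      gcongr
    have hfin : ‖c t - ω • hermite n‖ ≤ ε₀ / 2 := by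
      have e : c t - ω • hermite n = (c t - ω • trans β (hermite n)) +
          ω • (trans β (hermite n) - hermite n) := by rw [smul_sub]; abel
      rw [e]
      refine (norm_add_le _ _).trans ?_
      rw [norm_smul, hω, one_mul]
      linarith
    have hoff : offMode n (c t) = offMode n (c t - ω • hermite n) := by
      rw [offMode, offMode, lp.coeFn_sub, Pi.sub_apply, Coeff.smul_apply, hermite_self]
      module
    have hoff2 : ‖offMode n (c t - ω • hermite n)‖ ≤ ‖c t - ω • hermite n‖ := by
      refine (abs_le_of_sq_le_sq' ?_ (norm_nonneg _)).2
      rw [norm_offMode_sq]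
      linarith [sq_nonneg ‖(c t - ω • hermite n) n‖]
    rw [hoff] at ht
    linarith


theorem normL2_le_normL21 (u : ℂ → ℂ) : normL2 u ≤ normL21 u := by
  refine eLpNorm_mono fun z => ?_
  have h : 1 ≤ √(1 + ‖z‖ ^ 2) := Real.one_le_sqrt.2 (by linarith [sq_nonneg ‖z‖])
  rw [norm_mul, Complex.norm_real, Real.norm_eq_abs, abs_of_nonneg (Real.sqrt_nonneg _)]
  exact le_mul_of_one_le_left (norm_nonneg _) h

theorem spaceRot_smul (s : ℝ) (ω : ℂ) (c : Coeff) :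
    spaceRot s (fock (ω • c)) = ω • spaceRot s (fock c) := by
  ext z
  simp only [spaceRot, fock_smul, Pi.smul_apply, smul_eq_mul]

theorem spaceRot_hermite (s : ℝ) (n : ℕ) : spaceRot s (fock (hermite n)) =
    fock (Complex.exp (Complex.I * s) ^ n • hermite n) := by
  ext z
  rw [spaceRot, fock_smul, fock_eq, fock_eq, norm_exp_I_mul_z, entire_hermite, entire_hermite]
  ring

/-- The group orbit of `phi n α` in coordinates. -/
theorem exists_of_mem_fullOrbit_phi {n : ℕ} {α : ℂ} {w : ℂ → ℂ} (hw : w ∈ fullOrbit (phi n α)) :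
    ∃ ω β : ℂ, ‖ω‖ = 1 ∧ w = fock (ω • trans β (hermite n)) := by
  obtain ⟨θ, s, β, rfl⟩ := hw
  refine ⟨Complex.exp (Complex.I * θ) * (Complex.exp ((conj β * (-conj α) - β * conj (-conj α)) / 2) *
    Complex.exp (Complex.I * s) ^ n), Complex.exp (-(Complex.I * s)) * (β + -conj α), ?_, ?_⟩
  · rw [norm_mul, norm_mul, norm_pow, norm_exp_I_mul, norm_exp_I_mul, norm_exp_twist, one_pow,
      one_mul, one_mul]
  · rw [phi_eq, ← fock_trans, trans_trans, spaceRot_smul, fock_trans, spaceRot_magTrans,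
      spaceRot_hermite, ← fock_trans, map_smul]
    ext z
    simp only [phaseRot, Pi.smul_apply, smul_eq_mul, fock_smul]
    ring

/-- The data are close in the stronger norm and the escape is measured in the weaker one, so every
intermediate norm is covered. Translation of the solution reduces to `α = 0`. -/
theorem not_orbitallyStable {N : (ℂ → ℂ) → ℝ≥0∞} (hN : ∀ u, normL2 u ≤ N u)
    (hN' : ∀ u, N u ≤ normL21 u) {n : ℕ} (hn : 2 ≤ n) (α : ℂ) :
    ¬ OrbitallyStable N (fullOrbit (phi n α)) (phi n α) := by
  intro hst
  obtain ⟨ε, hε, H⟩ := exists_unstable hn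
  obtain ⟨δ, hδ, hδ'⟩ := hst (ε / 2) (by positivity)
  obtain ⟨c, hc, hc0, t, ht⟩ := H (δ / (2 + ‖-conj α‖)) (by positivity)
  have hclose : N (fock (trans (-conj α) (c 0)) - phi n α) ≤ ENNReal.ofReal δ := by
    rw [phi_eq, fock_sub_fun, ← map_sub]
    refine (hN' _).trans ((normL21_fock_trans_le (by positivity) hc0 _).trans (le_of_eq ?_))
    congr 1
    field_simp
  have h := hδ' _ _ (hc.trans (-conj α)).isSolution hclose t
  have hge : ENNReal.ofReal ε ≤ ENNReal.ofReal (ε / 2) := by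
    refine le_trans (le_iInf₂ fun w hw => ?_) h
    obtain ⟨ω, β, hω, rfl⟩ := exists_of_mem_fullOrbit_phi hw
    refine le_trans ?_ (hN _)
    rw [fock_sub_fun, normL2_fock, ← (trans (conj α)).norm_map, map_sub, trans_trans_neg, map_smul,
      trans_trans, smul_smul]
    refine ENNReal.ofReal_le_ofReal (ht _ _ ?_).le
    rw [norm_mul, hω, norm_exp_twist, one_mul]
  rw [ENNReal.ofReal_le_ofReal_iff (by positivity)] at hge
  linarith

end

end LLL

theorem mainTheorem2 :
    -- (i) `φ_0^α` in `L²`, up to phase rotations and magnetic translations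
    (∃ C > (0 : ℝ), ∃ δ₀ > (0 : ℝ), ∀ α : ℂ,
      ∀ u₀ u, LLL.IsSolution u₀ u → ∀ δ : ℝ, 0 ≤ δ → δ ≤ δ₀ →
        LLL.normL2 (u₀ - LLL.phi 0 α) = ENNReal.ofReal δ →
        (⨆ t : ℝ, ⨅ (θ : ℝ) (β : ℂ), LLL.normL2 (u t - LLL.phaseRot θ (LLL.phi 0 β)))
          ≤ ENNReal.ofReal (C * √δ)) ∧
    -- (ii) `φ_0^α` and `φ_1^α` in `L^{2,1}`, up to phase rotations
    (∀ α : ℂ, ∃ C > (0 : ℝ), ∃ δ₀ > (0 : ℝ), ∀ j : ℕ, (j = 0 ∨ j = 1) →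
      ∀ u₀ u, LLL.IsSolution u₀ u → ∀ δ : ℝ, 0 ≤ δ → δ ≤ δ₀ →
        LLL.normL21 (u₀ - LLL.phi j α) = ENNReal.ofReal δ →
        (⨆ t : ℝ, ⨅ θ : ℝ, LLL.normL21 (u t - LLL.phaseRot θ (LLL.phi j α)))
          ≤ ENNReal.ofReal (C * √δ)) ∧
    -- (iii) `ψ_b` in `L^{2,1}`, up to phase and space rotations
    (∀ b : ℝ, 0 ≤ b → ∃ C > (0 : ℝ), ∃ δ₀ > (0 : ℝ),
      ∀ u₀ u, LLL.IsSolution u₀ u → ∀ δ : ℝ, 0 ≤ δ → δ ≤ δ₀ →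
        LLL.normL21 (u₀ - LLL.psi b) = ENNReal.ofReal δ →
        (⨆ t : ℝ, ⨅ (θ : ℝ) (s : ℝ),
            LLL.normL21 (u t - LLL.phaseRot θ (LLL.spaceRot s (LLL.psi b))))
          ≤ ENNReal.ofReal (C * √δ)) ∧
    -- (iv) the three-dimensional family, in `L^{2,1}`, up to all symmetries
    (∀ lam mu al : ℂ, lam ≠ 0 → ∀ v₀ : ℂ → ℂ,
      (∀ z, v₀ z = (lam * z + mu) * Complex.exp (al * z - (‖z‖ ^ 2 : ℝ) / 2)) →
      ∃ b : ℝ, 0 ≤ b ∧ ∃ c : ℝ, 0 < c ∧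
        (∃ w ∈ LLL.fullOrbit (LLL.psi b), v₀ = (c : ℂ) • w) ∧
        ∃ C > (0 : ℝ), ∃ δ₀ > (0 : ℝ),
          ∀ u₀ u, LLL.IsSolution u₀ u → ∀ δ : ℝ, 0 ≤ δ → δ ≤ δ₀ →
            LLL.normL21 (u₀ - v₀) = ENNReal.ofReal δ →
            (⨆ t : ℝ, ⨅ (θ : ℝ) (s : ℝ) (β : ℂ),
                LLL.normL21 (u t -
                  (c : ℂ) • LLL.phaseRot θ (LLL.spaceRot s (LLL.magTrans β (LLL.psi b)))))
              ≤ ENNReal.ofReal (C * √δ)) ∧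
    -- (v) `φ_n^α` with `n ≥ 2`: unstable even up to all symmetries
    (∀ n : ℕ, 2 ≤ n → ∀ α : ℂ,
      ¬ LLL.OrbitallyStable LLL.normL2 (LLL.fullOrbit (LLL.phi n α)) (LLL.phi n α) ∧
      ¬ LLL.OrbitallyStable LLL.normL21 (LLL.fullOrbit (LLL.phi n α)) (LLL.phi n α)) :=
  ⟨LLL.stability_one, LLL.stability_two, LLL.stability_three, LLL.stability_four,
    fun _ hn α => ⟨LLL.not_orbitallyStable (fun _ => le_rfl) LLL.normL2_le_normL21 hn α,
      LLL.not_orbitallyStable LLL.normL2_le_normL21 (fun _ => le_rfl) hn α⟩⟩
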